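/- **Setting.** Let $Y=(Y_{ij})_{i,j\ge 1}$ be a dissociated row-column exchangeable matrix given by an Aldous--Hoover--Kallenberg representation $Y_{ij}=\phi(\xi_i,\eta_j,\zeta_{ij})$ a.s., where $\phi$ is measurable and all the variables $\xi_i,\eta_j,\zeta_{ij}$ are i.i.d. uniform on $[0,1]$. Let $h:\mathcal M_{p,q}(\mathbb R)\to\mathbb R$ be measurable, invariant under separate permutations of rows and of columns, with $h(Y_{[p],[q]})\in L^2$, and let $$U_{m,n}=\binom mp^{-1}\binom nq^{-1}\sum_{I\subseteq[m],\,|I|=p}\ \sum_{J\subseteq[n],\,|J|=q}h(Y_{I,J}),$$ where $Y_{I,J}$ is the submatrix with rows $I$ and columns $J$. **Projections.** For a finite bipartite graph $G=(V_1,V_2,E)$ with $E\subseteq V_1\times V_2$, row nodes and column nodes in $\{1,2,\dots\}$, let $v_i(G)=|V_i|$, let $H(G)$ be the family of the variables $\xi_i$ $(i\in V_1)$, $\eta_j$ $(j\in V_2)$, $\zeta_{ij}$ $((i,j)\in E)$, and let $K_{I,J}=(I,J,I\times J)$. For $G\subseteq K_{I,J}$ with $|I|=p$, $|J|=q$, define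 recursively $$p^G=\mathbb E[h(Y_{I,J})\mid H(G)]-\sum_{F\subsetneq G}p^F ,$$ the sum being over proper subgraphs; up to a.s. equality this does not depend on $(I,J)$, and $p^\emptyset=\mathbb E[h(Y_{[p],[q]})]$. For $(0,0)\neq(r,c)\le(p,q)$ let $$V^{(r,c)}=\frac{p!^2q!^2}{(p-r)!^2(q-c)!^2}\sum_{G\in\Gamma_{r,c}}|\mathrm{Aut}(G)|^{-1}\,\mathbb E[(p^G)^2],$$ where $\Gamma_{r,c}$ contains one representative of each isomorphism class of subgraphs of $K_{[r],[c]}$ with $r$ row and $c$ column nodes (isomorphisms map rows to rows and columns to columns). **Asymptotics.** Let $m_N\to\infty$ and $n_N\to\infty$ at arbitrary rates, and $U_N=U_{m_N,n_N}$. Let $(r_\ell,c_\ell)_{1\le\ell\le L}$ be the principal degrees of $U_N$, that is, distinct pairs with $(0,0)\ne(r_\ell,c_\ell)\le(p,q)$ such that $m_N^{r_1}n_N^{c_1}\asymp\dots\asymp m_N^{r_L}n_N^{c_L}$ and $\mathbb V[U_N]\asymp\sum_{\ell}V^{(r_\ell,c_\ell)}m_N^{-r_\ell}n_N^{-c_\ell}$.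 Let $\gamma(N)$ be a normalization and $\alpha_1,\dots,\alpha_L>0$ be such that $$\gamma(N)\,m_N^{-r_\ell}n_N^{-c_\ell}\to\alpha_\ell\quad(1\le\ell\le L),\qquad \gamma(N)\,\mathbb V[U_N]=\sum_{\ell=1}^L\alpha_\ell V^{(r_\ell,c_\ell)}+o(1).$$ The principal support graphs of $U_N$ are the graphs $G$ with $(v_1(G),v_2(G))\in\{(r_\ell,c_\ell):1\le\ell\le L\}$ and $p^G\ne0$ (not a.s. zero). **Theorem.** If all principal support graphs of $U_N$ are connected, then $$\sqrt{\gamma(N)}\,(U_N-p^\emptyset)\xrightarrow[N\to\infty]{\mathcal D}\mathcal N(0,\sigma^2),\qquad \sigma^2=\sum_{\ell=1}^L\alpha_\ell V^{(r_\ell,c_\ell)} .$$ -/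

import Mathlib

open MeasureTheory ProbabilityTheory Filter Topology Asymptotics

noncomputable section

namespace RCE

/-! ### Finite bipartite graphs -/

/-- A finite bipartite graph `(V₁, V₂, E)` with row nodes and column nodes labelled by natural
numbers and `E ⊆ V₁ × V₂`. -/
@[ext]
structure BipGraph where
  rows : Finset ℕ
  cols : Finset ℕ
  edges : Finset (ℕ × ℕ)
  edges_subset : edges ⊆ rows ×ˢ cols

namespace BipGraph

/-- `F ≤ G` means that `F` is a subgraph of `G`: each of the three sets of `F` is contained in that
of `G`. -/
instance : PartialOrder BipGraph :=
  PartialOrder.lift (fun G => (G.rows, G.cols, G.edges)) (by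
    intro F G hFG
    simp only [Prod.mk.injEq] at hFG
    exact BipGraph.ext hFG.1 hFG.2.1 hFG.2.2)

theorem le_def {F G : BipGraph} :
    F ≤ G ↔ F.rows ⊆ G.rows ∧ F.cols ⊆ G.cols ∧ F.edges ⊆ G.edges := Iff.rfl

/-- The number of row nodes. -/
def v₁ (G : BipGraph) : ℕ := G.rows.card

/-- The number of column nodes. -/
def v₂ (G : BipGraph) : ℕ := G.cols.card

/-- The number of nodes and edges (only used to justify recursions on subgraphs). -/
def size (G : BipGraph) : ℕ := G.rows.card + G.cols.card + G.edges.card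

theorem size_lt_size {F G : BipGraph} (hFG : F < G) : F.size < G.size := by
  obtain ⟨hr, hc, he⟩ := le_def.1 hFG.le
  have h1 := Finset.card_le_card hr
  have h2 := Finset.card_le_card hc
  have h3 := Finset.card_le_card he
  rcases Nat.lt_or_ge F.size G.size with h | h
  · exact h
  · exfalso
    unfold size at h
    exact hFG.ne (BipGraph.ext (Finset.eq_of_subset_of_card_le hr (by omega))
      (Finset.eq_of_subset_of_card_le hc (by omega))
      (Finset.eq_of_subset_of_card_le he (by omega)))

theorem finite_subgraphs (G : BipGraph) : {F : BipGraph | F ≤ G}.Finite := by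
  refine Set.Finite.of_finite_image (f := fun F => (F.rows, F.cols, F.edges)) ?_ ?_
  · refine Set.Finite.subset
      (G.rows.powerset ×ˢ (G.cols.powerset ×ˢ G.edges.powerset)).finite_toSet ?_
    rintro _ ⟨F, hF, rfl⟩
    obtain ⟨hr, hc, he⟩ := le_def.1 hF
    simp [hr, hc, he]
  · intro F _ F' _ hFF
    simp only [Prod.mk.injEq] at hFF
    exact BipGraph.ext hFF.1 hFF.2.1 hFF.2.2

/-- The finite set of all proper subgraphs `F ⊂ G`. -/
def properSubgraphs (G : BipGraph) : Finset BipGraph :=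
  (G.finite_subgraphs.subset (t := {F | F < G}) fun _ hF => le_of_lt (Set.mem_ofPred.1 hF)).toFinset

theorem mem_properSubgraphs {F G : BipGraph} : F ∈ G.properSubgraphs ↔ F < G := by
  simp [properSubgraphs]

/-- The complete bipartite graph `K_{I,J}` on row set `I` and column set `J`. -/
def K (I J : Finset ℕ) : BipGraph := ⟨I, J, I ×ˢ J, Finset.Subset.refl _⟩

/-- Isomorphism of bipartite graphs: bijections of row nodes and of column nodes under which edges
correspond to edges. -/
def Iso (G G' : BipGraph) : Prop :=
  ∃ (σ : G.rows ≃ G'.rows) (τ : G.cols ≃ G'.cols), ∀ (i : G.rows) (j : G.cols),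
    ((i : ℕ), (j : ℕ)) ∈ G.edges ↔ ((σ i : ℕ), (τ j : ℕ)) ∈ G'.edges

/-- `|Aut(G)|`: the number of pairs of permutations of the row nodes and of the column nodes that
preserve the edge set. -/
def autCard (G : BipGraph) : ℕ :=
  Nat.card {Φ : Equiv.Perm G.rows × Equiv.Perm G.cols //
    ∀ (i : G.rows) (j : G.cols),
      ((i : ℕ), (j : ℕ)) ∈ G.edges ↔ ((Φ.1 i : ℕ), (Φ.2 j : ℕ)) ∈ G.edges}

/-- The subgraphs of `K_{r,c}` with `r` row nodes and `c` column nodes. -/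
def Spanning (r c : ℕ) : Type :=
  {G : BipGraph // G ≤ K (Finset.range r) (Finset.range c) ∧ G.v₁ = r ∧ G.v₂ = c}

instance (r c : ℕ) : Finite (Spanning r c) :=
  Set.Finite.to_subtype
    ((K (Finset.range r) (Finset.range c)).finite_subgraphs.subset fun _ hG => hG.1)

instance isoSetoid (r c : ℕ) : Setoid (Spanning r c) where
  r G G' := Iso G.1 G'.1
  iseqv :=
    { refl := fun _ => ⟨Equiv.refl _, Equiv.refl _, fun _ _ => Iff.rfl⟩
      symm := by
        rintro G G' ⟨σ, τ, h⟩
        refine ⟨σ.symm, τ.symm, fun i j => ?_⟩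
        have := h (σ.symm i) (τ.symm j)
        simp only [Equiv.apply_symm_apply] at this
        exact this.symm
      trans := by
        rintro G G' G'' ⟨σ, τ, h⟩ ⟨σ', τ', h'⟩
        exact ⟨σ.trans σ', τ.trans τ', fun i j => (h i j).trans (h' (σ i) (τ j))⟩ }

/-- `Γ_{r,c}`: a set of subgraphs of `K_{r,c}` with `r` row nodes and `c` column nodes that contains
exactly one representative of each isomorphism class. -/
def Gam (r c : ℕ) : Finset BipGraph :=
  (Set.finite_range fun x : Quotient (isoSetoid r c) => x.out.1).toFinset

/-- The graph on the disjoint union of the row nodes and the column nodes. -/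
def toSimpleGraph (G : BipGraph) : SimpleGraph (G.rows ⊕ G.cols) :=
  SimpleGraph.fromRel fun x y =>
    ∃ (i : G.rows) (j : G.cols), x = Sum.inl i ∧ y = Sum.inr j ∧ ((i : ℕ), (j : ℕ)) ∈ G.edges

/-- Connectedness of a bipartite graph. -/
def Connected (G : BipGraph) : Prop := G.toSimpleGraph.Connected

end BipGraph

open BipGraph

variable {Ω : Type*} [MeasurableSpace Ω]

/-! ### Aldous-Hoover-Kallenberg variables and projections -/

/-- `Y i j = φ (ξ i) (η j) (ζ i j)` almost surely, where `φ` is measurable and all the variables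
`ξ i`, `η j`, `ζ i j` together are i.i.d. with uniform distribution on `[0,1]`. -/
structure IsAHKRepresentation (P : Measure Ω) (Y : ℕ → ℕ → Ω → ℝ) (φ : ℝ → ℝ → ℝ → ℝ)
    (ξ η : ℕ → Ω → ℝ) (ζ : ℕ → ℕ → Ω → ℝ) : Prop where
  measurable_phi : Measurable fun t : ℝ × ℝ × ℝ => φ t.1 t.2.1 t.2.2
  measurable_row : ∀ i, Measurable (ξ i)
  measurable_col : ∀ j, Measurable (η j)
  measurable_edge : ∀ i j, Measurable (ζ i j)
  uniform_row : ∀ i, pdf.IsUniform (ξ i) (Set.Icc 0 1) P volume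
  uniform_col : ∀ j, pdf.IsUniform (η j) (Set.Icc 0 1) P volume
  uniform_edge : ∀ i j, pdf.IsUniform (ζ i j) (Set.Icc 0 1) P volume
  indep : iIndepFun
    (Sum.elim ξ (Sum.elim η fun e : ℕ × ℕ => ζ e.1 e.2) : ℕ ⊕ ℕ ⊕ ℕ × ℕ → Ω → ℝ) P
  eq_ae : ∀ i j, Y i j =ᵐ[P] fun ω => φ (ξ i ω) (η j ω) (ζ i j ω)

/-- `σ(H(G))`: the σ-algebra generated by the variables `ξ i` for the row nodes `i`, `η j` for the
column nodes `j` and `ζ i j` for the edges `(i, j)` of `G`. -/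
@[reducible]
def sigmaH (ξ η : ℕ → Ω → ℝ) (ζ : ℕ → ℕ → Ω → ℝ) (G : BipGraph) : MeasurableSpace Ω :=
  (⨆ i ∈ G.rows, MeasurableSpace.comap (ξ i) inferInstance) ⊔
    (⨆ j ∈ G.cols, MeasurableSpace.comap (η j) inferInstance) ⊔
    (⨆ e ∈ G.edges, MeasurableSpace.comap (ζ e.1 e.2) inferInstance)

/-- `p^G(X) = 𝔼[X | H(G)] - ∑_{F ⊂ G} p^F(X)`, by recursion on `G`. For the empty graph the
σ-algebra is trivial and the sum is empty, so `p^∅(X) = 𝔼[X]`. -/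
def proj (P : Measure Ω) (ξ η : ℕ → Ω → ℝ) (ζ : ℕ → ℕ → Ω → ℝ) (X : Ω → ℝ)
    (G : BipGraph) : Ω → ℝ :=
  P[X | sigmaH ξ η ζ G] - ∑ F ∈ G.properSubgraphs.attach, proj P ξ η ζ X F.1
termination_by G.size
decreasing_by exact size_lt_size (mem_properSubgraphs.1 F.2)

/-! ### The U-statistic -/

/-- `h(Y_{I,J})`: the kernel at the submatrix of `Y` with rows `I` and columns `J`, both in
increasing order. -/
def kernelAt {p q : ℕ} (h : (Fin p → Fin q → ℝ) → ℝ) (Y : ℕ → ℕ → Ω → ℝ)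
    (I J : Finset ℕ) (hI : I.card = p) (hJ : J.card = q) : Ω → ℝ :=
  fun ω => h fun a b => Y (I.orderEmbOfFin hI a) (J.orderEmbOfFin hJ b) ω

/-- `h(Y_{[p],[q]})`. -/
def kernel₀ {p q : ℕ} (h : (Fin p → Fin q → ℝ) → ℝ) (Y : ℕ → ℕ → Ω → ℝ) : Ω → ℝ :=
  kernelAt h Y (Finset.range p) (Finset.range q) (Finset.card_range p) (Finset.card_range q)

/-- `U_{m,n}`: the average of `h(Y_{I,J})` over the `p`-subsets `I` of the first `m` rows and the
`q`-subsets `J` of the first `n` columns. -/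
def UStat {p q : ℕ} (h : (Fin p → Fin q → ℝ) → ℝ) (Y : ℕ → ℕ → Ω → ℝ) (m n : ℕ) : Ω → ℝ :=
  fun ω => ((m.choose p : ℝ) * (n.choose q : ℝ))⁻¹ *
    ∑ I ∈ ((Finset.range m).powersetCard p).attach,
      ∑ J ∈ ((Finset.range n).powersetCard q).attach,
        kernelAt h Y I.1 J.1 (Finset.mem_powersetCard.1 I.2).2 (Finset.mem_powersetCard.1 J.2).2 ω

/-- `V^{(r,c)} = (p! q! / ((p-r)! (q-c)!))² ∑_{G ∈ Γ_{r,c}} |Aut(G)|⁻¹ 𝔼[(p^G)²]`, where `p^G` is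
taken at `h(Y_{[p],[q]})`; used for `r ≤ p` and `c ≤ q`. -/
def V {p q : ℕ} (P : Measure Ω) (ξ η : ℕ → Ω → ℝ) (ζ : ℕ → ℕ → Ω → ℝ)
    (h : (Fin p → Fin q → ℝ) → ℝ) (Y : ℕ → ℕ → Ω → ℝ) (r c : ℕ) : ℝ :=
  ((p.factorial : ℝ) ^ 2 * (q.factorial : ℝ) ^ 2) /
      (((p - r).factorial : ℝ) ^ 2 * ((q - c).factorial : ℝ) ^ 2) *
    ∑ G ∈ Gam r c, (G.autCard : ℝ)⁻¹ * ∫ ω, (proj P ξ η ζ (kernel₀ h Y) G ω) ^ 2 ∂P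

/-! ### Principal degrees, normalization, principal support graphs -/

/-- `S` is the set of principal degrees of `U_N = U_{m_N,n_N}`: pairs `(0,0) < (r,c) ≤ (p,q)` whose
products `m_N^r n_N^c` all have the same order, such that
`𝕍[U_N] ≍ ∑_{(r,c) ∈ S} V^{(r,c)} / (m_N^r n_N^c)`. -/
structure IsPrincipalDegrees {p q : ℕ} (P : Measure Ω) (ξ η : ℕ → Ω → ℝ) (ζ : ℕ → ℕ → Ω → ℝ)
    (h : (Fin p → Fin q → ℝ) → ℝ) (Y : ℕ → ℕ → Ω → ℝ) (m n : ℕ → ℕ)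
    (S : Finset (ℕ × ℕ)) : Prop where
  range : ∀ s ∈ S, s ≠ (0, 0) ∧ s.1 ≤ p ∧ s.2 ≤ q
  same_order : ∀ s ∈ S, ∀ t ∈ S,
    (fun N => (m N : ℝ) ^ s.1 * (n N : ℝ) ^ s.2) =Θ[atTop]
      fun N => (m N : ℝ) ^ t.1 * (n N : ℝ) ^ t.2
  variance_order :
    (fun N => Var[UStat h Y (m N) (n N); P]) =Θ[atTop]
      fun N => ∑ s ∈ S, V P ξ η ζ h Y s.1 s.2 / ((m N : ℝ) ^ s.1 * (n N : ℝ) ^ s.2)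

/-- `γ` is a normalization for the principal degrees `S` with coefficients `α`:
`γ(N) m_N^{-r} n_N^{-c} → α_{(r,c)} > 0` for all `(r,c) ∈ S`, and
`γ(N) 𝕍[U_N] = ∑_{(r,c) ∈ S} α_{(r,c)} V^{(r,c)} + o(1)`. -/
structure IsNormalization {p q : ℕ} (P : Measure Ω) (ξ η : ℕ → Ω → ℝ) (ζ : ℕ → ℕ → Ω → ℝ)
    (h : (Fin p → Fin q → ℝ) → ℝ) (Y : ℕ → ℕ → Ω → ℝ) (m n : ℕ → ℕ)
    (S : Finset (ℕ × ℕ)) (γ : ℕ → ℝ) (α : ℕ × ℕ → ℝ) : Prop where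
  pos : ∀ s ∈ S, 0 < α s
  tendsto_coeff : ∀ s ∈ S,
    Tendsto (fun N => γ N * (((m N : ℝ) ^ s.1)⁻¹ * ((n N : ℝ) ^ s.2)⁻¹)) atTop (𝓝 (α s))
  tendsto_variance :
    Tendsto (fun N => γ N * Var[UStat h Y (m N) (n N); P]) atTop
      (𝓝 (∑ s ∈ S, α s * V P ξ η ζ h Y s.1 s.2))

/-- `G` is a principal support graph: its numbers of nodes form a principal degree and `p^G ≠ 0`,
where `p^G` is the projection of `h(Y_{I,J})` for some `K_{I,J} ⊇ G` (all these projections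
coincide almost surely). -/
def IsPrincipalSupportGraph {p q : ℕ} (P : Measure Ω) (ξ η : ℕ → Ω → ℝ) (ζ : ℕ → ℕ → Ω → ℝ)
    (h : (Fin p → Fin q → ℝ) → ℝ) (Y : ℕ → ℕ → Ω → ℝ) (S : Finset (ℕ × ℕ))
    (G : BipGraph) : Prop :=
  (G.v₁, G.v₂) ∈ S ∧
    ∃ (I J : Finset ℕ) (hI : I.card = p) (hJ : J.card = q), G ≤ K I J ∧
      ¬ proj P ξ η ζ (kernelAt h Y I J hI hJ) G =ᵐ[P] 0

end RCE

end

/-!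
The proof is by the method of moments, after a Hoeffding decomposition and a truncation.

*Hoeffding decomposition.* The projection `p^G` is a function of the variables attached to `G`, and
its conditional expectation vanishes as soon as one of them is not given
(`IsAHKRepresentation.condExp_proj_eq_zero`). Up to null sets it does not depend on the submatrix
from which it is computed, and isomorphic graphs have projections with the same second moment; both
facts come from relabelling rows and columns by injections. Hence `U_{m,n}` is its mean plus a sum
of orthogonal terms, one for each nonempty graph in `K_{[m],[n]}` with at most `p` rows and `q`
columns (`IsKernel.UStat_sub_ae_eq_sum`), and the graphs with `r` rows and `c` columns contribute
`V^{(r,c)} / (m (m - 1) ⋯ (m - r + 1) n (n - 1) ⋯ (n - c + 1))` to the variance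
(`IsKernel.sum_sq_degree`). After normalization the principal degrees carry the whole limiting
variance, so that all other terms vanish in mean square; among the principal degrees the
disconnected graphs have zero projection by assumption. What is left is a weighted sum `W` of
projections on connected graphs, in which the weight of a graph is at most a constant times
`m^(-1/2)` for each row and `n^(-1/2)` for each column (`isConnectedArray_principalCopies`).

*Moments.* Let the projections be bounded, and expand the moment of order `k + 2` of `W` into a sum
over tuples of graphs. The expectation of a product of projections is zero if some variable belongs
to only one of the graphs (`integral_prod_eq_zero`). Suppose that it is not zero and that no node
belongs to three graphs of the tuple. Then two graphs that share a node are equal, because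
connectedness carries the coincidence from one node to the next (`Connected.le_of_common_node`). So
the first graph equals exactly one of the others, is disjoint from the rest, and its second moment
factors out. This is the recursion of the Gaussian moments. In the remaining tuples every node is
covered at least twice and some node three times. The sum of their weights is at most a multiple of
the largest weight of a single node, since the weights of the nodes are square summable
(`abs_moment_recursion_le`). The recursion determines the limits of the moments, and the moments
the limit of the characteristic function (`tendsto_charFun_sub_of_moments`).

*Truncation.* Cutting off the kernel at `±M` makes the projections bounded, and changes `W` in mean
square by at most a constant times the mean square error of the truncation, uniformly in `N`
(`IsKernel.integral_sq_sum_graphProj_sub_le`). Gaussian limits are stable under such approximations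
(`tendsto_charFun_of_approx`).
-/

noncomputable section

namespace RCE

open BipGraph

/-! ### Conditional expectations given independent or transported σ-algebras -/

section CondExp

variable {Ω : Type*} [mΩ : MeasurableSpace Ω]

/-- Enlarging the conditioning σ-algebra by events that are independent of everything else does not
change a conditional expectation. -/
theorem condExp_sup_of_indep {P : Measure Ω} [IsProbabilityMeasure P]
    {mA mC m₁ : MeasurableSpace Ω} (hA : mA ≤ m₁) (h₁ : m₁ ≤ mΩ) (hC : mC ≤ mΩ)
    (hind : Indep m₁ mC P) {f : Ω → ℝ} (hf : StronglyMeasurable[m₁] f) :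
    P[f | mA ⊔ mC] =ᵐ[P] P[f | mA] := by
  by_cases hint : Integrable f P
  swap
  · simp [condExp_of_not_integrable hint]
  have hAm : mA ≤ mΩ := hA.trans h₁
  have hsup : mA ⊔ mC ≤ mΩ := sup_le hAm hC
  -- On intersections of an event of `mA` and an event of `mC`, both sides factor.
  have key : ∀ g : Ω → ℝ, Integrable g P → StronglyMeasurable[m₁] g → ∀ a c : Set Ω,
      MeasurableSet[mA] a → MeasurableSet[mC] c →
      ∫ ω in a ∩ c, g ω ∂P = (∫ ω in a, g ω ∂P) * P.real c := by
    intro g hg hgm a c ha hc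
    have h1 : StronglyMeasurable[m₁] (a.indicator g) := hgm.indicator (hA _ ha)
    have hE := condExp_indep_eq h₁ hC h1 hind
    have hga : Integrable (a.indicator g) P := hg.indicator (hAm _ ha)
    calc ∫ ω in a ∩ c, g ω ∂P = ∫ ω in c, a.indicator g ω ∂P := by
          rw [setIntegral_indicator (hAm _ ha), Set.inter_comm]
      _ = ∫ ω in c, (P[a.indicator g | mC]) ω ∂P := (setIntegral_condExp hC hga hc).symm
      _ = ∫ ω in c, (∫ ω', a.indicator g ω' ∂P) ∂P :=
          setIntegral_congr_ae (hC _ hc) (hE.mono fun ω h _ => h)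
      _ = _ := by
          rw [setIntegral_const, integral_indicator (hAm _ ha), smul_eq_mul, mul_comm]
  symm
  refine ae_eq_condExp_of_forall_setIntegral_eq hsup hint
    (fun s _ _ => integrable_condExp.integrableOn) ?_
    ((stronglyMeasurable_condExp.mono (le_sup_left : mA ≤ mA ⊔ mC)).aestronglyMeasurable)
  intro s hs _
  have hgen : mA ⊔ mC = MeasurableSpace.generateFrom
      (Set.image2 (· ∩ ·) {a | MeasurableSet[mA] a} {c | MeasurableSet[mC] c}) := by
    apply le_antisymm
    · refine sup_le (fun a ha => ?_) (fun c hc => ?_)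
      · exact MeasurableSpace.measurableSet_generateFrom
          ⟨a, ha, Set.univ, MeasurableSet.univ, Set.inter_univ a⟩
      · exact MeasurableSpace.measurableSet_generateFrom
          ⟨Set.univ, MeasurableSet.univ, c, hc, Set.univ_inter c⟩
    · refine MeasurableSpace.generateFrom_le ?_
      rintro _ ⟨a, ha, c, hc, rfl⟩
      exact MeasurableSet.inter ((le_sup_left : mA ≤ mA ⊔ mC) _ ha)
        ((le_sup_right : mC ≤ mA ⊔ mC) _ hc)
  have hpi : IsPiSystem
      (Set.image2 (· ∩ ·) {a | MeasurableSet[mA] a} {c | MeasurableSet[mC] c}) := by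
    rintro _ ⟨a, ha, c, hc, rfl⟩ _ ⟨a', ha', c', hc', rfl⟩ _
    exact ⟨a ∩ a', MeasurableSet.inter ha ha', c ∩ c', MeasurableSet.inter hc hc',
      Set.inter_inter_inter_comm _ _ _ _⟩
  induction s, hs using MeasurableSpace.induction_on_inter hgen hpi with
  | empty => simp
  | basic t ht =>
    obtain ⟨a, ha, c, hc, rfl⟩ := ht
    change ∫ ω in a ∩ c, _ ∂P = ∫ ω in a ∩ c, _ ∂P
    rw [key _ integrable_condExp (stronglyMeasurable_condExp.mono hA) a c ha hc,
      key f hint hf a c ha hc, setIntegral_condExp hAm hint ha]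
  | compl t ht ih =>
    have ih' := ih (measure_lt_top _ _)
    have e1 := integral_add_compl (hsup _ ht) (integrable_condExp (m := mA) (f := f) (μ := P))
    have e2 := integral_add_compl (hsup _ ht) hint
    rw [integral_condExp hAm] at e1
    linarith
  | iUnion s hd hs ih =>
    rw [integral_iUnion (fun i => hsup _ (hs i)) hd integrable_condExp.integrableOn,
      integral_iUnion (fun i => hsup _ (hs i)) hd hint.integrableOn]
    exact tsum_congr fun i => ih i (measure_lt_top _ _)

/-- For independent variables, conditioning on the variables in `T` and then on those in `S` amounts
to conditioning on the variables in `S ∩ T`. -/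
theorem condExp_condExp_iSup_comap {ι : Type*} {P : Measure Ω} [IsProbabilityMeasure P]
    {Z : ι → Ω → ℝ} (hZ : ∀ i, Measurable (Z i)) (hind : iIndepFun Z P) (S T : Set ι)
    {f : Ω → ℝ} :
    P[P[f | ⨆ i ∈ T, MeasurableSpace.comap (Z i) inferInstance] |
        ⨆ i ∈ S, MeasurableSpace.comap (Z i) inferInstance] =ᵐ[P]
      P[f | ⨆ i ∈ S ∩ T, MeasurableSpace.comap (Z i) inferInstance] := by
  set m : ι → MeasurableSpace Ω := fun i => MeasurableSpace.comap (Z i) inferInstance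
  have hm : ∀ i, m i ≤ mΩ := fun i => (hZ i).comap_le
  have hle : ∀ A : Set ι, ⨆ i ∈ A, m i ≤ mΩ := fun A => iSup₂_le fun i _ => hm i
  have hmono : ∀ {A B : Set ι}, A ⊆ B → ⨆ i ∈ A, m i ≤ ⨆ i ∈ B, m i :=
    fun h => biSup_mono h
  have hsplit : (⨆ i ∈ S, m i) = (⨆ i ∈ S ∩ T, m i) ⊔ (⨆ i ∈ S \ T, m i) := by
    rw [← iSup_union, Set.inter_union_sdiff]
  have hI : Indep (⨆ i ∈ T, m i) (⨆ i ∈ S \ T, m i) P :=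
    indep_iSup_of_disjoint hm hind Set.disjoint_sdiff_right
  have h1 := condExp_sup_of_indep (hmono (Set.inter_subset_right : S ∩ T ⊆ T)) (hle T)
    (hle (S \ T)) hI (f := P[f | ⨆ i ∈ T, m i]) stronglyMeasurable_condExp
  rw [← hsplit] at h1
  exact h1.trans (condExp_condExp_of_le (hmono Set.inter_subset_right) (hle T))

/-- Conditional expectations are transported along measure preserving maps. -/
theorem condExp_comp_ae_eq {Ω' : Type*} {m : MeasurableSpace Ω'} [mΩ' : MeasurableSpace Ω']
    {P : Measure Ω} [IsProbabilityMeasure P] {ν : Measure Ω'}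
    [IsProbabilityMeasure ν] {g : Ω → Ω'} (hg : MeasurePreserving g P ν)
    (hm : m ≤ mΩ') {f : Ω' → ℝ} (hf : Integrable f ν) :
    P[f ∘ g | m.comap g] =ᵐ[P] (ν[f | m]) ∘ g := by
  have hmg : m.comap g ≤ mΩ :=
    (MeasurableSpace.comap_mono hm).trans hg.measurable.comap_le
  have hcm : Measurable[m.comap g, m] g := comap_measurable g
  symm
  refine ae_eq_condExp_of_forall_setIntegral_eq hmg (hg.integrable_comp_of_integrable hf)
    (fun s _ _ => (hg.integrable_comp_of_integrable integrable_condExp).integrableOn) ?_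
    ((stronglyMeasurable_condExp.comp_measurable hcm).aestronglyMeasurable)
  rintro _ ⟨t, ht, rfl⟩ _
  have h1 : ∀ u : Ω' → ℝ, Integrable u ν →
      ∫ ω in g ⁻¹' t, (u ∘ g) ω ∂P = ∫ x in t, u x ∂ν := by
    intro u hu
    rw [← hg.map_eq, setIntegral_map (hm _ ht) _ hg.measurable.aemeasurable]
    · rfl
    · rw [hg.map_eq]; exact hu.1
  rw [h1 _ integrable_condExp, h1 _ hf, setIntegral_condExp hm hf ht]

end CondExp

/-! ### Subgraphs and the variables they carry -/

namespace BipGraph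

/-- The nodes and edges of a graph, as indices of the variables `ξ i`, `η j`, `ζ i j`. -/
def support (G : BipGraph) : Finset (ℕ ⊕ ℕ ⊕ ℕ × ℕ) :=
  G.rows.disjSum (G.cols.disjSum G.edges)

@[simp] theorem inl_mem_support {G : BipGraph} {i : ℕ} :
    Sum.inl i ∈ G.support ↔ i ∈ G.rows := by simp [support]

@[simp] theorem inr_inl_mem_support {G : BipGraph} {j : ℕ} :
    Sum.inr (Sum.inl j) ∈ G.support ↔ j ∈ G.cols := by simp [support]

@[simp] theorem inr_inr_mem_support {G : BipGraph} {e : ℕ × ℕ} :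
    Sum.inr (Sum.inr e) ∈ G.support ↔ e ∈ G.edges := by simp [support]

theorem le_iff_support {F G : BipGraph} : F ≤ G ↔ F.support ⊆ G.support := by
  rw [le_def]
  constructor
  · rintro ⟨h1, h2, h3⟩ (i | j | e) hx
    · exact inl_mem_support.2 (h1 (inl_mem_support.1 hx))
    · exact inr_inl_mem_support.2 (h2 (inr_inl_mem_support.1 hx))
    · exact inr_inr_mem_support.2 (h3 (inr_inr_mem_support.1 hx))
  · intro h
    exact ⟨fun i hi => inl_mem_support.1 (h (inl_mem_support.2 hi)),
      fun i hi => inr_inl_mem_support.1 (h (inr_inl_mem_support.2 hi)),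
      fun i hi => inr_inr_mem_support.1 (h (inr_inr_mem_support.2 hi))⟩

/-- The largest common subgraph. -/
def inter (F G : BipGraph) : BipGraph :=
  ⟨F.rows ∩ G.rows, F.cols ∩ G.cols, F.edges ∩ G.edges, fun e he => by
    obtain ⟨h1, h2⟩ := Finset.mem_inter.1 he
    have h1' := Finset.mem_product.1 (F.edges_subset h1)
    have h2' := Finset.mem_product.1 (G.edges_subset h2)
    exact Finset.mem_product.2 ⟨Finset.mem_inter.2 ⟨h1'.1, h2'.1⟩,
      Finset.mem_inter.2 ⟨h1'.2, h2'.2⟩⟩⟩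

theorem support_inter (F G : BipGraph) : (F.inter G).support = F.support ∩ G.support := by
  ext (i | j | e) <;> simp [inter]

theorem inter_le_left (F G : BipGraph) : F.inter G ≤ F :=
  ⟨Finset.inter_subset_left, Finset.inter_subset_left, Finset.inter_subset_left⟩

theorem inter_le_right (F G : BipGraph) : F.inter G ≤ G :=
  ⟨Finset.inter_subset_right, Finset.inter_subset_right, Finset.inter_subset_right⟩

theorem le_inter {E F G : BipGraph} (h₁ : E ≤ F) (h₂ : E ≤ G) : E ≤ F.inter G :=
  ⟨Finset.subset_inter h₁.1 h₂.1, Finset.subset_inter h₁.2.1 h₂.2.1,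
    Finset.subset_inter h₁.2.2 h₂.2.2⟩

/-- The finite set of all subgraphs of `G`. -/
def subgraphs (G : BipGraph) : Finset BipGraph := G.finite_subgraphs.toFinset

@[simp] theorem mem_subgraphs {F G : BipGraph} : F ∈ G.subgraphs ↔ F ≤ G := by
  simp [subgraphs]

instance : DecidableEq BipGraph := Classical.decEq _

theorem subgraphs_eq_insert (G : BipGraph) : G.subgraphs = insert G G.properSubgraphs := by
  ext F
  simp only [mem_subgraphs, Finset.mem_insert, mem_properSubgraphs]
  exact le_iff_eq_or_lt

theorem notMem_properSubgraphs (G : BipGraph) : G ∉ G.properSubgraphs := by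
  simp [mem_properSubgraphs]

theorem card_subgraphs_le (G : BipGraph) : G.subgraphs.card ≤ 2 ^ G.size := by
  have h : G.size = G.support.card := by
    simp [support, size, Finset.card_disjSum, add_assoc]
  rw [h, ← Finset.card_powerset]
  refine Finset.card_le_card_of_injOn support ?_ ?_
  · intro F hF
    simpa using le_iff_support.1 (mem_subgraphs.1 hF)
  · intro F _ F' _ hFF
    exact le_antisymm (le_iff_support.2 hFF.le) (le_iff_support.2 hFF.ge)

end BipGraph

/-! ### Degeneracy and orthogonality of the projections -/

section Proj

variable {Ω : Type*} [mΩ : MeasurableSpace Ω] {P : Measure Ω}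
  {Y : ℕ → ℕ → Ω → ℝ} {φ : ℝ → ℝ → ℝ → ℝ} {ξ η : ℕ → Ω → ℝ} {ζ : ℕ → ℕ → Ω → ℝ}

/-- All variables `ξ i`, `η j`, `ζ i j` as a single family. -/
def allVars (ξ η : ℕ → Ω → ℝ) (ζ : ℕ → ℕ → Ω → ℝ) : ℕ ⊕ ℕ ⊕ ℕ × ℕ → Ω → ℝ :=
  Sum.elim ξ (Sum.elim η fun e : ℕ × ℕ => ζ e.1 e.2)

theorem IsAHKRepresentation.measurable_allVars (hY : IsAHKRepresentation P Y φ ξ η ζ)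
    (x : ℕ ⊕ ℕ ⊕ ℕ × ℕ) : Measurable (allVars ξ η ζ x) := by
  rcases x with i | j | e
  · exact hY.measurable_row i
  · exact hY.measurable_col j
  · exact hY.measurable_edge _ _

omit mΩ in
theorem sigmaH_eq_iSup (ξ η : ℕ → Ω → ℝ) (ζ : ℕ → ℕ → Ω → ℝ) (G : BipGraph) :
    sigmaH ξ η ζ G = ⨆ x ∈ (G.support : Set (ℕ ⊕ ℕ ⊕ ℕ × ℕ)),
      MeasurableSpace.comap (allVars ξ η ζ x) inferInstance := by
  simp only [Finset.mem_coe, iSup_sum, inl_mem_support, inr_inl_mem_support, inr_inr_mem_support]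
  rw [sigmaH, sup_assoc]
  rfl

omit mΩ in
theorem sigmaH_mono {F G : BipGraph} (h : F ≤ G) : sigmaH ξ η ζ F ≤ sigmaH ξ η ζ G := by
  rw [sigmaH_eq_iSup, sigmaH_eq_iSup]
  exact biSup_mono fun x hx => le_iff_support.1 h hx

theorem IsAHKRepresentation.sigmaH_le (hY : IsAHKRepresentation P Y φ ξ η ζ) (G : BipGraph) :
    sigmaH ξ η ζ G ≤ mΩ := by
  rw [sigmaH_eq_iSup]
  exact iSup₂_le fun x _ => (hY.measurable_allVars x).comap_le

theorem IsAHKRepresentation.condExp_condExp [IsProbabilityMeasure P]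
    (hY : IsAHKRepresentation P Y φ ξ η ζ)
    (E F : BipGraph) (X : Ω → ℝ) :
    P[P[X | sigmaH ξ η ζ F] | sigmaH ξ η ζ E] =ᵐ[P] P[X | sigmaH ξ η ζ (E.inter F)] := by
  rw [sigmaH_eq_iSup, sigmaH_eq_iSup, sigmaH_eq_iSup, support_inter, Finset.coe_inter]
  exact condExp_condExp_iSup_comap hY.measurable_allVars hY.indep _ _

theorem proj_eq (X : Ω → ℝ) (G : BipGraph) :
    proj P ξ η ζ X G = P[X | sigmaH ξ η ζ G] - ∑ F ∈ G.properSubgraphs, proj P ξ η ζ X F := by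
  rw [proj, Finset.sum_attach G.properSubgraphs (fun F => proj P ξ η ζ X F)]

theorem sum_subgraphs_proj (X : Ω → ℝ) (G : BipGraph) :
    ∑ F ∈ G.subgraphs, proj P ξ η ζ X F = P[X | sigmaH ξ η ζ G] := by
  rw [subgraphs_eq_insert, Finset.sum_insert (notMem_properSubgraphs G), proj_eq]
  simp

/-- Strong induction along proper subgraphs. -/
theorem BipGraph.strongInduction {motive : BipGraph → Prop} (G : BipGraph)
    (ih : ∀ G, (∀ F, F < G → motive F) → motive G) : motive G := by
  induction hn : G.size using Nat.strong_induction_on generalizing G with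
  | _ n IH => exact ih G fun F hF => IH _ (hn ▸ size_lt_size hF) F rfl

theorem stronglyMeasurable_proj (X : Ω → ℝ) (G : BipGraph) :
    StronglyMeasurable[sigmaH ξ η ζ G] (proj P ξ η ζ X G) := by
  induction G using BipGraph.strongInduction with
  | ih G ih =>
    rw [proj_eq]
    refine StronglyMeasurable.sub stronglyMeasurable_condExp ?_
    refine Finset.stronglyMeasurable_sum _ fun F hF => ?_
    have hF' := mem_properSubgraphs.1 hF
    exact (ih F hF').mono (sigmaH_mono hF'.le)

theorem memLp_proj {X : Ω → ℝ} (hX : MemLp X 2 P) (G : BipGraph) :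
    MemLp (proj P ξ η ζ X G) 2 P := by
  induction G using BipGraph.strongInduction with
  | ih G ih =>
    rw [proj_eq]
    refine (hX.condExp (by norm_num)).sub
      (memLp_finsetSum' _ fun F hF => ih F (mem_properSubgraphs.1 hF))

theorem integrable_proj (X : Ω → ℝ) (G : BipGraph) : Integrable (proj P ξ η ζ X G) P := by
  induction G using BipGraph.strongInduction with
  | ih G ih =>
    rw [proj_eq]
    exact integrable_condExp.sub
      (integrable_finsetSum' _ fun F hF => ih F (mem_properSubgraphs.1 hF))

theorem proj_congr_ae {X X' : Ω → ℝ} (h : X =ᵐ[P] X') (G : BipGraph) :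
    proj P ξ η ζ X G =ᵐ[P] proj P ξ η ζ X' G := by
  induction G using BipGraph.strongInduction with
  | ih G ih =>
    rw [proj_eq, proj_eq]
    refine (condExp_congr_ae h).sub ?_
    exact eventuallyEq_sum fun F hF => ih F (mem_properSubgraphs.1 hF)

theorem proj_sub {X X' : Ω → ℝ} (hX : Integrable X P) (hX' : Integrable X' P) (G : BipGraph) :
    proj P ξ η ζ (X - X') G =ᵐ[P] proj P ξ η ζ X G - proj P ξ η ζ X' G := by
  induction G using BipGraph.strongInduction with
  | ih G ih =>
    rw [proj_eq, proj_eq, proj_eq]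
    have h2 : ∑ F ∈ G.properSubgraphs, proj P ξ η ζ (X - X') F =ᵐ[P]
        ∑ F ∈ G.properSubgraphs, (proj P ξ η ζ X F - proj P ξ η ζ X' F) :=
      eventuallyEq_sum fun F hF => ih F (mem_properSubgraphs.1 hF)
    refine ((condExp_sub hX hX' _).sub h2).trans ?_
    rw [Finset.sum_sub_distrib]
    exact Eventually.of_forall fun ω => by simp; ring

/-- The projection on `G` is degenerate: its conditional expectation vanishes unless all variables
of `G` are given. -/
theorem IsAHKRepresentation.condExp_proj_eq_zero [IsProbabilityMeasure P]
    (hY : IsAHKRepresentation P Y φ ξ η ζ)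
    (X : Ω → ℝ) {E G : BipGraph} (hEG : ¬ G ≤ E) :
    P[proj P ξ η ζ X G | sigmaH ξ η ζ E] =ᵐ[P] 0 := by
  induction G using BipGraph.strongInduction with
  | ih G ih =>
    have hlt : E.inter G < G := lt_of_le_of_ne (inter_le_right _ _) fun h =>
      hEG (h ▸ inter_le_left E G)
    have hsub : (E.inter G).subgraphs ⊆ G.properSubgraphs := fun F hF =>
      mem_properSubgraphs.2 (lt_of_le_of_lt (mem_subgraphs.1 hF) hlt)
    have h1 : P[proj P ξ η ζ X G | sigmaH ξ η ζ E] =ᵐ[P]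
        P[P[X | sigmaH ξ η ζ G] | sigmaH ξ η ζ E] -
          P[∑ F ∈ G.properSubgraphs, proj P ξ η ζ X F | sigmaH ξ η ζ E] := by
      rw [proj_eq]
      exact condExp_sub integrable_condExp
        (integrable_finsetSum' _ fun F _ => integrable_proj X F) _
    have h2 : P[∑ F ∈ G.properSubgraphs, proj P ξ η ζ X F | sigmaH ξ η ζ E] =ᵐ[P]
        ∑ F ∈ G.properSubgraphs, P[proj P ξ η ζ X F | sigmaH ξ η ζ E] :=
      condExp_finsetSum (fun F _ => integrable_proj X F) _
    have h3 : ∑ F ∈ G.properSubgraphs, P[proj P ξ η ζ X F | sigmaH ξ η ζ E] =ᵐ[P]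
        ∑ F ∈ G.properSubgraphs,
          if F ∈ (E.inter G).subgraphs then proj P ξ η ζ X F else 0 := by
      refine eventuallyEq_sum fun F hF => ?_
      have hF' := mem_properSubgraphs.1 hF
      split_ifs with hFE
      · rw [condExp_of_stronglyMeasurable (hY.sigmaH_le E)
          ((stronglyMeasurable_proj X F).mono
            (sigmaH_mono ((mem_subgraphs.1 hFE).trans (inter_le_left _ _))))
          (integrable_proj X F)]
      · exact ih F hF' fun h => hFE (mem_subgraphs.2 (le_inter h hF'.le))
    rw [← Finset.sum_filter, Finset.filter_mem_eq_inter, Finset.inter_eq_right.2 hsub,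
      sum_subgraphs_proj] at h3
    filter_upwards [h1, h2, h3, hY.condExp_condExp E G X] with ω a1 a2 a3 a4
    simp only [Pi.sub_apply] at a1
    rw [a1, a2, a3, a4]
    simp

/-- A variable with vanishing conditional expectation is orthogonal to the functions of the given
variables. -/
theorem IsAHKRepresentation.integral_mul_eq_zero [IsProbabilityMeasure P]
    (hY : IsAHKRepresentation P Y φ ξ η ζ)
    {E : BipGraph} {U W : Ω → ℝ} (hU : P[U | sigmaH ξ η ζ E] =ᵐ[P] 0)
    (hUi : Integrable U P) (hW : StronglyMeasurable[sigmaH ξ η ζ E] W)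
    (hUW : Integrable (U * W) P) : ∫ ω, U ω * W ω ∂P = 0 := by
  have h1 := condExp_mul_of_aestronglyMeasurable_right hW.aestronglyMeasurable hUW hUi
  calc ∫ ω, U ω * W ω ∂P = ∫ ω, (P[U * W | sigmaH ξ η ζ E]) ω ∂P :=
        (integral_condExp (hY.sigmaH_le E)).symm
    _ = ∫ _, (0 : ℝ) ∂P := integral_congr_ae (by
        filter_upwards [h1, hU] with ω a1 a2
        rw [a1, Pi.mul_apply, a2]; simp)
    _ = 0 := by simp

theorem IsAHKRepresentation.integral_proj_mul_proj [IsProbabilityMeasure P]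
    (hY : IsAHKRepresentation P Y φ ξ η ζ)
    {X X' : Ω → ℝ} (hX : MemLp X 2 P) (hX' : MemLp X' 2 P) {F G : BipGraph} (hFG : F ≠ G) :
    ∫ ω, proj P ξ η ζ X F ω * proj P ξ η ζ X' G ω ∂P = 0 := by
  have hint := (memLp_proj (ξ := ξ) (η := η) (ζ := ζ) hX F).integrable_mul
    (memLp_proj (ξ := ξ) (η := η) (ζ := ζ) hX' G)
  by_cases h : F ≤ G
  · have h' : ¬ G ≤ F := fun h' => hFG (le_antisymm h h')
    rw [← hY.integral_mul_eq_zero (hY.condExp_proj_eq_zero X' h') (integrable_proj X' G)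
      (stronglyMeasurable_proj X F) (by rwa [mul_comm])]
    simp_rw [mul_comm]
  · exact hY.integral_mul_eq_zero (hY.condExp_proj_eq_zero X h) (integrable_proj X F)
      (stronglyMeasurable_proj X' G) hint

/-- Pythagoras' theorem. -/
theorem integral_sq_sum_of_orthogonal {ι : Type*} (s : Finset ι) {f : ι → Ω → ℝ}
    (hf : ∀ i ∈ s, MemLp (f i) 2 P)
    (horth : ∀ i ∈ s, ∀ j ∈ s, i ≠ j → ∫ ω, f i ω * f j ω ∂P = 0) :
    ∫ ω, (∑ i ∈ s, f i ω) ^ 2 ∂P = ∑ i ∈ s, ∫ ω, f i ω ^ 2 ∂P := by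
  classical
  have hij : ∀ i ∈ s, ∀ j ∈ s, Integrable (fun ω => f i ω * f j ω) P := fun i hi j hj =>
    (hf i hi).integrable_mul (hf j hj)
  simp_rw [sq, Finset.sum_mul_sum]
  rw [integral_finsetSum _ fun i hi => integrable_finsetSum _ fun j hj => hij i hi j hj]
  refine Finset.sum_congr rfl fun i hi => ?_
  rw [integral_finsetSum _ fun j hj => hij i hi j hj]
  rw [Finset.sum_eq_single i (fun j hj hne => horth i hi j hj hne.symm) (fun h => (h hi).elim)]

theorem IsAHKRepresentation.integral_sq_proj_le [IsProbabilityMeasure P]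
    (hY : IsAHKRepresentation P Y φ ξ η ζ)
    {X : Ω → ℝ} (hX : MemLp X 2 P) (G : BipGraph) :
    ∫ ω, proj P ξ η ζ X G ω ^ 2 ∂P ≤ ∫ ω, X ω ^ 2 ∂P := by
  have h1 : ∫ ω, (P[X | sigmaH ξ η ζ G]) ω ^ 2 ∂P =
      ∑ F ∈ G.subgraphs, ∫ ω, proj P ξ η ζ X F ω ^ 2 ∂P := by
    rw [← sum_subgraphs_proj]
    simp only [Finset.sum_apply]
    exact integral_sq_sum_of_orthogonal _ (fun F _ => memLp_proj hX F)
      fun F _ F' _ h => hY.integral_proj_mul_proj hX hX h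
  calc ∫ ω, proj P ξ η ζ X G ω ^ 2 ∂P ≤ ∫ ω, (P[X | sigmaH ξ η ζ G]) ω ^ 2 ∂P := by
        rw [h1]
        exact Finset.single_le_sum (f := fun F => ∫ ω, proj P ξ η ζ X F ω ^ 2 ∂P)
          (fun F _ => integral_nonneg fun ω => sq_nonneg _) (mem_subgraphs.2 le_rfl)
    _ ≤ ∫ ω, X ω ^ 2 ∂P := by
        have hvar := hX.condExp (m := sigmaH ξ η ζ G) (by norm_num)
        have hA : Integrable (fun ω => (P[X | sigmaH ξ η ζ G]) ω * X ω) P :=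
          hvar.integrable_mul hX
        -- `X - E[X | H]` is orthogonal to `E[X | H]`.
        have h2 : ∫ ω, (P[X | sigmaH ξ η ζ G]) ω * X ω ∂P =
            ∫ ω, (P[X | sigmaH ξ η ζ G]) ω ^ 2 ∂P := by
          rw [← integral_condExp (hY.sigmaH_le G)]
          refine integral_congr_ae ?_
          filter_upwards [condExp_mul_of_stronglyMeasurable_left
            (stronglyMeasurable_condExp (μ := P) (m := sigmaH ξ η ζ G) (f := X)) hA
            (hX.integrable (by norm_num))] with ω hω
          simp only [Pi.mul_apply] at hω
          rw [sq]; exact hω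
        have h3 : 0 ≤ ∫ ω, (X ω - (P[X | sigmaH ξ η ζ G]) ω) ^ 2 ∂P :=
          integral_nonneg fun ω => sq_nonneg _
        have h4 : ∫ ω, (X ω - (P[X | sigmaH ξ η ζ G]) ω) ^ 2 ∂P =
            ∫ ω, X ω ^ 2 ∂P - 2 * ∫ ω, (P[X | sigmaH ξ η ζ G]) ω * X ω ∂P +
              ∫ ω, (P[X | sigmaH ξ η ζ G]) ω ^ 2 ∂P := by
          rw [← integral_const_mul, ← integral_sub hX.integrable_sq (hA.const_mul 2),
            ← integral_add (f := fun ω => X ω ^ 2 - 2 * ((P[X | sigmaH ξ η ζ G]) ω * X ω))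
              (hX.integrable_sq.sub (hA.const_mul 2)) hvar.integrable_sq]
          exact integral_congr_ae (Eventually.of_forall fun ω => by simp; ring)
        linarith

/-- Projections of bounded variables are bounded, uniformly over graphs of bounded size. -/
theorem abs_proj_le {X : Ω → ℝ} {M : ℝ} (hX : ∀ᵐ ω ∂P, |X ω| ≤ M) (hM : 0 ≤ M) (D : ℕ)
    {G : BipGraph} (hG : G.size ≤ D) :
    ∀ᵐ ω ∂P, |proj P ξ η ζ X G ω| ≤ M * (1 + 2 ^ D) ^ G.size := by
  induction G using BipGraph.strongInduction with
  | ih G ih =>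
    have h1 : ∀ᵐ ω ∂P, |(P[X | sigmaH ξ η ζ G]) ω| ≤ M :=
      ae_bdd_abs_condExp_of_ae_bdd_abs hX
    have h2 : ∀ᵐ ω ∂P, ∀ F ∈ G.properSubgraphs,
        |proj P ξ η ζ X F ω| ≤ M * (1 + 2 ^ D) ^ F.size := by
      rw [Finset.eventually_all]
      intro F hF
      have hF' := mem_properSubgraphs.1 hF
      exact ih F hF' ((size_lt_size hF').le.trans hG)
    filter_upwards [h1, h2] with ω a1 a2
    rw [proj_eq]
    simp only [Pi.sub_apply, Finset.sum_apply]
    by_cases hs : G.properSubgraphs = ∅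
    · simp only [hs, Finset.sum_empty, sub_zero]
      refine a1.trans (le_mul_of_one_le_right hM ?_)
      exact one_le_pow₀ (by linarith [pow_pos (two_pos : (0 : ℝ) < 2) D])
    obtain ⟨F₀, hF₀⟩ := Finset.nonempty_iff_ne_empty.2 hs
    have hpos : 0 < G.size := (Nat.zero_le _).trans_lt (size_lt_size (mem_properSubgraphs.1 hF₀))
    obtain ⟨t, ht⟩ : ∃ t, G.size = t + 1 := ⟨G.size - 1, by omega⟩
    set b : ℝ := 1 + 2 ^ D with hb
    have hb1 : 1 ≤ b := by rw [hb]; linarith [pow_pos (two_pos : (0 : ℝ) < 2) D]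
    have hcard : (G.properSubgraphs.card : ℝ) ≤ 2 ^ D := by
      have c1 : G.properSubgraphs.card ≤ G.subgraphs.card :=
        Finset.card_le_card (by rw [subgraphs_eq_insert]; exact Finset.subset_insert _ _)
      have c2 : G.properSubgraphs.card ≤ 2 ^ D :=
        c1.trans ((card_subgraphs_le G).trans (Nat.pow_le_pow_right (by norm_num) hG))
      exact_mod_cast c2
    have hsum : |∑ F ∈ G.properSubgraphs, proj P ξ η ζ X F ω| ≤ 2 ^ D * (M * b ^ t) := by
      refine (Finset.abs_sum_le_sum_abs _ _).trans ?_
      calc ∑ F ∈ G.properSubgraphs, |proj P ξ η ζ X F ω|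
          ≤ ∑ _F ∈ G.properSubgraphs, M * b ^ t := by
            refine Finset.sum_le_sum fun F hF => (a2 F hF).trans ?_
            have := size_lt_size (mem_properSubgraphs.1 hF)
            exact mul_le_mul_of_nonneg_left (pow_le_pow_right₀ hb1 (by omega)) hM
        _ = G.properSubgraphs.card * (M * b ^ t) := by rw [Finset.sum_const, nsmul_eq_mul]
        _ ≤ _ := mul_le_mul_of_nonneg_right hcard (by positivity)
    calc _ ≤ M + 2 ^ D * (M * b ^ t) := (abs_sub _ _).trans (add_le_add a1 hsum)
      _ ≤ M * b ^ t + 2 ^ D * (M * b ^ t) := by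
          gcongr; exact le_mul_of_one_le_right hM (one_le_pow₀ hb1)
      _ = M * b ^ G.size := by rw [ht, pow_succ, hb]; ring

end Proj

/-! ### Relabelling rows and columns -/

namespace BipGraph

/-- The image of a graph under maps of the row labels and of the column labels. -/
def map (σ τ : ℕ → ℕ) (G : BipGraph) : BipGraph :=
  ⟨G.rows.image σ, G.cols.image τ, G.edges.image (Prod.map σ τ), by
    intro e he
    obtain ⟨e', he', rfl⟩ := Finset.mem_image.1 he
    have := Finset.mem_product.1 (G.edges_subset he')
    exact Finset.mem_product.2 ⟨Finset.mem_image_of_mem _ this.1,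
      Finset.mem_image_of_mem _ this.2⟩⟩

variable {σ τ : ℕ → ℕ}

theorem map_mono {F G : BipGraph} (h : F ≤ G) : F.map σ τ ≤ G.map σ τ :=
  ⟨Finset.image_subset_image h.1, Finset.image_subset_image h.2.1,
    Finset.image_subset_image h.2.2⟩

theorem map_injective (hσ : σ.Injective) (hτ : τ.Injective) :
    Function.Injective (map σ τ) := by
  intro F G h
  simp only [map, BipGraph.mk.injEq] at h
  exact BipGraph.ext (Finset.image_injective hσ h.1) (Finset.image_injective hτ h.2.1)
    (Finset.image_injective (hσ.prodMap hτ) h.2.2)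

theorem exists_map_eq_of_le_map {F G : BipGraph} (h : F ≤ G.map σ τ) :
    ∃ F₀ ≤ G, F₀.map σ τ = F := by
  obtain ⟨h1, h2, h3⟩ := h
  refine ⟨⟨G.rows.filter (σ · ∈ F.rows), G.cols.filter (τ · ∈ F.cols),
    G.edges.filter (Prod.map σ τ · ∈ F.edges), ?_⟩, ⟨Finset.filter_subset _ _,
      Finset.filter_subset _ _, Finset.filter_subset _ _⟩, ?_⟩
  · intro e he
    obtain ⟨he1, he2⟩ := Finset.mem_filter.1 he
    have hG := Finset.mem_product.1 (G.edges_subset he1)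
    have hF := Finset.mem_product.1 (F.edges_subset he2)
    exact Finset.mem_product.2 ⟨Finset.mem_filter.2 ⟨hG.1, hF.1⟩,
      Finset.mem_filter.2 ⟨hG.2, hF.2⟩⟩
  · have key : ∀ {α β : Type} [DecidableEq β] (f : α → β) (s : Finset α) (t : Finset β),
        t ⊆ s.image f → (s.filter (f · ∈ t)).image f = t := by
      intro α β _ f s t ht
      ext x
      simp only [Finset.mem_image, Finset.mem_filter]
      constructor
      · rintro ⟨y, ⟨_, hy⟩, rfl⟩; exact hy
      · intro hx
        obtain ⟨y, hy, rfl⟩ := Finset.mem_image.1 (ht hx)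
        exact ⟨y, ⟨hy, hx⟩, rfl⟩
    exact BipGraph.ext (key _ _ _ h1) (key _ _ _ h2) (key _ _ _ h3)

theorem properSubgraphs_map (hσ : σ.Injective) (hτ : τ.Injective) (G : BipGraph) :
    (G.map σ τ).properSubgraphs = G.properSubgraphs.image (map σ τ) := by
  ext F
  simp only [mem_properSubgraphs, Finset.mem_image]
  constructor
  · intro h
    obtain ⟨F₀, hF₀, rfl⟩ := exists_map_eq_of_le_map h.le
    exact ⟨F₀, lt_of_le_of_ne hF₀ fun h' => h.ne (by rw [h']), rfl⟩
  · rintro ⟨F₀, hF₀, rfl⟩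
    exact lt_of_le_of_ne (map_mono hF₀.le) fun h' => hF₀.ne (map_injective hσ hτ h')

theorem map_congr {σ' τ' : ℕ → ℕ} {G : BipGraph} (hσ : Set.EqOn σ σ' G.rows)
    (hτ : Set.EqOn τ τ' G.cols) : G.map σ τ = G.map σ' τ' := by
  refine BipGraph.ext (Finset.image_congr hσ) (Finset.image_congr hτ)
    (Finset.image_congr fun e he => ?_)
  have := Finset.mem_product.1 (G.edges_subset he)
  exact Prod.ext (hσ this.1) (hτ this.2)

theorem map_id (G : BipGraph) : G.map id id = G := by
  refine BipGraph.ext Finset.image_id Finset.image_id ?_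
  simp [map]

end BipGraph

/-- A map that is injective on a finite set of labels agrees there with a globally injective map. -/
theorem exists_injective_eqOn (s : Finset ℕ) {f : ℕ → ℕ} (hf : Set.InjOn f s) :
    ∃ σ : ℕ → ℕ, σ.Injective ∧ Set.EqOn σ f s := by
  classical
  set M := (s.image f).sup id + 1
  have hM : ∀ x ∈ s, f x < M := fun x hx =>
    Nat.lt_succ_of_le (Finset.le_sup (f := id) (Finset.mem_image_of_mem f hx))
  refine ⟨fun x => if x ∈ s then f x else x + M, ?_, fun x hx => if_pos hx⟩
  intro x y hxy
  dsimp only at hxy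
  split_ifs at hxy with hx hy hy
  · exact hf hx hy hxy
  · have := hM x hx; omega
  · have := hM y hy; omega
  · omega

/-- A partial injection between finite sets of the same size extends to an injection of the labels
that maps one set onto the other. -/
theorem exists_injective_image_eq {R I I' : Finset ℕ} {f : ℕ → ℕ} (hf : Set.InjOn f R)
    (hRI : R ⊆ I) (hRI' : R.image f ⊆ I') (hcard : I.card = I'.card) :
    ∃ σ : ℕ → ℕ, σ.Injective ∧ Set.EqOn σ f R ∧ I.image σ = I' := by
  classical
  obtain ⟨g, hg⟩ := Finset.exists_equiv_extend_of_card_eq (α := I) (t := I')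
    (s := Finset.univ.filter fun x : I => (x : ℕ) ∈ R) (f := fun x => f x)
    (by simpa using hcard)
    (by
      intro y hy
      obtain ⟨x, hx, rfl⟩ := Finset.mem_image.1 hy
      exact hRI' (Finset.mem_image_of_mem f (Finset.mem_filter.1 hx).2))
    (by
      intro x hx y hy hxy
      exact Subtype.ext (hf (by simpa using hx) (by simpa using hy) hxy))
  obtain ⟨σ, hσ, hσg⟩ := exists_injective_eqOn I
    (f := fun x => if hx : x ∈ I then (g ⟨x, hx⟩ : ℕ) else 0) (by
      intro x hx y hy hxy
      simp only [Finset.mem_coe] at hx hy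
      simp only [hx, hy, dif_pos] at hxy
      have := g.injective (Subtype.ext hxy)
      simpa using this)
  have hval : ∀ x (hx : x ∈ I), σ x = g ⟨x, hx⟩ := fun x hx => by
    have h := hσg hx
    simpa [hx] using h
  refine ⟨σ, hσ, fun x hx => ?_, ?_⟩
  · rw [hval x (hRI hx)]
    exact hg ⟨x, hRI hx⟩ (by simpa using hx)
  · ext y
    simp only [Finset.mem_image]
    constructor
    · rintro ⟨x, hx, rfl⟩
      rw [hval x hx]
      exact (g _).2
    · intro hy
      exact ⟨g.symm ⟨y, hy⟩, (g.symm ⟨y, hy⟩).2, by rw [hval _ (g.symm ⟨y, hy⟩).2]; simp⟩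

theorem measurable_kernelAt {α : Type*} {mα : MeasurableSpace α} {p q : ℕ}
    {h : (Fin p → Fin q → ℝ) → ℝ} (hmeas : Measurable h) {φ : ℝ → ℝ → ℝ → ℝ}
    (hφ : Measurable fun t : ℝ × ℝ × ℝ => φ t.1 t.2.1 t.2.2) {x y : ℕ → α → ℝ}
    {z : ℕ → ℕ → α → ℝ} {I J : Finset ℕ} (hI : I.card = p) (hJ : J.card = q)
    (hx : ∀ i ∈ I, Measurable (x i)) (hy : ∀ j ∈ J, Measurable (y j))
    (hz : ∀ i ∈ I, ∀ j ∈ J, Measurable (z i j)) :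
    Measurable (kernelAt h (fun i j a => φ (x i a) (y j a) (z i j a)) I J hI hJ) := by
  refine hmeas.comp (measurable_pi_iff.2 fun a => measurable_pi_iff.2 fun b => ?_)
  have ha := Finset.orderEmbOfFin_mem I hI a
  have hb := Finset.orderEmbOfFin_mem J hJ b
  exact hφ.comp ((hx _ ha).prodMk ((hy _ hb).prodMk (hz _ ha _ hb)))

section Relabel

variable {Ω : Type*} [mΩ : MeasurableSpace Ω] {P : Measure Ω}
  {Y : ℕ → ℕ → Ω → ℝ} {φ : ℝ → ℝ → ℝ → ℝ} {ξ η : ℕ → Ω → ℝ} {ζ : ℕ → ℕ → Ω → ℝ}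
  {σ τ : ℕ → ℕ}

omit mΩ in
theorem sigmaH_relabel (G : BipGraph) :
    sigmaH (fun i => ξ (σ i)) (fun j => η (τ j)) (fun i j => ζ (σ i) (τ j)) G =
      sigmaH ξ η ζ (G.map σ τ) := by
  simp only [sigmaH, BipGraph.map, Finset.iSup_finset_image]
  rfl

theorem proj_relabel (hσ : σ.Injective) (hτ : τ.Injective) (X : Ω → ℝ) (G : BipGraph) :
    proj P (fun i => ξ (σ i)) (fun j => η (τ j)) (fun i j => ζ (σ i) (τ j)) X G =
      proj P ξ η ζ X (G.map σ τ) := by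
  induction G using BipGraph.strongInduction with
  | ih G ih =>
    rw [proj_eq, proj_eq, sigmaH_relabel, properSubgraphs_map hσ hτ,
      Finset.sum_image fun F _ F' _ h => map_injective hσ hτ h]
    congr 1
    exact Finset.sum_congr rfl fun F hF => ih F (mem_properSubgraphs.1 hF)

omit mΩ in
/-- By the symmetry of the kernel, relabelling the matrix amounts to relabelling the index sets. -/
theorem kernelAt_relabel {p q : ℕ} {h : (Fin p → Fin q → ℝ) → ℝ}
    (hsymm : ∀ (σ : Equiv.Perm (Fin p)) (τ : Equiv.Perm (Fin q)) (A : Fin p → Fin q → ℝ),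
      h (fun a b => A (σ a) (τ b)) = h A)
    (hσ : σ.Injective) (hτ : τ.Injective) {I J : Finset ℕ} (hI : I.card = p) (hJ : J.card = q)
    (hI' : (I.image σ).card = p) (hJ' : (J.image τ).card = q) :
    kernelAt h (fun i j => Y (σ i) (τ j)) I J hI hJ =
      kernelAt h Y (I.image σ) (J.image τ) hI' hJ' := by
  have key : ∀ {r : ℕ} {ρ : ℕ → ℕ} (_ : ρ.Injective) {A : Finset ℕ} (hA : A.card = r)
      (hA' : (A.image ρ).card = r), ∃ π : Equiv.Perm (Fin r), ∀ a,
        (A.image ρ).orderEmbOfFin hA' (π a) = ρ (A.orderEmbOfFin hA a) := by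
    intro r ρ hρ A hA hA'
    have hmem : ∀ a, ρ (A.orderEmbOfFin hA a) ∈ A.image ρ := fun a =>
      Finset.mem_image_of_mem _ (Finset.orderEmbOfFin_mem _ _ _)
    have hinj : Function.Injective fun a : Fin r =>
        ((A.image ρ).orderIsoOfFin hA').symm ⟨ρ (A.orderEmbOfFin hA a), hmem a⟩ := by
      intro a b hab
      have := congrArg Subtype.val (OrderIso.injective _ hab)
      exact (A.orderEmbOfFin hA).injective (hρ this)
    refine ⟨Equiv.ofBijective _ (Finite.injective_iff_bijective.1 hinj), fun a => ?_⟩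
    rw [← Finset.coe_orderIsoOfFin_apply]
    simp
  obtain ⟨π, hπ⟩ := key hσ hI hI'
  obtain ⟨π', hπ'⟩ := key hτ hJ hJ'
  funext ω
  have := hsymm π π' fun a b =>
    Y ((I.image σ).orderEmbOfFin hI' a) ((J.image τ).orderEmbOfFin hJ' b) ω
  simp only [hπ, hπ'] at this
  exact this

theorem IsAHKRepresentation.relabel (hY : IsAHKRepresentation P Y φ ξ η ζ)
    (hσ : σ.Injective) (hτ : τ.Injective) :
    IsAHKRepresentation P (fun i j => Y (σ i) (τ j)) φ (fun i => ξ (σ i)) (fun j => η (τ j))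
      (fun i j => ζ (σ i) (τ j)) where
  measurable_phi := hY.measurable_phi
  measurable_row i := hY.measurable_row _
  measurable_col j := hY.measurable_col _
  measurable_edge i j := hY.measurable_edge _ _
  uniform_row i := hY.uniform_row _
  uniform_col j := hY.uniform_col _
  uniform_edge i j := hY.uniform_edge _ _
  eq_ae i j := hY.eq_ae _ _
  indep := by
    have h := hY.indep.precomp (g := Sum.map σ (Sum.map τ (Prod.map σ τ)))
      (hσ.sumMap (hτ.sumMap (hσ.prodMap hτ)))
    convert h using 1
    funext x
    rcases x with i | j | e <;> rfl

/-! ### The canonical space of the variables -/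

/-- The random point of the canonical space whose coordinates are all the variables. -/
def point (ξ η : ℕ → Ω → ℝ) (ζ : ℕ → ℕ → Ω → ℝ) (ω : Ω) : ℕ ⊕ ℕ ⊕ ℕ × ℕ → ℝ :=
  fun x => allVars ξ η ζ x ω

/-- The row coordinates of the canonical space. -/
def rowCoord (i : ℕ) (z : ℕ ⊕ ℕ ⊕ ℕ × ℕ → ℝ) : ℝ := z (Sum.inl i)

/-- The column coordinates of the canonical space. -/
def colCoord (j : ℕ) (z : ℕ ⊕ ℕ ⊕ ℕ × ℕ → ℝ) : ℝ := z (Sum.inr (Sum.inl j))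

/-- The edge coordinates of the canonical space. -/
def edgeCoord (i j : ℕ) (z : ℕ ⊕ ℕ ⊕ ℕ × ℕ → ℝ) : ℝ := z (Sum.inr (Sum.inr (i, j)))

/-- The matrix entries as functions on the canonical space. -/
def entry (φ : ℝ → ℝ → ℝ → ℝ) (i j : ℕ) (z : ℕ ⊕ ℕ ⊕ ℕ × ℕ → ℝ) : ℝ :=
  φ (rowCoord i z) (colCoord j z) (edgeCoord i j z)

theorem IsAHKRepresentation.measurable_point (hY : IsAHKRepresentation P Y φ ξ η ζ) :
    Measurable (point ξ η ζ) :=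
  measurable_pi_iff.2 hY.measurable_allVars

/-- The law of all variables together does not depend on the representation. -/
theorem IsAHKRepresentation.map_point_eq {Y' : ℕ → ℕ → Ω → ℝ} {φ' : ℝ → ℝ → ℝ → ℝ}
    {ξ' η' : ℕ → Ω → ℝ} {ζ' : ℕ → ℕ → Ω → ℝ}
    (hY : IsAHKRepresentation P Y φ ξ η ζ) (hY' : IsAHKRepresentation P Y' φ' ξ' η' ζ') :
    P.map (point ξ η ζ) = P.map (point ξ' η' ζ') := by
  have h1 := hY.indep.map_fun_eq_infinitePi_map hY.measurable_allVars
  have h2 := hY'.indep.map_fun_eq_infinitePi_map hY'.measurable_allVars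
  refine h1.trans (Eq.trans ?_ h2.symm)
  congr 1
  funext x
  rcases x with i | j | e
  · exact (hY.uniform_row i).trans (hY'.uniform_row i).symm
  · exact (hY.uniform_col j).trans (hY'.uniform_col j).symm
  · exact (hY.uniform_edge _ _).trans (hY'.uniform_edge _ _).symm

omit mΩ in
theorem comap_point_sigmaH (G : BipGraph) :
    (sigmaH rowCoord colCoord edgeCoord G).comap (point ξ η ζ) = sigmaH ξ η ζ G := by
  simp only [sigmaH, MeasurableSpace.comap_sup, MeasurableSpace.comap_iSup,
    MeasurableSpace.comap_comp]
  rfl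

theorem measurable_allVars_coord (x : ℕ ⊕ ℕ ⊕ ℕ × ℕ) :
    Measurable (allVars rowCoord colCoord edgeCoord x) := by
  rcases x with i | j | e <;> exact measurable_pi_apply _

theorem sigmaH_coord_le (G : BipGraph) :
    sigmaH rowCoord colCoord edgeCoord G ≤ MeasurableSpace.pi := by
  rw [sigmaH_eq_iSup]
  exact iSup₂_le fun x _ => (measurable_allVars_coord x).comap_le

theorem IsAHKRepresentation.proj_comp_point [IsProbabilityMeasure P]
    (hY : IsAHKRepresentation P Y φ ξ η ζ) {f : (ℕ ⊕ ℕ ⊕ ℕ × ℕ → ℝ) → ℝ}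
    (hf : Integrable f (P.map (point ξ η ζ))) (G : BipGraph) :
    proj P ξ η ζ (f ∘ point ξ η ζ) G =ᵐ[P]
      proj (P.map (point ξ η ζ)) rowCoord colCoord edgeCoord f G ∘ point ξ η ζ := by
  have hprob := Measure.isProbabilityMeasure_map (μ := P) hY.measurable_point.aemeasurable
  have hmp : MeasurePreserving (point ξ η ζ) P (P.map (point ξ η ζ)) :=
    ⟨hY.measurable_point, rfl⟩
  induction G using BipGraph.strongInduction with
  | ih G ih =>
    rw [proj_eq, proj_eq]
    have h1 := condExp_comp_ae_eq hmp (sigmaH_coord_le G) hf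
    rw [comap_point_sigmaH] at h1
    have h2 : ∑ F ∈ G.properSubgraphs, proj P ξ η ζ (f ∘ point ξ η ζ) F =ᵐ[P]
        ∑ F ∈ G.properSubgraphs,
          proj (P.map (point ξ η ζ)) rowCoord colCoord edgeCoord f F ∘ point ξ η ζ :=
      eventuallyEq_sum fun F hF => ih F (mem_properSubgraphs.1 hF)
    refine (h1.sub h2).trans (Eventually.of_forall fun ω => ?_)
    simp

/-- A function measurable with respect to the variables of `G` only depends on those
coordinates. -/
theorem eq_of_stronglyMeasurable_sigmaH {G : BipGraph} {g : (ℕ ⊕ ℕ ⊕ ℕ × ℕ → ℝ) → ℝ}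
    (hg : StronglyMeasurable[sigmaH rowCoord colCoord edgeCoord G] g)
    {z z' : ℕ ⊕ ℕ ⊕ ℕ × ℕ → ℝ} (hz : ∀ x ∈ G.support, z x = z' x) : g z = g z' := by
  have hle : sigmaH rowCoord colCoord edgeCoord G ≤
      MeasurableSpace.comap (G.support.restrict (π := fun _ => ℝ)) MeasurableSpace.pi := by
    rw [sigmaH_eq_iSup]
    refine iSup₂_le fun x hx => ?_
    have : allVars rowCoord colCoord edgeCoord x =
        (fun u : G.support → ℝ => u ⟨x, hx⟩) ∘ G.support.restrict (π := fun _ => ℝ) := by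
      funext z
      rcases x with i | j | e <;> rfl
    rw [this, ← MeasurableSpace.comap_comp]
    exact MeasurableSpace.comap_mono (measurable_pi_apply _).comap_le
  obtain ⟨g', -, rfl⟩ := (hg.mono hle).exists_eq_measurable_comp
  have : G.support.restrict (π := fun _ => ℝ) z = G.support.restrict (π := fun _ => ℝ) z' := by
    funext x
    exact hz x x.2
  simp [Function.comp, this]

variable {p q : ℕ} {h : (Fin p → Fin q → ℝ) → ℝ}

theorem measurable_kernelAt_entry (hφ : Measurable fun t : ℝ × ℝ × ℝ => φ t.1 t.2.1 t.2.2)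
    (hmeas : Measurable h) {I J : Finset ℕ} (hI : I.card = p) (hJ : J.card = q) :
    Measurable (kernelAt h (entry φ) I J hI hJ) := by
  exact measurable_kernelAt hmeas hφ hI hJ (fun i _ => measurable_pi_apply _)
    (fun j _ => measurable_pi_apply _) (fun i _ j _ => measurable_pi_apply _)

theorem IsAHKRepresentation.kernelAt_ae_eq (hY : IsAHKRepresentation P Y φ ξ η ζ)
    {I J : Finset ℕ} (hI : I.card = p) (hJ : J.card = q) :
    kernelAt h Y I J hI hJ =ᵐ[P] kernelAt h (entry φ) I J hI hJ ∘ point ξ η ζ := by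
  have : ∀ᵐ ω ∂P, ∀ i j, Y i j ω = φ (ξ i ω) (η j ω) (ζ i j ω) :=
    ae_all_iff.2 fun i => ae_all_iff.2 fun j => hY.eq_ae i j
  filter_upwards [this] with ω hω
  simp only [kernelAt, hω, Function.comp]
  rfl

theorem IsAHKRepresentation.aestronglyMeasurable_kernelAt
    (hY : IsAHKRepresentation P Y φ ξ η ζ) (hmeas : Measurable h)
    {I J : Finset ℕ} (hI : I.card = p) (hJ : J.card = q) :
    AEStronglyMeasurable (kernelAt h Y I J hI hJ) P :=
  ((measurable_kernelAt_entry hY.measurable_phi hmeas hI hJ).comp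
    hY.measurable_point).aestronglyMeasurable.congr (hY.kernelAt_ae_eq hI hJ).symm

/-- The kernels at all submatrices have the same law. -/
theorem IsAHKRepresentation.identDistrib_kernelAt
    (hY : IsAHKRepresentation P Y φ ξ η ζ) (hmeas : Measurable h)
    (hsymm : ∀ (σ : Equiv.Perm (Fin p)) (τ : Equiv.Perm (Fin q)) (A : Fin p → Fin q → ℝ),
      h (fun a b => A (σ a) (τ b)) = h A)
    {I J : Finset ℕ} (hI : I.card = p) (hJ : J.card = q) :
    IdentDistrib (kernelAt h Y I J hI hJ) (kernel₀ h Y) P P := by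
  obtain ⟨σ, hσ, -, rfl⟩ := exists_injective_image_eq (R := ∅) (I := Finset.range p) (I' := I)
    (f := id) (by simp) (by simp) (by simp) (by simp [hI])
  obtain ⟨τ, hτ, -, rfl⟩ := exists_injective_image_eq (R := ∅) (I := Finset.range q) (I' := J)
    (f := id) (by simp) (by simp) (by simp) (by simp [hJ])
  rw [← kernelAt_relabel hsymm hσ hτ (Finset.card_range p) (Finset.card_range q)]
  have hY' := hY.relabel hσ hτ
  have hm := measurable_kernelAt_entry hY.measurable_phi hmeas (Finset.card_range p)
    (Finset.card_range q)
  refine ⟨(hY'.aestronglyMeasurable_kernelAt hmeas _ _).aemeasurable,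
    (hY.aestronglyMeasurable_kernelAt hmeas _ _).aemeasurable, ?_⟩
  rw [kernel₀, Measure.map_congr (hY'.kernelAt_ae_eq _ _),
    Measure.map_congr (hY.kernelAt_ae_eq _ _),
    ← Measure.map_map hm hY'.measurable_point, ← Measure.map_map hm hY.measurable_point,
    hY.map_point_eq hY']

theorem IsAHKRepresentation.memLp_kernelAt
    (hY : IsAHKRepresentation P Y φ ξ η ζ) (hmeas : Measurable h)
    (hsymm : ∀ (σ : Equiv.Perm (Fin p)) (τ : Equiv.Perm (Fin q)) (A : Fin p → Fin q → ℝ),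
      h (fun a b => A (σ a) (τ b)) = h A)
    (hL2 : MemLp (kernel₀ h Y) 2 P)
    {I J : Finset ℕ} (hI : I.card = p) (hJ : J.card = q) :
    MemLp (kernelAt h Y I J hI hJ) 2 P :=
  (hY.identDistrib_kernelAt hmeas hsymm hI hJ).symm.memLp_snd hL2

/-- The projections at all relabellings of a graph are given by one function of the relabelled
variables. -/
theorem IsAHKRepresentation.exists_proj_relabel_eq [IsProbabilityMeasure P]
    (hY : IsAHKRepresentation P Y φ ξ η ζ) (hmeas : Measurable h)
    (hsymm : ∀ (σ : Equiv.Perm (Fin p)) (τ : Equiv.Perm (Fin q)) (A : Fin p → Fin q → ℝ),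
      h (fun a b => A (σ a) (τ b)) = h A)
    (hL2 : MemLp (kernel₀ h Y) 2 P)
    {I J : Finset ℕ} (hI : I.card = p) (hJ : J.card = q) (G : BipGraph) :
    ∃ g, StronglyMeasurable[sigmaH rowCoord colCoord edgeCoord G] g ∧
      ∀ σ τ : ℕ → ℕ, σ.Injective → τ.Injective →
        ∀ (I' J' : Finset ℕ) (G' : BipGraph) (hI' : I'.card = p) (hJ' : J'.card = q),
        I.image σ = I' → J.image τ = J' → G.map σ τ = G' →
        proj P ξ η ζ (kernelAt h Y I' J' hI' hJ') G' =ᵐ[P]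
          g ∘ point (fun i => ξ (σ i)) (fun j => η (τ j)) (fun i j => ζ (σ i) (τ j)) := by
  refine ⟨proj (P.map (point ξ η ζ)) rowCoord colCoord edgeCoord
    (kernelAt h (entry φ) I J hI hJ) G, stronglyMeasurable_proj _ _, ?_⟩
  rintro σ τ hσ hτ _ _ _ hI' hJ' rfl rfl rfl
  have hY' := hY.relabel hσ hτ
  rw [← kernelAt_relabel hsymm hσ hτ hI hJ, ← proj_relabel hσ hτ, hY.map_point_eq hY']
  refine (proj_congr_ae (hY'.kernelAt_ae_eq hI hJ) G).trans (hY'.proj_comp_point ?_ G)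
  have hint := (hY.memLp_kernelAt hmeas hsymm hL2 hI hJ).integrable (by norm_num)
  rw [← hY.map_point_eq hY', integrable_map_measure
    (measurable_kernelAt_entry hY.measurable_phi hmeas hI hJ).aestronglyMeasurable
    hY.measurable_point.aemeasurable]
  exact hint.congr (hY.kernelAt_ae_eq hI hJ)

/-- The projection on `G` is the same for all `K_{I,J}` that contain `G`. -/
theorem IsAHKRepresentation.proj_kernelAt_ae_eq [IsProbabilityMeasure P]
    (hY : IsAHKRepresentation P Y φ ξ η ζ) (hmeas : Measurable h)
    (hsymm : ∀ (σ : Equiv.Perm (Fin p)) (τ : Equiv.Perm (Fin q)) (A : Fin p → Fin q → ℝ),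
      h (fun a b => A (σ a) (τ b)) = h A)
    (hL2 : MemLp (kernel₀ h Y) 2 P)
    {I J I' J' : Finset ℕ} (hI : I.card = p) (hJ : J.card = q) (hI' : I'.card = p)
    (hJ' : J'.card = q) {G : BipGraph} (hG : G ≤ K I J) (hG' : G ≤ K I' J') :
    proj P ξ η ζ (kernelAt h Y I J hI hJ) G =ᵐ[P]
      proj P ξ η ζ (kernelAt h Y I' J' hI' hJ') G := by
  obtain ⟨σ, hσ, hσG, rfl⟩ := exists_injective_image_eq (I := I) (f := id) (Set.injOn_id _) hG.1
    (by rw [Finset.image_id]; exact hG'.1) (hI.trans hI'.symm)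
  obtain ⟨τ, hτ, hτG, rfl⟩ := exists_injective_image_eq (I := J) (f := id) (Set.injOn_id _) hG.2.1
    (by rw [Finset.image_id]; exact hG'.2.1) (hJ.trans hJ'.symm)
  obtain ⟨g, hg, hgG⟩ := hY.exists_proj_relabel_eq hmeas hsymm hL2 hI hJ G
  have h1 := hgG id id Function.injective_id Function.injective_id I J G hI hJ
    Finset.image_id Finset.image_id (BipGraph.map_id G)
  have h2 := hgG σ τ hσ hτ _ _ G hI' hJ' rfl rfl
    ((map_congr hσG hτG).trans (BipGraph.map_id G))
  refine h1.trans (EventuallyEq.trans ?_ h2.symm)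
  refine Eventually.of_forall fun ω => eq_of_stronglyMeasurable_sigmaH hg ?_
  rintro (i | j | e) hx
  · exact congrArg (fun k => ξ k ω) (hσG (inl_mem_support.1 hx)).symm
  · exact congrArg (fun k => η k ω) (hτG (inr_inl_mem_support.1 hx)).symm
  · have he := Finset.mem_product.1 (G.edges_subset (inr_inr_mem_support.1 hx))
    have e1 : σ e.1 = e.1 := hσG he.1
    have e2 : τ e.2 = e.2 := hτG he.2
    simp [point, allVars, e1, e2]

/-- Projections on graphs that correspond under a relabelling have the same second moment. -/
theorem IsAHKRepresentation.integral_sq_proj_map [IsProbabilityMeasure P]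
    (hY : IsAHKRepresentation P Y φ ξ η ζ) (hmeas : Measurable h)
    (hsymm : ∀ (σ : Equiv.Perm (Fin p)) (τ : Equiv.Perm (Fin q)) (A : Fin p → Fin q → ℝ),
      h (fun a b => A (σ a) (τ b)) = h A)
    (hL2 : MemLp (kernel₀ h Y) 2 P)
    {I J : Finset ℕ} (hI : I.card = p) (hJ : J.card = q) (G : BipGraph)
    (hσ : σ.Injective) (hτ : τ.Injective)
    (hI' : (I.image σ).card = p) (hJ' : (J.image τ).card = q) :
    ∫ ω, proj P ξ η ζ (kernelAt h Y (I.image σ) (J.image τ) hI' hJ') (G.map σ τ) ω ^ 2 ∂P =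
      ∫ ω, proj P ξ η ζ (kernelAt h Y I J hI hJ) G ω ^ 2 ∂P := by
  obtain ⟨g, hg, hgG⟩ := hY.exists_proj_relabel_eq hmeas hsymm hL2 hI hJ G
  have h1 := hgG id id Function.injective_id Function.injective_id I J G hI hJ
    Finset.image_id Finset.image_id (BipGraph.map_id G)
  have h2 := hgG σ τ hσ hτ _ _ _ hI' hJ' rfl rfl rfl
  have hY' := hY.relabel hσ hτ
  have hg' : Measurable fun z => g z ^ 2 := (hg.mono (sigmaH_coord_le G)).measurable.pow_const 2
  calc _ = ∫ ω, (fun z => g z ^ 2) (point (fun i => ξ (σ i)) (fun j => η (τ j))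
          (fun i j => ζ (σ i) (τ j)) ω) ∂P :=
        integral_congr_ae (h2.mono fun ω hω => by rw [hω]; rfl)
    _ = ∫ ω, (fun z => g z ^ 2) (point ξ η ζ ω) ∂P := by
        rw [← integral_map hY'.measurable_point.aemeasurable hg'.aestronglyMeasurable,
          ← hY.map_point_eq hY', integral_map hY.measurable_point.aemeasurable
            hg'.aestronglyMeasurable]
    _ = _ := integral_congr_ae (h1.mono fun ω hω => by rw [hω]; rfl)

end Relabel

/-! ### Counting copies of a graph -/

namespace BipGraph

/-- The isomorphisms from `G` to `F`. -/
abbrev Isos (G F : BipGraph) : Type :=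
  {Φ : (G.rows ≃ F.rows) × (G.cols ≃ F.cols) //
    ∀ (i : G.rows) (j : G.cols),
      ((i : ℕ), (j : ℕ)) ∈ G.edges ↔ ((Φ.1 i : ℕ), (Φ.2 j : ℕ)) ∈ F.edges}

instance (G F : BipGraph) : Finite (Isos G F) := Subtype.finite

theorem iso_iff_nonempty_isos {G F : BipGraph} : Iso G F ↔ Nonempty (Isos G F) :=
  ⟨fun ⟨σ, τ, h⟩ => ⟨⟨(σ, τ), h⟩⟩, fun ⟨⟨(σ, τ), h⟩⟩ => ⟨σ, τ, h⟩⟩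

theorem Iso.symm {G F : BipGraph} (h : Iso G F) : Iso F G := by
  obtain ⟨σ, τ, h⟩ := h
  refine ⟨σ.symm, τ.symm, fun i j => ?_⟩
  have := h (σ.symm i) (τ.symm j)
  simp only [Equiv.apply_symm_apply] at this
  exact this.symm

theorem Iso.trans {E F G : BipGraph} (h : Iso E F) (h' : Iso F G) : Iso E G := by
  obtain ⟨σ, τ, h⟩ := h
  obtain ⟨σ', τ', h'⟩ := h'
  exact ⟨σ.trans σ', τ.trans τ', fun i j => (h i j).trans (h' (σ i) (τ j))⟩

theorem Iso.v₁_eq {G F : BipGraph} (h : Iso G F) : G.v₁ = F.v₁ := by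
  obtain ⟨σ, -, -⟩ := h
  simpa [v₁] using Fintype.card_congr σ

theorem Iso.v₂_eq {G F : BipGraph} (h : Iso G F) : G.v₂ = F.v₂ := by
  obtain ⟨-, τ, -⟩ := h
  simpa [v₂] using Fintype.card_congr τ

theorem card_isos {G F : BipGraph} (h : Iso G F) : Nat.card (Isos G F) = G.autCard := by
  obtain ⟨σ, τ, hστ⟩ := h
  refine Nat.card_congr
    { toFun := fun Φ => ⟨(Φ.1.1.trans σ.symm, Φ.1.2.trans τ.symm), fun i j => ?_⟩
      invFun := fun Φ => ⟨(Φ.1.1.trans σ, Φ.1.2.trans τ), fun i j => ?_⟩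
      left_inv := fun Φ => Subtype.ext (Prod.ext ?_ ?_)
      right_inv := fun Φ => Subtype.ext (Prod.ext ?_ ?_) }
  · rw [Φ.2 i j, hστ]; simp
  · rw [Φ.2 i j, hστ]; simp
  all_goals ext; simp

/-- Injective relabellings are isomorphisms onto the image graph. -/
theorem exists_isos_map {σ τ : ℕ → ℕ} (hσ : σ.Injective) (hτ : τ.Injective) (G : BipGraph) :
    ∃ Φ : Isos G (G.map σ τ), (∀ i, (Φ.1.1 i : ℕ) = σ i) ∧ ∀ j, (Φ.1.2 j : ℕ) = τ j := by
  have key : ∀ {ρ : ℕ → ℕ} (_ : ρ.Injective) (s : Finset ℕ), ∃ e : s ≃ s.image ρ,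
      ∀ x, (e x : ℕ) = ρ x := fun {ρ} hρ s =>
    ⟨Equiv.ofBijective (fun x => ⟨ρ x, Finset.mem_image_of_mem ρ x.2⟩)
      ⟨fun x y h => Subtype.ext (hρ (congrArg Subtype.val h)), fun ⟨y, hy⟩ => by
        obtain ⟨x, hx, rfl⟩ := Finset.mem_image.1 hy
        exact ⟨⟨x, hx⟩, rfl⟩⟩, fun _ => rfl⟩
  obtain ⟨e₁, h₁⟩ := key hσ G.rows
  obtain ⟨e₂, h₂⟩ := key hτ G.cols
  refine ⟨⟨(e₁, e₂), fun i j => ?_⟩, h₁, h₂⟩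
  have h : ((e₁ i : ℕ), (e₂ j : ℕ)) = Prod.map σ τ (i, j) := Prod.ext (h₁ i) (h₂ j)
  change _ ↔ ((e₁ i : ℕ), (e₂ j : ℕ)) ∈ G.edges.image (Prod.map σ τ)
  rw [h, (hσ.prodMap hτ).mem_finset_image]

theorem iso_map {σ τ : ℕ → ℕ} (hσ : σ.Injective) (hτ : τ.Injective) (G : BipGraph) :
    Iso G (G.map σ τ) :=
  iso_iff_nonempty_isos.2 ⟨(exists_isos_map hσ hτ G).choose⟩

/-- Isomorphic graphs correspond under a relabelling, which may be chosen to map given larger sets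
of rows and columns onto each other. -/
theorem Iso.exists_map_eq {F G : BipGraph} (h : Iso F G) {I J I' J' : Finset ℕ} (hF : F ≤ K I J)
    (hG : G ≤ K I' J') (hI : I.card = I'.card) (hJ : J.card = J'.card) :
    ∃ σ τ : ℕ → ℕ, σ.Injective ∧ τ.Injective ∧ F.map σ τ = G ∧ I.image σ = I' ∧
      J.image τ = J' := by
  classical
  obtain ⟨e₁, e₂, he⟩ := h
  have key : ∀ {A B S S' : Finset ℕ} (e : A ≃ B) (_ : A ⊆ S) (_ : B ⊆ S')
      (_ : S.card = S'.card), ∃ σ : ℕ → ℕ, σ.Injective ∧ (∀ x : A, σ x = e x) ∧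
        S.image σ = S' := by
    intro A B S S' e hA hB hS
    obtain ⟨σ, h1, h2, h3⟩ := exists_injective_image_eq (R := A) (I := S) (I' := S')
      (f := fun x => if hx : x ∈ A then (e ⟨x, hx⟩ : ℕ) else 0)
      (by
        intro x hx y hy hxy
        simp only [Finset.mem_coe] at hx hy
        simp only [hx, hy, dif_pos] at hxy
        simpa using e.injective (Subtype.ext hxy)) hA
      (by
        intro y hy
        obtain ⟨x, hx, rfl⟩ := Finset.mem_image.1 hy
        simp only [hx, dif_pos]
        exact hB (e _).2) hS
    refine ⟨σ, h1, fun x => ?_, h3⟩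
    have := h2 x.2
    simpa using this
  have himg : ∀ {A B : Finset ℕ} (e : A ≃ B) {σ : ℕ → ℕ} (_ : ∀ x : A, σ x = e x),
      A.image σ = B := by
    intro A B e σ hσ
    ext y
    simp only [Finset.mem_image]
    constructor
    · rintro ⟨x, hx, rfl⟩
      rw [hσ ⟨x, hx⟩]
      exact (e _).2
    · intro hy
      exact ⟨e.symm ⟨y, hy⟩, (e.symm ⟨y, hy⟩).2, by rw [hσ]; simp⟩
  obtain ⟨σ, hσ, hσe, hσI⟩ := key e₁ hF.1 hG.1 hI
  obtain ⟨τ, hτ, hτe, hτJ⟩ := key e₂ hF.2.1 hG.2.1 hJ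
  refine ⟨σ, τ, hσ, hτ, BipGraph.ext (himg e₁ hσe) (himg e₂ hτe) ?_, hσI, hτJ⟩
  ext ⟨x, y⟩
  simp only [map, Finset.mem_image, Prod.exists, Prod.map_apply, Prod.mk.injEq]
  constructor
  · rintro ⟨a, b, hab, rfl, rfl⟩
    have hm := Finset.mem_product.1 (F.edges_subset hab)
    have := (he ⟨a, hm.1⟩ ⟨b, hm.2⟩).1 hab
    rwa [← hσe, ← hτe] at this
  · intro hxy
    have hm := Finset.mem_product.1 (G.edges_subset hxy)
    refine ⟨e₁.symm ⟨x, hm.1⟩, e₂.symm ⟨y, hm.2⟩, ?_, by rw [hσe]; simp, by rw [hτe]; simp⟩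
    rw [he]
    simpa using hxy

/-- A copy of `G` in `K_{[m],[n]}` together with an isomorphism is the same as a pair of injections
of the rows and the columns of `G`. -/
theorem sum_card_isos (G : BipGraph) (m n : ℕ) :
    ∑ F ∈ (K (Finset.range m) (Finset.range n)).subgraphs, Nat.card (Isos G F) =
      m.descFactorial G.v₁ * n.descFactorial G.v₂ := by
  classical
  set T := (K (Finset.range m) (Finset.range n)).subgraphs with hT
  have hTle : ∀ F : T, F.1 ≤ K (Finset.range m) (Finset.range n) := fun F =>
    mem_subgraphs.1 F.2
  let Ψ : (Σ F : T, Isos G F.1) → (G.rows ↪ Finset.range m) × (G.cols ↪ Finset.range n) :=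
    fun x => (x.2.1.1.toEmbedding.trans
        ⟨fun i => ⟨i.1, (hTle x.1).1 i.2⟩, fun i j h => Subtype.ext (congrArg (fun y => y.1) h)⟩,
      x.2.1.2.toEmbedding.trans
        ⟨fun i => ⟨i.1, (hTle x.1).2.1 i.2⟩, fun i j h => Subtype.ext (congrArg (fun y => y.1) h)⟩)
  have hΨ₁ : ∀ x i, ((Ψ x).1 i : ℕ) = x.2.1.1 i := fun x i => rfl
  have hΨ₂ : ∀ x i, ((Ψ x).2 i : ℕ) = x.2.1.2 i := fun x i => rfl
  have hinj : Function.Injective Ψ := by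
    rintro ⟨⟨F, hF⟩, Φ⟩ ⟨⟨F', hF'⟩, Φ'⟩ h
    have h1 : ∀ i, (Φ.1.1 i : ℕ) = Φ'.1.1 i := fun i => by
      rw [← hΨ₁ ⟨⟨F, hF⟩, Φ⟩ i, h, hΨ₁]
    have h2 : ∀ i, (Φ.1.2 i : ℕ) = Φ'.1.2 i := fun i => by
      rw [← hΨ₂ ⟨⟨F, hF⟩, Φ⟩ i, h, hΨ₂]
    have hsub : ∀ {A B C : Finset ℕ} (e : A ≃ B) (e' : A ≃ C) (_ : ∀ i, (e i : ℕ) = e' i),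
        B ⊆ C := fun {A B C} e e' hee y hy => by
      have := hee (e.symm ⟨y, hy⟩)
      simp only [Equiv.apply_symm_apply] at this
      rw [this]
      exact (e' _).2
    have hedge : ∀ {F F' : BipGraph} (Φ : Isos G F) (Φ' : Isos G F')
        (_ : ∀ i, (Φ.1.1 i : ℕ) = Φ'.1.1 i) (_ : ∀ i, (Φ.1.2 i : ℕ) = Φ'.1.2 i),
        F.edges ⊆ F'.edges := by
      rintro F F' Φ Φ' h1 h2 ⟨x, y⟩ hxy
      have hm := Finset.mem_product.1 (F.edges_subset hxy)
      have a1 := h1 (Φ.1.1.symm ⟨x, hm.1⟩)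
      have a2 := h2 (Φ.1.2.symm ⟨y, hm.2⟩)
      simp only [Equiv.apply_symm_apply] at a1 a2
      have h3 := (Φ.2 (Φ.1.1.symm ⟨x, hm.1⟩) (Φ.1.2.symm ⟨y, hm.2⟩)).2 (by simpa using hxy)
      rw [Φ'.2] at h3
      have h4 := congrArg₂ Prod.mk a1 a2
      rw [h4]
      exact h3
    have hFF : F = F' := BipGraph.ext
      (Finset.Subset.antisymm (hsub Φ.1.1 Φ'.1.1 h1) (hsub Φ'.1.1 Φ.1.1 fun i => (h1 i).symm))
      (Finset.Subset.antisymm (hsub Φ.1.2 Φ'.1.2 h2) (hsub Φ'.1.2 Φ.1.2 fun i => (h2 i).symm))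
      (Finset.Subset.antisymm (hedge Φ Φ' h1 h2)
        (hedge Φ' Φ (fun i => (h1 i).symm) fun i => (h2 i).symm))
    subst hFF
    have : Φ = Φ' := Subtype.ext (Prod.ext (Equiv.ext fun i => Subtype.ext (h1 i))
      (Equiv.ext fun i => Subtype.ext (h2 i)))
    rw [this]
  have hsurj : Function.Surjective Ψ := by
    rintro ⟨f, g⟩
    obtain ⟨σ, hσ, hσf⟩ := exists_injective_eqOn G.rows
      (f := fun x => if hx : x ∈ G.rows then (f ⟨x, hx⟩ : ℕ) else 0) (by
        intro x hx y hy hxy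
        simp only [Finset.mem_coe] at hx hy
        simp only [hx, hy, dif_pos] at hxy
        simpa using f.injective (Subtype.ext hxy))
    obtain ⟨τ, hτ, hτg⟩ := exists_injective_eqOn G.cols
      (f := fun x => if hx : x ∈ G.cols then (g ⟨x, hx⟩ : ℕ) else 0) (by
        intro x hx y hy hxy
        simp only [Finset.mem_coe] at hx hy
        simp only [hx, hy, dif_pos] at hxy
        simpa using g.injective (Subtype.ext hxy))
    have hσf' : ∀ i : G.rows, σ i = f i := fun i => by simpa using hσf i.2
    have hτg' : ∀ i : G.cols, τ i = g i := fun i => by simpa using hτg i.2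
    obtain ⟨Φ, h₁, h₂⟩ := exists_isos_map hσ hτ G
    have hle : G.map σ τ ∈ T := by
      rw [hT, mem_subgraphs]
      have hr : G.rows.image σ ⊆ Finset.range m := by
        intro y hy
        obtain ⟨x, hx, rfl⟩ := Finset.mem_image.1 hy
        rw [hσf' ⟨x, hx⟩]
        exact (f _).2
      have hc : G.cols.image τ ⊆ Finset.range n := by
        intro y hy
        obtain ⟨x, hx, rfl⟩ := Finset.mem_image.1 hy
        rw [hτg' ⟨x, hx⟩]
        exact (g _).2
      exact ⟨hr, hc, (G.map σ τ).edges_subset.trans (Finset.product_subset_product hr hc)⟩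
    refine ⟨⟨⟨G.map σ τ, hle⟩, Φ⟩, Prod.ext ?_ ?_⟩
    · ext i
      exact (h₁ i).trans (hσf' i)
    · ext i
      exact (h₂ i).trans (hτg' i)
  have hcard := Nat.card_congr (Equiv.ofBijective Ψ ⟨hinj, hsurj⟩)
  rw [Nat.card_sigma, Nat.card_prod] at hcard
  rw [← Finset.sum_coe_sort T fun F => Nat.card (Isos G F), hcard]
  simp [v₁, v₂, Fintype.card_embedding_eq, Nat.card_eq_fintype_card, -Finset.mem_range]

open Classical in
theorem card_filter_iso_mul_autCard (G : BipGraph) (m n : ℕ) :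
    ((K (Finset.range m) (Finset.range n)).subgraphs.filter (Iso G ·)).card * G.autCard =
      m.descFactorial G.v₁ * n.descFactorial G.v₂ := by
  classical
  rw [← sum_card_isos, Finset.card_filter, Finset.sum_mul]
  refine Finset.sum_congr rfl fun F _ => ?_
  split_ifs with h
  · rw [one_mul, card_isos h]
  · rw [zero_mul]
    have : IsEmpty (Isos G F) := not_nonempty_iff.1 fun h' => h (iso_iff_nonempty_isos.2 h')
    exact Nat.card_of_isEmpty.symm

theorem autCard_pos (G : BipGraph) : 0 < G.autCard := by
  have : Nonempty (Isos G G) := ⟨⟨(Equiv.refl _, Equiv.refl _), fun _ _ => Iff.rfl⟩⟩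
  exact Nat.card_pos (α := Isos G G)

theorem mem_Gam {r c : ℕ} {G : BipGraph} :
    G ∈ Gam r c ↔ ∃ x : Quotient (isoSetoid r c), x.out.1 = G := by
  simp [Gam]

theorem v₁_of_mem_Gam {r c : ℕ} {G : BipGraph} (h : G ∈ Gam r c) : G.v₁ = r := by
  obtain ⟨x, rfl⟩ := mem_Gam.1 h
  exact x.out.2.2.1

theorem v₂_of_mem_Gam {r c : ℕ} {G : BipGraph} (h : G ∈ Gam r c) : G.v₂ = c := by
  obtain ⟨x, rfl⟩ := mem_Gam.1 h
  exact x.out.2.2.2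

theorem le_K_of_mem_Gam {r c : ℕ} {G : BipGraph} (h : G ∈ Gam r c) :
    G ≤ K (Finset.range r) (Finset.range c) := by
  obtain ⟨x, rfl⟩ := mem_Gam.1 h
  exact x.out.2.1

theorem existsUnique_mem_Gam_iso (F : BipGraph) : ∃! G, G ∈ Gam F.v₁ F.v₂ ∧ Iso G F := by
  obtain ⟨σ, hσ, -, hσF⟩ := exists_injective_image_eq (R := ∅) (I := F.rows)
    (I' := Finset.range F.v₁) (f := id) (by simp) (by simp) (by simp) (by simp [v₁])
  obtain ⟨τ, hτ, -, hτF⟩ := exists_injective_image_eq (R := ∅) (I := F.cols)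
    (I' := Finset.range F.v₂) (f := id) (by simp) (by simp) (by simp) (by simp [v₂])
  have hiso := iso_map hσ hτ F
  have hsub : F.map σ τ ≤ K (Finset.range F.v₁) (Finset.range F.v₂) := by
    rw [← hσF, ← hτF]
    exact ⟨subset_rfl, subset_rfl, (F.map σ τ).edges_subset⟩
  let x : Spanning F.v₁ F.v₂ := ⟨F.map σ τ, hsub, hiso.v₁_eq.symm, hiso.v₂_eq.symm⟩
  have hx : Iso (Quotient.out (s := isoSetoid F.v₁ F.v₂) ⟦x⟧).1 x.1 :=
    Quotient.mk_out (s := isoSetoid F.v₁ F.v₂) x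
  refine ⟨_, ⟨mem_Gam.2 ⟨⟦x⟧, rfl⟩, hx.trans hiso.symm⟩, ?_⟩
  rintro G ⟨hG, hGF⟩
  obtain ⟨y, rfl⟩ := mem_Gam.1 hG
  have hyx : Iso y.out.1 x.1 := hGF.trans hiso
  have : y = ⟦x⟧ := by
    rw [← Quotient.out_eq y]
    exact Quotient.sound (s := isoSetoid F.v₁ F.v₂) hyx
  rw [this]

/-- A sum of an isomorphism invariant over all subgraphs of `K_{[m],[n]}` with `r` rows and `c`
columns is a sum over isomorphism classes. -/
theorem sum_subgraphs_K_eq_sum_Gam (m n r c : ℕ) (e : BipGraph → ℝ)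
    (he : ∀ F G : BipGraph, F.v₁ = r → F.v₂ = c → Iso G F → e G = e F) :
    ∑ F ∈ (K (Finset.range m) (Finset.range n)).subgraphs with F.v₁ = r ∧ F.v₂ = c, e F =
      (m.descFactorial r : ℝ) * n.descFactorial c *
        ∑ G ∈ Gam r c, (G.autCard : ℝ)⁻¹ * e G := by
  classical
  set T := (K (Finset.range m) (Finset.range n)).subgraphs
  have h1 : ∀ F ∈ T.filter (fun F => F.v₁ = r ∧ F.v₂ = c),
      e F = ∑ G ∈ Gam r c, if Iso G F then e G else 0 := by
    intro F hF
    obtain ⟨-, rfl, rfl⟩ := Finset.mem_filter.1 hF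
    obtain ⟨G, ⟨hG, hGF⟩, huniq⟩ := existsUnique_mem_Gam_iso F
    rw [Finset.sum_eq_single G, if_pos hGF, he F G rfl rfl hGF]
    · intro G' hG' hne
      exact if_neg fun h => hne (huniq G' ⟨hG', h⟩)
    · exact fun h => (h hG).elim
  rw [Finset.sum_congr rfl h1, Finset.sum_comm, Finset.mul_sum]
  refine Finset.sum_congr rfl fun G hG => ?_
  have hv₁ := v₁_of_mem_Gam hG
  have hv₂ := v₂_of_mem_Gam hG
  have hcount := card_filter_iso_mul_autCard G m n
  rw [hv₁, hv₂] at hcount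
  have hfilter : (T.filter (fun F => F.v₁ = r ∧ F.v₂ = c)).filter (Iso G ·) =
      T.filter (Iso G ·) := by
    rw [Finset.filter_filter]
    refine Finset.filter_congr fun F _ => ⟨fun h => h.2, fun h => ⟨⟨?_, ?_⟩, h⟩⟩
    · rw [← h.v₁_eq, hv₁]
    · rw [← h.v₂_eq, hv₂]
  rw [← Finset.sum_filter, hfilter, Finset.sum_const, nsmul_eq_mul]
  have hpos : (G.autCard : ℝ) ≠ 0 := Nat.cast_ne_zero.2 G.autCard_pos.ne'
  have hcount' : ((T.filter (Iso G ·)).card : ℝ) * G.autCard =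
      (m.descFactorial r : ℝ) * n.descFactorial c := by exact_mod_cast hcount
  rw [← hcount']
  field_simp

end BipGraph

/-! ### The Hoeffding decomposition of the U-statistic -/

/-- The standing assumptions: an Aldous-Hoover-Kallenberg representation and a symmetric, square
integrable kernel. -/
structure IsKernel {Ω : Type*} [MeasurableSpace Ω] (P : Measure Ω) (Y : ℕ → ℕ → Ω → ℝ)
    (φ : ℝ → ℝ → ℝ → ℝ) (ξ η : ℕ → Ω → ℝ) (ζ : ℕ → ℕ → Ω → ℝ) {p q : ℕ}
    (h : (Fin p → Fin q → ℝ) → ℝ) : Prop where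
  repr : IsAHKRepresentation P Y φ ξ η ζ
  meas : Measurable h
  symm : ∀ (σ : Equiv.Perm (Fin p)) (τ : Equiv.Perm (Fin q)) (A : Fin p → Fin q → ℝ),
    h (fun a b => A (σ a) (τ b)) = h A
  memLp : MemLp (kernel₀ h Y) 2 P

open Classical in
/-- The projection `p^G`, taken at the kernel of an arbitrarily chosen `K_{I,J}` that contains `G`;
it is zero if `G` has too many nodes to be contained in one. -/
def graphProj {Ω : Type*} [MeasurableSpace Ω] (P : Measure Ω) (ξ η : ℕ → Ω → ℝ)
    (ζ : ℕ → ℕ → Ω → ℝ) {p q : ℕ} (h : (Fin p → Fin q → ℝ) → ℝ) (Y : ℕ → ℕ → Ω → ℝ)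
    (G : BipGraph) : Ω → ℝ :=
  if H : ∃ A : {A : Finset ℕ × Finset ℕ // A.1.card = p ∧ A.2.card = q}, G ≤ K A.1.1 A.1.2 then
    proj P ξ η ζ (kernelAt h Y H.choose.1.1 H.choose.1.2 H.choose.2.1 H.choose.2.2) G
  else 0

theorem BipGraph.exists_le_K {G : BipGraph} {p q : ℕ} (hp : G.v₁ ≤ p) (hq : G.v₂ ≤ q) :
    ∃ A : {A : Finset ℕ × Finset ℕ // A.1.card = p ∧ A.2.card = q}, G ≤ K A.1.1 A.1.2 := by
  obtain ⟨I, hI, hIc⟩ := Infinite.exists_superset_card_eq G.rows p hp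
  obtain ⟨J, hJ, hJc⟩ := Infinite.exists_superset_card_eq G.cols q hq
  exact ⟨⟨(I, J), hIc, hJc⟩, hI, hJ,
    G.edges_subset.trans (Finset.product_subset_product hI hJ)⟩

/-- The graph without nodes. -/
def BipGraph.empty : BipGraph := ⟨∅, ∅, ∅, Finset.empty_subset _⟩

theorem BipGraph.empty_le (G : BipGraph) : BipGraph.empty ≤ G :=
  ⟨Finset.empty_subset _, Finset.empty_subset _, Finset.empty_subset _⟩

/-- The copies in `K_{[m],[n]}` of graphs with at most `p` rows and `q` columns. -/
def copies (p q m n : ℕ) : Finset BipGraph :=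
  (K (Finset.range m) (Finset.range n)).subgraphs.filter fun F => F.v₁ ≤ p ∧ F.v₂ ≤ q

/-- The coefficient of `p^G` in the decomposition of `U_{m,n}`, for a graph `G` with `r` rows and
`c` columns. -/
def hoeffdingCoeff (p q m n r c : ℕ) : ℝ :=
  ((p.descFactorial r : ℝ) * q.descFactorial c) / ((m.descFactorial r : ℝ) * n.descFactorial c)

theorem card_filter_superset {S R : Finset ℕ} (hRS : R ⊆ S) {p : ℕ} (hp : R.card ≤ p) :
    ((S.powersetCard p).filter (R ⊆ ·)).card = (S.card - R.card).choose (p - R.card) := by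
  classical
  rw [← Finset.card_sdiff_of_subset hRS, ← Finset.card_powersetCard]
  symm
  refine Finset.card_bij' (fun A _ => A ∪ R) (fun A _ => A \ R) ?_ ?_ ?_ ?_
  · intro A hA
    obtain ⟨hA1, hA2⟩ := Finset.mem_powersetCard.1 hA
    have hd : Disjoint A R := Finset.disjoint_of_subset_left hA1 Finset.sdiff_disjoint
    refine Finset.mem_filter.2 ⟨Finset.mem_powersetCard.2 ⟨Finset.union_subset
      (hA1.trans Finset.sdiff_subset) hRS, ?_⟩, Finset.subset_union_right⟩
    rw [Finset.card_union_of_disjoint hd, hA2]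
    omega
  · intro A hA
    obtain ⟨hA1, hA2⟩ := Finset.mem_filter.1 hA
    obtain ⟨hA3, hA4⟩ := Finset.mem_powersetCard.1 hA1
    exact Finset.mem_powersetCard.2 ⟨Finset.sdiff_subset_sdiff hA3 le_rfl, by
      rw [Finset.card_sdiff_of_subset hA2, hA4]⟩
  · intro A hA
    obtain ⟨hA1, hA2⟩ := Finset.mem_powersetCard.1 hA
    have hd : Disjoint A R := Finset.disjoint_of_subset_left hA1 Finset.sdiff_disjoint
    exact Finset.union_sdiff_cancel_right hd
  · intro A hA
    exact Finset.sdiff_union_of_subset (Finset.mem_filter.1 hA).2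

theorem choose_div_choose_eq {p m r : ℕ} (hr : r ≤ p) (hp : p ≤ m) :
    ((m - r).choose (p - r) : ℝ) / m.choose p = (p.descFactorial r : ℝ) / m.descFactorial r := by
  have h1 : (m.choose p : ℝ) * p.choose r = m.choose r * (m - r).choose (p - r) := by
    exact_mod_cast Nat.choose_mul hr
  have h2 : (m.choose p : ℝ) ≠ 0 := Nat.cast_ne_zero.2 (Nat.choose_pos hp).ne'
  have h3 : (m.choose r : ℝ) ≠ 0 := Nat.cast_ne_zero.2 (Nat.choose_pos (hr.trans hp)).ne'
  have h4 : (r.factorial : ℝ) ≠ 0 := Nat.cast_ne_zero.2 r.factorial_ne_zero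
  rw [Nat.descFactorial_eq_factorial_mul_choose, Nat.descFactorial_eq_factorial_mul_choose]
  push_cast
  rw [mul_div_mul_left _ _ h4, div_eq_div_iff h2 h3]
  linarith

section Decomposition

variable {Ω : Type*} [mΩ : MeasurableSpace Ω] {P : Measure Ω}
  {Y : ℕ → ℕ → Ω → ℝ} {φ : ℝ → ℝ → ℝ → ℝ} {ξ η : ℕ → Ω → ℝ} {ζ : ℕ → ℕ → Ω → ℝ}
  {p q : ℕ} {h : (Fin p → Fin q → ℝ) → ℝ}

theorem graphProj_eq_proj_or_zero (G : BipGraph) :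
    (∃ (I J : Finset ℕ) (hI : I.card = p) (hJ : J.card = q), G ≤ K I J ∧
      graphProj P ξ η ζ h Y G = proj P ξ η ζ (kernelAt h Y I J hI hJ) G) ∨
    graphProj P ξ η ζ h Y G = 0 := by
  by_cases H : ∃ A : {A : Finset ℕ × Finset ℕ // A.1.card = p ∧ A.2.card = q}, G ≤ K A.1.1 A.1.2
  · exact Or.inl ⟨_, _, H.choose.2.1, H.choose.2.2, H.choose_spec, dif_pos H⟩
  · exact Or.inr (dif_neg H)

theorem stronglyMeasurable_graphProj (G : BipGraph) :
    StronglyMeasurable[sigmaH ξ η ζ G] (graphProj P ξ η ζ h Y G) := by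
  rcases graphProj_eq_proj_or_zero (P := P) (ξ := ξ) (η := η) (ζ := ζ) (h := h) (Y := Y) G with
    ⟨I, J, hI, hJ, -, hG⟩ | hG
  · rw [hG]; exact stronglyMeasurable_proj _ _
  · rw [hG]; exact stronglyMeasurable_zero

theorem IsKernel.memLp_kernelAt (hK : IsKernel P Y φ ξ η ζ h) {I J : Finset ℕ} (hI : I.card = p)
    (hJ : J.card = q) : MemLp (kernelAt h Y I J hI hJ) 2 P :=
  hK.repr.memLp_kernelAt hK.meas hK.symm hK.memLp hI hJ

theorem IsKernel.memLp_graphProj (hK : IsKernel P Y φ ξ η ζ h) (G : BipGraph) :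
    MemLp (graphProj P ξ η ζ h Y G) 2 P := by
  rcases graphProj_eq_proj_or_zero (P := P) (ξ := ξ) (η := η) (ζ := ζ) (h := h) (Y := Y) G with
    ⟨I, J, hI, hJ, -, hG⟩ | hG
  · rw [hG]; exact memLp_proj (hK.memLp_kernelAt hI hJ) G
  · rw [hG]; exact MemLp.zero

variable [IsProbabilityMeasure P]

theorem IsKernel.proj_ae_eq_graphProj (hK : IsKernel P Y φ ξ η ζ h) {I J : Finset ℕ}
    (hI : I.card = p) (hJ : J.card = q) {G : BipGraph} (hG : G ≤ K I J) :
    proj P ξ η ζ (kernelAt h Y I J hI hJ) G =ᵐ[P] graphProj P ξ η ζ h Y G := by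
  have H : ∃ A : {A : Finset ℕ × Finset ℕ // A.1.card = p ∧ A.2.card = q}, G ≤ K A.1.1 A.1.2 :=
    ⟨⟨(I, J), hI, hJ⟩, hG⟩
  rw [graphProj, dif_pos H]
  exact hK.repr.proj_kernelAt_ae_eq hK.meas hK.symm hK.memLp hI hJ _ _ hG H.choose_spec

theorem IsAHKRepresentation.condExp_graphProj_eq_zero (hY : IsAHKRepresentation P Y φ ξ η ζ)
    {E G : BipGraph} (hEG : ¬ G ≤ E) :
    P[graphProj P ξ η ζ h Y G | sigmaH ξ η ζ E] =ᵐ[P] 0 := by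
  rcases graphProj_eq_proj_or_zero (P := P) (ξ := ξ) (η := η) (ζ := ζ) (h := h) (Y := Y) G with
    ⟨I, J, hI, hJ, -, hG⟩ | hG
  · rw [hG]; exact hY.condExp_proj_eq_zero _ hEG
  · rw [hG, condExp_zero]

theorem IsKernel.integral_sq_sum_graphProj (hK : IsKernel P Y φ ξ η ζ h) (A : Finset BipGraph)
    (w : BipGraph → ℝ) :
    ∫ ω, (∑ F ∈ A, w F * graphProj P ξ η ζ h Y F ω) ^ 2 ∂P =
      ∑ F ∈ A, w F ^ 2 * ∫ ω, graphProj P ξ η ζ h Y F ω ^ 2 ∂P := by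
  rw [integral_sq_sum_of_orthogonal A (f := fun F ω => w F * graphProj P ξ η ζ h Y F ω)
    (fun F _ => (hK.memLp_graphProj F).const_mul (w F))]
  · refine Finset.sum_congr rfl fun F _ => ?_
    rw [← integral_const_mul]
    simp_rw [mul_pow]
  · intro F _ G _ hFG
    have h0 : ∫ ω, graphProj P ξ η ζ h Y F ω * graphProj P ξ η ζ h Y G ω ∂P = 0 := by
      rcases graphProj_eq_proj_or_zero (P := P) (ξ := ξ) (η := η) (ζ := ζ) (h := h) (Y := Y) F
        with ⟨I, J, hI, hJ, -, hF'⟩ | hF'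
      · rcases graphProj_eq_proj_or_zero (P := P) (ξ := ξ) (η := η) (ζ := ζ) (h := h) (Y := Y) G
          with ⟨I', J', hI', hJ', -, hG'⟩ | hG'
        · rw [hF', hG']
          exact hK.repr.integral_proj_mul_proj (hK.memLp_kernelAt hI hJ)
            (hK.memLp_kernelAt hI' hJ') hFG
        · simp [hG']
      · simp [hF']
    calc _ = ∫ ω, (w F * w G) *
          (graphProj P ξ η ζ h Y F ω * graphProj P ξ η ζ h Y G ω) ∂P := by
          congr 1; funext ω; ring
      _ = 0 := by rw [integral_const_mul, h0, mul_zero]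

/-- The second moment of `p^G` is an isomorphism invariant. -/
theorem IsKernel.integral_sq_graphProj_eq_of_iso (hK : IsKernel P Y φ ξ η ζ h) {F G : BipGraph}
    (hp : F.v₁ ≤ p) (hq : F.v₂ ≤ q) (hFG : Iso F G) :
    ∫ ω, graphProj P ξ η ζ h Y G ω ^ 2 ∂P = ∫ ω, graphProj P ξ η ζ h Y F ω ^ 2 ∂P := by
  obtain ⟨⟨⟨I, J⟩, hI, hJ⟩, hF⟩ := exists_le_K hp hq
  obtain ⟨⟨⟨I', J'⟩, hI', hJ'⟩, hG⟩ := exists_le_K (G := G) (hFG.v₁_eq ▸ hp) (hFG.v₂_eq ▸ hq)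
  dsimp only at hI hJ hI' hJ' hF hG
  obtain ⟨σ, τ, hσ, hτ, rfl, rfl, rfl⟩ := hFG.exists_map_eq hF hG (hI.trans hI'.symm)
    (hJ.trans hJ'.symm)
  have e1 := hK.proj_ae_eq_graphProj hI hJ hF
  have e2 := hK.proj_ae_eq_graphProj hI' hJ' hG
  calc _ = ∫ ω, proj P ξ η ζ (kernelAt h Y (I.image σ) (J.image τ) hI' hJ') (F.map σ τ) ω ^ 2 ∂P :=
        integral_congr_ae (e2.mono fun ω hω => by simp only [hω])
    _ = ∫ ω, proj P ξ η ζ (kernelAt h Y I J hI hJ) F ω ^ 2 ∂P :=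
        hK.repr.integral_sq_proj_map hK.meas hK.symm hK.memLp hI hJ F hσ hτ hI' hJ'
    _ = _ := integral_congr_ae (e1.mono fun ω hω => by simp only [hω])

theorem IsKernel.graphProj_empty (hK : IsKernel P Y φ ξ η ζ h) :
    graphProj P ξ η ζ h Y BipGraph.empty =ᵐ[P] fun _ => ∫ ω, kernel₀ h Y ω ∂P := by
  refine (hK.proj_ae_eq_graphProj (Finset.card_range p) (Finset.card_range q)
    (BipGraph.empty_le _)).symm.trans (EventuallyEq.of_eq ?_)
  have h1 : BipGraph.empty.properSubgraphs = ∅ := by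
    refine Finset.eq_empty_of_forall_notMem fun F hF => ?_
    exact (mem_properSubgraphs.1 hF).not_ge (BipGraph.empty_le F)
  have h2 : sigmaH ξ η ζ BipGraph.empty = ⊥ := by simp [sigmaH, BipGraph.empty]
  rw [proj_eq, h1, Finset.sum_empty, sub_zero, h2, condExp_bot]
  rfl

theorem IsAHKRepresentation.integral_graphProj_eq_zero (hY : IsAHKRepresentation P Y φ ξ η ζ)
    {G : BipGraph} (hG : G ≠ BipGraph.empty) : ∫ ω, graphProj P ξ η ζ h Y G ω ∂P = 0 := by
  have h1 := hY.condExp_graphProj_eq_zero (h := h) (E := BipGraph.empty) (G := G)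
    fun hle => hG (le_antisymm hle (BipGraph.empty_le G))
  rw [← integral_condExp (hY.sigmaH_le BipGraph.empty), integral_congr_ae h1]
  simp

/-- The kernel at a submatrix is the sum of all its projections. -/
theorem IsKernel.kernelAt_ae_eq_sum (hK : IsKernel P Y φ ξ η ζ h) {I J : Finset ℕ}
    (hI : I.card = p) (hJ : J.card = q) :
    kernelAt h Y I J hI hJ =ᵐ[P] ∑ F ∈ (K I J).subgraphs, graphProj P ξ η ζ h Y F := by
  have h1 : ∑ F ∈ (K I J).subgraphs, graphProj P ξ η ζ h Y F =ᵐ[P]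
      ∑ F ∈ (K I J).subgraphs, proj P ξ η ζ (kernelAt h Y I J hI hJ) F :=
    eventuallyEq_sum fun F hF => (hK.proj_ae_eq_graphProj hI hJ (mem_subgraphs.1 hF)).symm
  rw [sum_subgraphs_proj] at h1
  refine EventuallyEq.trans ?_ h1.symm
  -- Up to null sets, the kernel is a function of the variables of `K I J`.
  have h2 := hK.repr.kernelAt_ae_eq (h := h) hI hJ
  have h3 : StronglyMeasurable[sigmaH ξ η ζ (K I J)]
      (kernelAt h (entry φ) I J hI hJ ∘ point ξ η ζ) := by
    have key : ∀ x ∈ (K I J).support, Measurable[sigmaH ξ η ζ (K I J)] (allVars ξ η ζ x) := by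
      intro x hx
      rw [sigmaH_eq_iSup]
      exact Measurable.mono (comap_measurable _) (le_iSup₂_of_le x hx le_rfl) le_rfl
    exact (measurable_kernelAt hK.meas hK.repr.measurable_phi hI hJ
      (fun i hi => key (Sum.inl i) (inl_mem_support.2 hi))
      (fun j hj => key (Sum.inr (Sum.inl j)) (inr_inl_mem_support.2 hj))
      (fun i hi j hj => key (Sum.inr (Sum.inr (i, j)))
        (inr_inr_mem_support.2 (Finset.mk_mem_product hi hj)))).stronglyMeasurable
  have h4 := condExp_congr_ae (m := sigmaH ξ η ζ (K I J)) h2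
  rw [condExp_of_stronglyMeasurable (hK.repr.sigmaH_le _) h3
    (((hK.memLp_kernelAt hI hJ).integrable (by norm_num)).congr h2)] at h4
  exact h2.trans h4.symm

theorem IsKernel.UStat_ae_eq_sum (hK : IsKernel P Y φ ξ η ζ h) {m n : ℕ} (hm : p ≤ m)
    (hn : q ≤ n) :
    UStat h Y m n =ᵐ[P] fun ω => ∑ F ∈ copies p q m n,
      hoeffdingCoeff p q m n F.v₁ F.v₂ * graphProj P ξ η ζ h Y F ω := by
  classical
  set T := copies p q m n with hT
  have hae : ∀ᵐ ω ∂P, ∀ (I : {I : Finset ℕ // I.card = p}) (J : {J : Finset ℕ // J.card = q}),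
      kernelAt h Y I.1 J.1 I.2 J.2 ω =
        (∑ F ∈ (K I.1 J.1).subgraphs, graphProj P ξ η ζ h Y F) ω :=
    ae_all_iff.2 fun I => ae_all_iff.2 fun J => hK.kernelAt_ae_eq_sum I.2 J.2
  filter_upwards [hae] with ω hω
  set π : BipGraph → ℝ := fun F => graphProj P ξ η ζ h Y F ω with hπ
  have h1 : ∀ I ∈ (Finset.range m).powersetCard p, ∀ J ∈ (Finset.range n).powersetCard q,
      ∑ F ∈ (K I J).subgraphs, π F =
        ∑ F ∈ T, if F.rows ⊆ I ∧ F.cols ⊆ J then π F else 0 := by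
    intro I hI J hJ
    rw [Finset.mem_powersetCard] at hI hJ
    rw [← Finset.sum_filter]
    refine Finset.sum_congr ?_ fun _ _ => rfl
    ext F
    simp only [mem_subgraphs, Finset.mem_filter, hT, copies]
    constructor
    · intro hF
      refine ⟨⟨⟨hF.1.trans hI.1, hF.2.1.trans hJ.1, hF.2.2.trans
        (Finset.product_subset_product hI.1 hJ.1)⟩, ?_, ?_⟩, hF.1, hF.2.1⟩
      · exact (Finset.card_le_card hF.1).trans hI.2.le
      · exact (Finset.card_le_card hF.2.1).trans hJ.2.le
    · rintro ⟨-, h1, h2⟩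
      exact ⟨h1, h2, F.edges_subset.trans (Finset.product_subset_product h1 h2)⟩
  have h2 : UStat h Y m n ω = ((m.choose p : ℝ) * (n.choose q : ℝ))⁻¹ *
      ∑ I ∈ (Finset.range m).powersetCard p, ∑ J ∈ (Finset.range n).powersetCard q,
        ∑ F ∈ (K I J).subgraphs, π F := by
    rw [UStat, ← Finset.sum_attach ((Finset.range m).powersetCard p)]
    congr 1
    refine Finset.sum_congr rfl fun I _ => ?_
    rw [← Finset.sum_attach ((Finset.range n).powersetCard q)]
    refine Finset.sum_congr rfl fun J _ => ?_
    rw [hω ⟨I.1, (Finset.mem_powersetCard.1 I.2).2⟩ ⟨J.1, (Finset.mem_powersetCard.1 J.2).2⟩,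
      Finset.sum_apply]
  rw [h2, Finset.sum_congr rfl fun I hI => Finset.sum_congr rfl fun J hJ => h1 I hI J hJ]
  have h3 : ∑ I ∈ (Finset.range m).powersetCard p, ∑ J ∈ (Finset.range n).powersetCard q,
      ∑ F ∈ T, (if F.rows ⊆ I ∧ F.cols ⊆ J then π F else 0) =
      ∑ F ∈ T, ((((Finset.range m).powersetCard p).filter (F.rows ⊆ ·)).card *
        (((Finset.range n).powersetCard q).filter (F.cols ⊆ ·)).card : ℝ) * π F := by
    rw [Finset.sum_congr rfl fun I _ => Finset.sum_comm, Finset.sum_comm]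
    refine Finset.sum_congr rfl fun F _ => ?_
    rw [Finset.card_filter, Finset.card_filter]
    push_cast
    rw [Finset.sum_mul_sum, Finset.sum_mul]
    refine Finset.sum_congr rfl fun I _ => ?_
    rw [Finset.sum_mul]
    refine Finset.sum_congr rfl fun J _ => ?_
    by_cases a : F.rows ⊆ I <;> by_cases b : F.cols ⊆ J <;> simp [a, b]
  rw [h3, Finset.mul_sum]
  refine Finset.sum_congr rfl fun F hF => ?_
  obtain ⟨hF1, hF2, hF3⟩ := Finset.mem_filter.1 hF
  rw [mem_subgraphs] at hF1
  have hR : F.rows ⊆ Finset.range m := hF1.1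
  have hC : F.cols ⊆ Finset.range n := hF1.2.1
  rw [card_filter_superset hR hF2, card_filter_superset hC hF3, Finset.card_range,
    Finset.card_range]
  have e1 := choose_div_choose_eq hF2 hm
  have e2 := choose_div_choose_eq hF3 hn
  simp only [v₁, v₂] at e1 e2
  rw [hoeffdingCoeff, v₁, v₂, mul_div_mul_comm, ← e1, ← e2, ← mul_assoc]
  congr 1
  rw [mul_inv, div_eq_mul_inv, div_eq_mul_inv]
  ring

theorem hoeffdingCoeff_zero_zero (p q m n : ℕ) : hoeffdingCoeff p q m n 0 0 = 1 := by
  simp [hoeffdingCoeff]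

/-- The Hoeffding decomposition of the centred U-statistic into orthogonal terms, one for each
nonempty copy of a graph. -/
theorem IsKernel.UStat_sub_ae_eq_sum (hK : IsKernel P Y φ ξ η ζ h) {m n : ℕ} (hm : p ≤ m)
    (hn : q ≤ n) :
    (fun ω => UStat h Y m n ω - ∫ ω', kernel₀ h Y ω' ∂P) =ᵐ[P]
      fun ω => ∑ F ∈ (copies p q m n).erase BipGraph.empty,
        hoeffdingCoeff p q m n F.v₁ F.v₂ * graphProj P ξ η ζ h Y F ω := by
  filter_upwards [hK.UStat_ae_eq_sum hm hn, hK.graphProj_empty] with ω h1 h2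
  have hmem : BipGraph.empty ∈ copies p q m n :=
    Finset.mem_filter.2 ⟨mem_subgraphs.2 (BipGraph.empty_le _), Nat.zero_le _, Nat.zero_le _⟩
  rw [h1, ← Finset.add_sum_erase _ _ hmem, h2]
  have : hoeffdingCoeff p q m n BipGraph.empty.v₁ BipGraph.empty.v₂ = 1 :=
    hoeffdingCoeff_zero_zero p q m n
  rw [this]
  ring

theorem IsKernel.variance_UStat (hK : IsKernel P Y φ ξ η ζ h) {m n : ℕ} (hm : p ≤ m)
    (hn : q ≤ n) :
    Var[UStat h Y m n; P] = ∑ F ∈ (copies p q m n).erase BipGraph.empty,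
      hoeffdingCoeff p q m n F.v₁ F.v₂ ^ 2 * ∫ ω, graphProj P ξ η ζ h Y F ω ^ 2 ∂P := by
  set W : Ω → ℝ := fun ω => ∑ F ∈ (copies p q m n).erase BipGraph.empty,
    hoeffdingCoeff p q m n F.v₁ F.v₂ * graphProj P ξ η ζ h Y F ω with hW
  have hU := hK.UStat_sub_ae_eq_sum hm hn
  have hWL : MemLp W 2 P :=
    memLp_finsetSum _ fun F _ => (hK.memLp_graphProj F).const_mul _
  have hUW : UStat h Y m n =ᵐ[P] fun ω => W ω + ∫ ω', kernel₀ h Y ω' ∂P := by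
    filter_upwards [hU] with ω hω
    simp only [hW, ← hω]
    ring
  have h0 : ∫ ω, W ω ∂P = 0 := by
    rw [hW, integral_finsetSum _ fun F _ =>
      ((hK.memLp_graphProj F).integrable (by norm_num)).const_mul _]
    refine Finset.sum_eq_zero fun F hF => ?_
    rw [integral_const_mul, hK.repr.integral_graphProj_eq_zero (Finset.ne_of_mem_erase hF),
      mul_zero]
  rw [variance_congr hUW, variance_add_const hWL.1, variance_of_integral_eq_zero
    hWL.1.aemeasurable h0]
  exact hK.integral_sq_sum_graphProj _ _

theorem IsKernel.V_eq (hK : IsKernel P Y φ ξ η ζ h) {r c : ℕ} (hr : r ≤ p) (hc : c ≤ q) :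
    V P ξ η ζ h Y r c = ((p.descFactorial r : ℝ) * q.descFactorial c) ^ 2 *
      ∑ G ∈ Gam r c, (G.autCard : ℝ)⁻¹ * ∫ ω, graphProj P ξ η ζ h Y G ω ^ 2 ∂P := by
  have key : ∀ {s t : ℕ}, s ≤ t → (t.factorial : ℝ) ^ 2 / ((t - s).factorial : ℝ) ^ 2 =
      (t.descFactorial s : ℝ) ^ 2 := by
    intro s t hst
    have h1 : ((t - s).factorial : ℝ) ≠ 0 := Nat.cast_ne_zero.2 (Nat.factorial_ne_zero _)
    rw [← Nat.factorial_mul_descFactorial hst]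
    push_cast
    field_simp
  rw [V, mul_div_mul_comm, key hr, key hc, ← mul_pow]
  congr 1
  refine Finset.sum_congr rfl fun G hG => ?_
  congr 1
  have hle : G ≤ K (Finset.range p) (Finset.range q) := by
    have h1 : Finset.range r ⊆ Finset.range p := Finset.range_subset_range.2 hr
    have h2 : Finset.range c ⊆ Finset.range q := Finset.range_subset_range.2 hc
    exact (le_K_of_mem_Gam hG).trans ⟨h1, h2, Finset.product_subset_product h1 h2⟩
  exact integral_congr_ae ((hK.proj_ae_eq_graphProj (Finset.card_range p) (Finset.card_range q)
    hle).mono fun ω hω => by simp only [kernel₀, hω])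

/-- The part of the variance of `U_{m,n}` that belongs to the degree `(r, c)`. -/
theorem IsKernel.sum_sq_degree (hK : IsKernel P Y φ ξ η ζ h) {r c : ℕ} (hr : r ≤ p) (hc : c ≤ q)
    {m n : ℕ} (hm : p ≤ m) (hn : q ≤ n) :
    ∑ F ∈ (copies p q m n).filter (fun F => F.v₁ = r ∧ F.v₂ = c),
        hoeffdingCoeff p q m n F.v₁ F.v₂ ^ 2 * ∫ ω, graphProj P ξ η ζ h Y F ω ^ 2 ∂P =
      V P ξ η ζ h Y r c / ((m.descFactorial r : ℝ) * n.descFactorial c) := by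
  have h1 : (copies p q m n).filter (fun F => F.v₁ = r ∧ F.v₂ = c) =
      (K (Finset.range m) (Finset.range n)).subgraphs.filter
        (fun F => F.v₁ = r ∧ F.v₂ = c) := by
    rw [copies, Finset.filter_filter]
    refine Finset.filter_congr fun F _ => ⟨fun h => h.2, fun h => ⟨⟨?_, ?_⟩, h⟩⟩
    · rw [h.1]; exact hr
    · rw [h.2]; exact hc
  have h2 : ∀ F ∈ (K (Finset.range m) (Finset.range n)).subgraphs.filter
        (fun F => F.v₁ = r ∧ F.v₂ = c),
      hoeffdingCoeff p q m n F.v₁ F.v₂ ^ 2 * ∫ ω, graphProj P ξ η ζ h Y F ω ^ 2 ∂P =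
      hoeffdingCoeff p q m n r c ^ 2 * ∫ ω, graphProj P ξ η ζ h Y F ω ^ 2 ∂P := by
    intro F hF
    obtain ⟨-, h1, h2⟩ := Finset.mem_filter.1 hF
    rw [h1, h2]
  rw [h1, Finset.sum_congr rfl h2, ← Finset.mul_sum,
    sum_subgraphs_K_eq_sum_Gam m n r c (fun F => ∫ ω, graphProj P ξ η ζ h Y F ω ^ 2 ∂P)
      fun F G hF1 hF2 hFG =>
        hK.integral_sq_graphProj_eq_of_iso (hF1.le.trans hr) (hF2.le.trans hc) hFG.symm,
    hK.V_eq hr hc, hoeffdingCoeff]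
  have hm0 : (m.descFactorial r : ℝ) ≠ 0 :=
    Nat.cast_ne_zero.2 (Nat.descFactorial_pos.2 (hr.trans hm)).ne'
  have hn0 : (n.descFactorial c : ℝ) ≠ 0 :=
    Nat.cast_ne_zero.2 (Nat.descFactorial_pos.2 (hc.trans hn)).ne'
  field_simp

end Decomposition

/-! ### Products of degenerate projections -/

namespace BipGraph

/-- The union of a finite family of graphs. -/
def iUnion {ι : Type*} (s : Finset ι) (T : ι → BipGraph) : BipGraph :=
  ⟨s.biUnion fun i => (T i).rows, s.biUnion fun i => (T i).cols, s.biUnion fun i => (T i).edges, by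
    intro e he
    obtain ⟨i, hi, he⟩ := Finset.mem_biUnion.1 he
    have := Finset.mem_product.1 ((T i).edges_subset he)
    exact Finset.mem_product.2 ⟨Finset.mem_biUnion.2 ⟨i, hi, this.1⟩,
      Finset.mem_biUnion.2 ⟨i, hi, this.2⟩⟩⟩

theorem mem_support_iUnion {ι : Type*} {s : Finset ι} {T : ι → BipGraph} {x : ℕ ⊕ ℕ ⊕ ℕ × ℕ} :
    x ∈ (iUnion s T).support ↔ ∃ i ∈ s, x ∈ (T i).support := by
  rcases x with i | j | e <;> simp [iUnion]

theorem le_iUnion {ι : Type*} {s : Finset ι} {T : ι → BipGraph} {i : ι} (hi : i ∈ s) :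
    T i ≤ iUnion s T :=
  le_iff_support.2 fun _ hx => mem_support_iUnion.2 ⟨i, hi, hx⟩

/-- The nodes of a graph, rows on the left and columns on the right. -/
def nodes (G : BipGraph) : Finset (ℕ ⊕ ℕ) := G.rows.disjSum G.cols

@[simp] theorem inl_mem_nodes {G : BipGraph} {i : ℕ} : Sum.inl i ∈ G.nodes ↔ i ∈ G.rows := by
  simp [nodes]

@[simp] theorem inr_mem_nodes {G : BipGraph} {j : ℕ} : Sum.inr j ∈ G.nodes ↔ j ∈ G.cols := by
  simp [nodes]

theorem card_nodes (G : BipGraph) : G.nodes.card = G.v₁ + G.v₂ := Finset.card_disjSum _ _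

theorem disjoint_support_of_disjoint_nodes {F G : BipGraph} (h : Disjoint F.nodes G.nodes) :
    Disjoint F.support G.support := by
  rw [Finset.disjoint_left] at h ⊢
  rintro (i | j | e) hF hG
  · exact h (inl_mem_nodes.2 (inl_mem_support.1 hF)) (inl_mem_nodes.2 (inl_mem_support.1 hG))
  · exact h (inr_mem_nodes.2 (inr_inl_mem_support.1 hF))
      (inr_mem_nodes.2 (inr_inl_mem_support.1 hG))
  · have h1 := Finset.mem_product.1 (F.edges_subset (inr_inr_mem_support.1 hF))
    have h2 := Finset.mem_product.1 (G.edges_subset (inr_inr_mem_support.1 hG))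
    exact h (inl_mem_nodes.2 h1.1) (inl_mem_nodes.2 h2.1)

theorem Connected.nodes_nonempty {G : BipGraph} (hG : G.Connected) : G.nodes.Nonempty := by
  obtain ⟨x⟩ := SimpleGraph.Connected.nonempty hG
  rcases x with i | j
  · exact ⟨Sum.inl i, inl_mem_nodes.2 i.2⟩
  · exact ⟨Sum.inr j, inr_mem_nodes.2 j.2⟩

/-- A set of nodes that contains one node of a connected graph, and with one end of an edge also the
other end, contains all nodes. -/
theorem Connected.forall_nodes {G : BipGraph} (hG : G.Connected) {p : ℕ ⊕ ℕ → Prop}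
    {v₀ : ℕ ⊕ ℕ} (hv₀ : v₀ ∈ G.nodes) (hp : p v₀)
    (hedge : ∀ i j, (i, j) ∈ G.edges → (p (Sum.inl i) ↔ p (Sum.inr j))) :
    ∀ v ∈ G.nodes, p v := by
  have hG' : G.toSimpleGraph.Connected := hG
  let c : G.rows ⊕ G.cols → ℕ ⊕ ℕ := Sum.map (fun i => (i : ℕ)) (fun j => (j : ℕ))
  have hc : ∀ v ∈ G.nodes, ∃ x, c x = v := by
    rintro (i | j) hv
    · exact ⟨Sum.inl ⟨i, inl_mem_nodes.1 hv⟩, rfl⟩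
    · exact ⟨Sum.inr ⟨j, inr_mem_nodes.1 hv⟩, rfl⟩
  have hadj : ∀ x y, G.toSimpleGraph.Adj x y → (p (c x) ↔ p (c y)) := by
    intro x y hxy
    rw [toSimpleGraph, SimpleGraph.fromRel_adj] at hxy
    rcases hxy.2 with ⟨i, j, rfl, rfl, he⟩ | ⟨i, j, rfl, rfl, he⟩
    · exact hedge i j he
    · exact (hedge i j he).symm
  have hwalk : ∀ x y, G.toSimpleGraph.Walk x y → (p (c x) ↔ p (c y)) := by
    intro x y w
    induction w with
    | nil => exact Iff.rfl
    | cons hxy _ ih => exact (hadj _ _ hxy).trans ih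
  intro v hv
  obtain ⟨x₀, rfl⟩ := hc v₀ hv₀
  obtain ⟨x, rfl⟩ := hc v hv
  obtain ⟨w⟩ := hG'.preconnected x₀ x
  exact (hwalk x₀ x w).1 hp

/-- In a family of graphs in which no node is shared by three members and every node and edge of a
member is shared with another one, a connected member that meets another one is contained in it. -/
theorem Connected.le_of_common_node {ι : Type*} {T : ι → BipGraph}
    (h₂ : ∀ i, ∀ x ∈ (T i).support, ∃ j, j ≠ i ∧ x ∈ (T j).support)
    (h₃ : ∀ i j l, i ≠ j → i ≠ l → j ≠ l → ∀ v, v ∈ (T i).nodes → v ∈ (T j).nodes →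
      v ∉ (T l).nodes)
    {i j : ι} (hij : i ≠ j) (hi : (T i).Connected) {v₀ : ℕ ⊕ ℕ} (hv : v₀ ∈ (T i).nodes)
    (hv' : v₀ ∈ (T j).nodes) : T i ≤ T j := by
  -- An edge of `T i` with an end in `T j` is an edge of `T j`.
  have hl : ∀ a b, (a, b) ∈ (T i).edges →
      (Sum.inl a ∈ (T j).nodes ∨ Sum.inr b ∈ (T j).nodes) → (a, b) ∈ (T j).edges := by
    intro a b hab hor
    obtain ⟨l, hli, hl⟩ := h₂ i (Sum.inr (Sum.inr (a, b))) (inr_inr_mem_support.2 hab)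
    rw [inr_inr_mem_support] at hl
    have m1 := Finset.mem_product.1 ((T i).edges_subset hab)
    have m2 := Finset.mem_product.1 ((T l).edges_subset hl)
    by_cases hlj : l = j
    · rwa [← hlj]
    · exfalso
      rcases hor with hor | hor
      · exact h₃ i j l hij (Ne.symm hli) (Ne.symm hlj) (Sum.inl a) (inl_mem_nodes.2 m1.1) hor
          (inl_mem_nodes.2 m2.1)
      · exact h₃ i j l hij (Ne.symm hli) (Ne.symm hlj) (Sum.inr b) (inr_mem_nodes.2 m1.2) hor
          (inr_mem_nodes.2 m2.2)
  have hnodes : ∀ v ∈ (T i).nodes, v ∈ (T j).nodes := by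
    refine hi.forall_nodes (p := fun v => v ∈ (T j).nodes) hv hv' fun a b hab => ?_
    constructor
    · intro h
      exact inr_mem_nodes.2 (Finset.mem_product.1 ((T j).edges_subset (hl a b hab (Or.inl h)))).2
    · intro h
      exact inl_mem_nodes.2 (Finset.mem_product.1 ((T j).edges_subset (hl a b hab (Or.inr h)))).1
  refine ⟨fun a ha => inl_mem_nodes.1 (hnodes _ (inl_mem_nodes.2 ha)),
    fun b hb => inr_mem_nodes.1 (hnodes _ (inr_mem_nodes.2 hb)), ?_⟩
  rintro ⟨a, b⟩ hab
  exact hl a b hab (Or.inl (hnodes _ (inl_mem_nodes.2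
    (Finset.mem_product.1 ((T i).edges_subset hab)).1)))

end BipGraph

/-- A family of random variables indexed by graphs, each a function of the variables of its graph,
and with vanishing conditional expectation unless all of them are given. -/
structure IsDegenerateFamily {Ω : Type*} [MeasurableSpace Ω] (P : Measure Ω)
    (ξ η : ℕ → Ω → ℝ) (ζ : ℕ → ℕ → Ω → ℝ) (X : BipGraph → Ω → ℝ) : Prop where
  stronglyMeasurable : ∀ G, StronglyMeasurable[sigmaH ξ η ζ G] (X G)
  condExp_eq_zero : ∀ E G, ¬ G ≤ E → P[X G | sigmaH ξ η ζ E] =ᵐ[P] 0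

section Products

variable {Ω : Type*} [mΩ : MeasurableSpace Ω] {P : Measure Ω} [IsProbabilityMeasure P]
  {Y : ℕ → ℕ → Ω → ℝ} {φ : ℝ → ℝ → ℝ → ℝ} {ξ η : ℕ → Ω → ℝ} {ζ : ℕ → ℕ → Ω → ℝ}
  {X : BipGraph → Ω → ℝ} {ι : Type*} {B : ℝ}

omit mΩ in
theorem stronglyMeasurable_prod_sigmaH
    (hX : ∀ G, StronglyMeasurable[sigmaH ξ η ζ G] (X G)) (s : Finset ι) (T : ι → BipGraph) :
    StronglyMeasurable[sigmaH ξ η ζ (iUnion s T)] fun ω => ∏ i ∈ s, X (T i) ω :=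
  Finset.stronglyMeasurable_fun_prod _ fun i hi =>
    (hX (T i)).mono (sigmaH_mono (le_iUnion hi))

omit [IsProbabilityMeasure P] in
theorem ae_abs_prod_le (s : Finset ι) {T : ι → BipGraph}
    (hB : ∀ i ∈ s, ∀ᵐ ω ∂P, |X (T i) ω| ≤ B) :
    ∀ᵐ ω ∂P, |∏ i ∈ s, X (T i) ω| ≤ B ^ s.card := by
  have h : ∀ᵐ ω ∂P, ∀ i ∈ s, |X (T i) ω| ≤ B := (Finset.eventually_all s).2 hB
  filter_upwards [h] with ω hω
  rw [Finset.abs_prod, ← Finset.prod_const]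
  exact Finset.prod_le_prod (fun i _ => abs_nonneg _) hω

theorem integrable_prod (hY : IsAHKRepresentation P Y φ ξ η ζ)
    (hX : IsDegenerateFamily P ξ η ζ X) (s : Finset ι) {T : ι → BipGraph}
    (hB : ∀ i ∈ s, ∀ᵐ ω ∂P, |X (T i) ω| ≤ B) :
    Integrable (fun ω => ∏ i ∈ s, X (T i) ω) P :=
  Integrable.of_bound ((stronglyMeasurable_prod_sigmaH hX.stronglyMeasurable s T).mono
    (hY.sigmaH_le _)).aestronglyMeasurable (B ^ s.card) (ae_abs_prod_le s hB)

theorem abs_integral_prod_le [Fintype ι] {T : ι → BipGraph}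
    (hB : ∀ i, ∀ᵐ ω ∂P, |X (T i) ω| ≤ B) :
    |∫ ω, ∏ i, X (T i) ω ∂P| ≤ B ^ Fintype.card ι := by
  have h := ae_abs_prod_le (P := P) (X := X) Finset.univ fun i _ => hB i
  have := norm_integral_le_of_norm_le_const (f := fun ω => ∏ i, X (T i) ω) h
  simpa using this

/-- A product in which some variable enters through one factor only has mean zero. -/
theorem integral_prod_eq_zero [Fintype ι] (hY : IsAHKRepresentation P Y φ ξ η ζ)
    (hX : IsDegenerateFamily P ξ η ζ X) {T : ι → BipGraph}
    (hB : ∀ i, ∀ᵐ ω ∂P, |X (T i) ω| ≤ B) {i₀ : ι} {x : ℕ ⊕ ℕ ⊕ ℕ × ℕ}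
    (hx : x ∈ (T i₀).support) (hx' : ∀ j, j ≠ i₀ → x ∉ (T j).support) :
    ∫ ω, ∏ i, X (T i) ω ∂P = 0 := by
  classical
  set E := iUnion (Finset.univ.erase i₀) T with hE
  have hle : ¬ T i₀ ≤ E := fun h => by
    obtain ⟨j, hj, hxj⟩ := mem_support_iUnion.1 (le_iff_support.1 h hx)
    exact hx' j (Finset.ne_of_mem_erase hj) hxj
  have hsplit : ∀ ω, ∏ i, X (T i) ω = X (T i₀) ω * ∏ i ∈ Finset.univ.erase i₀, X (T i) ω :=
    fun ω => (Finset.mul_prod_erase _ _ (Finset.mem_univ i₀)).symm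
  have hint := integrable_prod hY hX Finset.univ (T := T) fun i _ => hB i
  simp_rw [hsplit] at hint ⊢
  refine hY.integral_mul_eq_zero (hX.condExp_eq_zero E _ hle) ?_
    (stronglyMeasurable_prod_sigmaH hX.stronglyMeasurable _ T) hint
  exact Integrable.of_bound ((hX.stronglyMeasurable _).mono
    (hY.sigmaH_le _)).aestronglyMeasurable B (hB i₀)

omit [IsProbabilityMeasure P] in
/-- A factor without common variables splits off. -/
theorem integral_sq_mul_prod [Fintype ι] (hY : IsAHKRepresentation P Y φ ξ η ζ)
    (hX : IsDegenerateFamily P ξ η ζ X) {G : BipGraph} {T : ι → BipGraph}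
    (hdisj : ∀ i, Disjoint G.support (T i).support) :
    ∫ ω, X G ω ^ 2 * ∏ i, X (T i) ω ∂P =
      (∫ ω, X G ω ^ 2 ∂P) * ∫ ω, ∏ i, X (T i) ω ∂P := by
  have h1 : StronglyMeasurable[sigmaH ξ η ζ G] fun ω => X G ω ^ 2 :=
    (hX.stronglyMeasurable G).pow 2
  have h2 := stronglyMeasurable_prod_sigmaH hX.stronglyMeasurable Finset.univ T
  have hd : Disjoint (G.support : Set (ℕ ⊕ ℕ ⊕ ℕ × ℕ)) (iUnion Finset.univ T).support := by
    rw [Finset.disjoint_coe, Finset.disjoint_left]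
    intro x hx hx'
    obtain ⟨i, -, hi⟩ := mem_support_iUnion.1 hx'
    exact Finset.disjoint_left.1 (hdisj i) hx hi
  have hind : Indep (sigmaH ξ η ζ G) (sigmaH ξ η ζ (iUnion Finset.univ T)) P := by
    rw [sigmaH_eq_iSup, sigmaH_eq_iSup]
    exact indep_iSup_of_disjoint (fun x => (hY.measurable_allVars x).comap_le) hY.indep hd
  have hif : IndepFun (fun ω => X G ω ^ 2) (fun ω => ∏ i, X (T i) ω) P := by
    rw [IndepFun_iff_Indep]
    exact indep_of_indep_of_le_left (indep_of_indep_of_le_right hind h2.measurable.comap_le)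
      h1.measurable.comap_le
  exact hif.integral_fun_mul_eq_mul_integral (h1.mono (hY.sigmaH_le _)).aestronglyMeasurable
    (h2.mono (hY.sigmaH_le _)).aestronglyMeasurable

/-! ### The recursion for the moments -/

/-- The mean of a product over `k + 2` graphs, minus its value by the pairings of the first graph
with an equal one. -/
def pairingDefect (P : Measure Ω) (X : BipGraph → Ω → ℝ) {k : ℕ} (T : Fin (k + 2) → BipGraph) : ℝ :=
  ∫ ω, ∏ i, X (T i) ω ∂P - ∑ j : Fin (k + 1), if T j.succ = T 0 then
    (∫ ω, X (T 0) ω ^ 2 ∂P) * ∫ ω, ∏ i : Fin k, X (T (j.succAbove i).succ) ω ∂P else 0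

theorem abs_pairingDefect_le {k : ℕ} {T : Fin (k + 2) → BipGraph}
    (hB : ∀ i, ∀ᵐ ω ∂P, |X (T i) ω| ≤ B) :
    |pairingDefect P X T| ≤ (k + 2) * B ^ (k + 2) := by
  have hB0 : 0 ≤ B := by
    obtain ⟨ω, hω⟩ := (hB 0).exists
    exact (abs_nonneg _).trans hω
  have h1 := abs_integral_prod_le hB
  rw [Fintype.card_fin] at h1
  have h2 : ∀ j : Fin (k + 1), |if T j.succ = T 0 then
      (∫ ω, X (T 0) ω ^ 2 ∂P) * ∫ ω, ∏ i : Fin k, X (T (j.succAbove i).succ) ω ∂P else 0| ≤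
      B ^ (k + 2) := by
    intro j
    split_ifs
    · rw [abs_mul, pow_add, mul_comm]
      have e1 := abs_integral_prod_le (P := P) (X := X) (B := B)
        (T := fun i : Fin k => T (j.succAbove i).succ) fun i => hB _
      have e2 := abs_integral_prod_le (P := P) (X := X) (B := B)
        (T := fun _ : Fin 2 => T 0) fun i => hB _
      simp only [Finset.prod_const, Finset.card_univ, Fintype.card_fin] at e1 e2
      exact mul_le_mul e1 e2 (abs_nonneg _) (by positivity)
    · simpa using pow_nonneg hB0 _
  calc |pairingDefect P X T| ≤ B ^ (k + 2) + ∑ _j : Fin (k + 1), B ^ (k + 2) :=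
        (abs_sub _ _).trans (add_le_add h1 ((Finset.abs_sum_le_sum_abs _ _).trans
          (Finset.sum_le_sum fun j _ => h2 j)))
    _ = (k + 2) * B ^ (k + 2) := by
        rw [Finset.sum_const, Finset.card_univ, Fintype.card_fin, nsmul_eq_mul]
        push_cast
        ring

/-- Only tuples that cover every node at least twice and some node three times contribute to the
defect. -/
theorem cover_of_pairingDefect_ne_zero (hY : IsAHKRepresentation P Y φ ξ η ζ)
    (hX : IsDegenerateFamily P ξ η ζ X) {k : ℕ} {T : Fin (k + 2) → BipGraph}
    (hB : ∀ i, ∀ᵐ ω ∂P, |X (T i) ω| ≤ B) (hconn : ∀ i, (T i).Connected)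
    (hT : pairingDefect P X T ≠ 0) :
    (∀ i, ∀ v ∈ (T i).nodes, ∃ j, j ≠ i ∧ v ∈ (T j).nodes) ∧
      ∃ v i j l, i ≠ j ∧ i ≠ l ∧ j ≠ l ∧ v ∈ (T i).nodes ∧ v ∈ (T j).nodes ∧
        v ∈ (T l).nodes := by
  have h₂ : ∀ i, ∀ x ∈ (T i).support, ∃ j, j ≠ i ∧ x ∈ (T j).support := by
    by_contra hcon
    push Not at hcon
    obtain ⟨i₀, x, hx, hx'⟩ := hcon
    refine hT ?_
    rw [pairingDefect, integral_prod_eq_zero hY hX hB hx hx', zero_sub, neg_eq_zero]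
    refine Finset.sum_eq_zero fun j _ => ?_
    split_ifs with hj
    · have h0 : i₀ ≠ 0 := by
        rintro rfl
        exact hx' j.succ (Fin.succ_ne_zero j) (hj ▸ hx)
      have hj' : i₀ ≠ j.succ := by
        rintro rfl
        exact hx' 0 (Fin.succ_ne_zero j).symm (hj ▸ hx)
      obtain ⟨i₁, rfl⟩ := Fin.exists_succ_eq.2 h0
      obtain ⟨i₂, rfl⟩ := Fin.exists_succAbove_eq fun h : i₁ = j => hj' (by rw [h])
      rw [integral_prod_eq_zero hY hX (T := fun i => T (j.succAbove i).succ) (fun i => hB _)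
        (i₀ := i₂) hx fun l hl => hx' _ fun h =>
          hl (Fin.succAbove_right_injective (Fin.succ_injective _ h)), mul_zero]
    · rfl
  refine ⟨?_, ?_⟩
  · rintro i (a | b) hv
    · obtain ⟨j, hj, hx⟩ := h₂ i (Sum.inl a) (inl_mem_support.2 (inl_mem_nodes.1 hv))
      exact ⟨j, hj, inl_mem_nodes.2 (inl_mem_support.1 hx)⟩
    · obtain ⟨j, hj, hx⟩ := h₂ i (Sum.inr (Sum.inl b))
        (inr_inl_mem_support.2 (inr_mem_nodes.1 hv))
      exact ⟨j, hj, inr_mem_nodes.2 (inr_inl_mem_support.1 hx)⟩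
  · by_contra hcon
    have h₃ : ∀ i j l, i ≠ j → i ≠ l → j ≠ l → ∀ v, v ∈ (T i).nodes → v ∈ (T j).nodes →
        v ∉ (T l).nodes := fun i j l hij hil hjl v hi hj hl =>
      hcon ⟨v, i, j, l, hij, hil, hjl, hi, hj, hl⟩
    refine hT ?_
    -- The first graph meets exactly one other member of the tuple, and that one is equal to it.
    obtain ⟨v₀, hv₀⟩ := (hconn 0).nodes_nonempty
    obtain ⟨j₁, hj₁, hv₁⟩ : ∃ j, j ≠ 0 ∧ v₀ ∈ (T j).nodes := by
      rcases v₀ with a | b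
      · obtain ⟨j, hj, hx⟩ := h₂ 0 (Sum.inl a) (inl_mem_support.2 (inl_mem_nodes.1 hv₀))
        exact ⟨j, hj, inl_mem_nodes.2 (inl_mem_support.1 hx)⟩
      · obtain ⟨j, hj, hx⟩ := h₂ 0 (Sum.inr (Sum.inl b))
          (inr_inl_mem_support.2 (inr_mem_nodes.1 hv₀))
        exact ⟨j, hj, inr_mem_nodes.2 (inr_inl_mem_support.1 hx)⟩
    obtain ⟨j₀, rfl⟩ := Fin.exists_succ_eq.2 hj₁
    have heq : T j₀.succ = T 0 := le_antisymm
      ((hconn j₀.succ).le_of_common_node h₂ h₃ hj₁ hv₁ hv₀)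
      ((hconn 0).le_of_common_node h₂ h₃ hj₁.symm hv₀ hv₁)
    have hdisj : ∀ l, l ≠ 0 → l ≠ j₀.succ → Disjoint (T 0).nodes (T l).nodes := by
      intro l hl0 hlj
      rw [Finset.disjoint_left]
      intro v hv hvl
      exact h₃ 0 j₀.succ l hj₁.symm hl0.symm hlj.symm v hv (heq ▸ hv) hvl
    rw [pairingDefect, Finset.sum_eq_single j₀, if_pos heq, sub_eq_zero]
    · rw [← integral_sq_mul_prod hY hX fun i => disjoint_support_of_disjoint_nodes
        (hdisj _ (Fin.succ_ne_zero _) fun h => Fin.succAbove_ne j₀ i (Fin.succ_injective _ h))]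
      refine integral_congr_ae (Eventually.of_forall fun ω => ?_)
      simp only
      rw [Fin.prod_univ_succ, Fin.prod_univ_succAbove _ j₀, heq]
      ring
    · intro j _ hj
      refine if_neg fun h => ?_
      have hd := hdisj j.succ (Fin.succ_ne_zero j) fun h' => hj (Fin.succ_injective _ h')
      rw [h] at hd
      exact Finset.disjoint_left.1 hd hv₀ hv₀
    · exact fun h => (h (Finset.mem_univ _)).elim

theorem integral_sum_pow {α : Type*} [Fintype α] (hY : IsAHKRepresentation P Y φ ξ η ζ)
    (hX : IsDegenerateFamily P ξ η ζ X) {G : α → BipGraph}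
    (hB : ∀ a, ∀ᵐ ω ∂P, |X (G a) ω| ≤ B) (w : α → ℝ) (k : ℕ) :
    ∫ ω, (∑ a, w a * X (G a) ω) ^ k ∂P =
      ∑ T : Fin k → α, (∏ i, w (T i)) * ∫ ω, ∏ i, X (G (T i)) ω ∂P := by
  simp_rw [Fintype.sum_pow, Finset.prod_mul_distrib]
  rw [integral_finsetSum]
  · simp_rw [integral_const_mul]
  · intro T _
    exact (integrable_prod hY hX Finset.univ (T := fun i => G (T i)) fun i _ => hB _).const_mul _

/-- The moments of a weighted sum satisfy the recursion of the Gaussian moments up to the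
contribution of the defects. -/
theorem sum_pairingDefect {α : Type*} [Fintype α] (hY : IsAHKRepresentation P Y φ ξ η ζ)
    (hX : IsDegenerateFamily P ξ η ζ X) {G : α → BipGraph} (hG : G.Injective)
    (hB : ∀ a, ∀ᵐ ω ∂P, |X (G a) ω| ≤ B) (w : α → ℝ) (k : ℕ) :
    ∑ T : Fin (k + 2) → α, (∏ i, w (T i)) * pairingDefect P X (fun i => G (T i)) =
      ∫ ω, (∑ a, w a * X (G a) ω) ^ (k + 2) ∂P -
        (k + 1) * (∑ a, w a ^ 2 * ∫ ω, X (G a) ω ^ 2 ∂P) *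
          ∫ ω, (∑ a, w a * X (G a) ω) ^ k ∂P := by
  classical
  have hj : ∀ j : Fin (k + 1), ∑ T : Fin (k + 2) → α, (∏ i, w (T i)) *
      (if G (T j.succ) = G (T 0) then (∫ ω, X (G (T 0)) ω ^ 2 ∂P) *
        ∫ ω, ∏ i : Fin k, X (G (T (j.succAbove i).succ)) ω ∂P else 0) =
      (∑ a, w a ^ 2 * ∫ ω, X (G a) ω ^ 2 ∂P) * ∫ ω, (∑ a, w a * X (G a) ω) ^ k ∂P := by
    intro j
    rw [integral_sum_pow hY hX hB, Finset.sum_mul_sum,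
      ← (Fin.consEquiv fun _ => α).sum_comp, Fintype.sum_prod_type]
    refine Finset.sum_congr rfl fun a _ => ?_
    rw [← (Fin.insertNthEquiv (fun _ => α) j).sum_comp, Fintype.sum_prod_type,
      Finset.sum_eq_single a]
    · refine Finset.sum_congr rfl fun T _ => ?_
      simp only [Fin.consEquiv, Fin.insertNthEquiv, Equiv.coe_fn_mk, Fin.cons_succ, Fin.cons_zero,
        Fin.insertNth_apply_same, Fin.insertNth_apply_succAbove, if_true]
      rw [Fin.prod_univ_succ, Fin.prod_univ_succAbove _ j]
      simp only [Fin.cons_succ, Fin.cons_zero, Fin.insertNth_apply_same,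
        Fin.insertNth_apply_succAbove]
      ring
    · intro b _ hb
      refine Finset.sum_eq_zero fun T _ => ?_
      simp only [Fin.consEquiv, Fin.insertNthEquiv, Equiv.coe_fn_mk, Fin.cons_succ, Fin.cons_zero,
        Fin.insertNth_apply_same]
      rw [if_neg fun h => hb (hG h), mul_zero]
    · exact fun h => (h (Finset.mem_univ _)).elim
  simp only [pairingDefect, mul_sub, Finset.sum_sub_distrib]
  rw [← integral_sum_pow hY hX hB w (k + 2)]
  congr 1
  simp only [Finset.mul_sum]
  rw [Finset.sum_comm]
  simp only [← Finset.mul_sum]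
  rw [Finset.sum_congr rfl fun j _ => hj j, Finset.sum_const, Finset.card_univ, Fintype.card_fin,
    nsmul_eq_mul]
  push_cast
  ring

end Products

/-! ### Counting tuples of graphs that cover a node three times -/

section Counting

variable {α ι : Type*} [Fintype α] [Fintype ι] {G : α → BipGraph} {t : ℕ ⊕ ℕ → ℝ}

theorem card_filter_nodes_subset_le (hG : G.Injective) (U : Finset (ℕ ⊕ ℕ)) {M : ℕ}
    (hU : U.card ≤ M) :
    (Finset.univ.filter fun a => (G a).nodes ⊆ U).card ≤ 2 ^ (M + M * M) := by
  classical
  have hle : ∀ a, (G a).nodes ⊆ U → G a ≤ K U.toLeft U.toRight := by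
    intro a ha
    have h1 : (G a).rows ⊆ U.toLeft := fun i hi =>
      Finset.mem_toLeft.2 (ha (inl_mem_nodes.2 hi))
    have h2 : (G a).cols ⊆ U.toRight := fun j hj =>
      Finset.mem_toRight.2 (ha (inr_mem_nodes.2 hj))
    exact ⟨h1, h2, (G a).edges_subset.trans (Finset.product_subset_product h1 h2)⟩
  have h1 : (Finset.univ.filter fun a => (G a).nodes ⊆ U).card ≤
      (K U.toLeft U.toRight).subgraphs.card :=
    Finset.card_le_card_of_injOn G
      (fun a ha => by simpa using hle a (by simpa using ha)) hG.injOn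
  refine h1.trans ((card_subgraphs_le _).trans (Nat.pow_le_pow_right (by norm_num) ?_))
  have h2 := Finset.card_toLeft_add_card_toRight (u := U)
  simp only [size, K, Finset.card_product]
  exact add_le_add (h2.le.trans hU) (Nat.mul_le_mul (by omega) (by omega))

/-- The sum of `∏_{v ∈ U} t v ^ 2` over all sets `U` of nodes, with multiplicities, is bounded if
`∑ t v ^ 2` is. -/
theorem sum_prod_sq_le {β : Type*} [Fintype β] {Vtx : Finset (ℕ ⊕ ℕ)}
    (ht : ∑ v ∈ Vtx, t v ^ 2 ≤ 2) (U : β → Finset (ℕ ⊕ ℕ)) (hU : ∀ b, U b ⊆ Vtx) {C : ℕ}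
    (hC : ∀ A, (Finset.univ.filter fun b => U b = A).card ≤ C) :
    ∑ b, ∏ v ∈ U b, t v ^ 2 ≤ C * Real.exp 2 := by
  classical
  rw [← Finset.sum_fiberwise_of_maps_to (s := Finset.univ) (t := Vtx.powerset) (g := U)
    fun b _ => Finset.mem_powerset.2 (hU b)]
  have h1 : ∀ A ∈ Vtx.powerset, ∑ b ∈ Finset.univ.filter (fun b => U b = A), ∏ v ∈ U b, t v ^ 2 ≤
      C * ∏ v ∈ A, t v ^ 2 := by
    intro A _
    have : ∀ b ∈ Finset.univ.filter (fun b => U b = A), ∏ v ∈ U b, t v ^ 2 =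
        ∏ v ∈ A, t v ^ 2 := fun b hb => by rw [(Finset.mem_filter.1 hb).2]
    rw [Finset.sum_congr rfl this, Finset.sum_const, nsmul_eq_mul]
    exact mul_le_mul_of_nonneg_right (by exact_mod_cast hC A)
      (Finset.prod_nonneg fun v _ => sq_nonneg _)
  refine (Finset.sum_le_sum h1).trans ?_
  rw [← Finset.mul_sum, ← Finset.prod_one_add]
  refine mul_le_mul_of_nonneg_left ?_ (Nat.cast_nonneg _)
  calc ∏ v ∈ Vtx, (1 + t v ^ 2) ≤ ∏ v ∈ Vtx, Real.exp (t v ^ 2) :=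
        Finset.prod_le_prod (fun v _ => by positivity) fun v _ => by
          rw [add_comm]; exact Real.add_one_le_exp _
    _ = Real.exp (∑ v ∈ Vtx, t v ^ 2) := (Real.exp_sum _ _).symm
    _ ≤ Real.exp 2 := Real.exp_le_exp.2 ht

theorem sum_prod_sq_nodes_le (hG : G.Injective) {Vtx : Finset (ℕ ⊕ ℕ)}
    (ht : ∑ v ∈ Vtx, t v ^ 2 ≤ 2) (hV : ∀ a, (G a).nodes ⊆ Vtx) {D : ℕ}
    (hD : ∀ a, (G a).nodes.card ≤ D) :
    ∑ a, ∏ v ∈ (G a).nodes, t v ^ 2 ≤ (2 ^ (D + D * D) : ℕ) * Real.exp 2 := by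
  classical
  refine sum_prod_sq_le ht (fun a => (G a).nodes) hV fun A => ?_
  by_cases hA : A.card ≤ D
  · refine le_trans (Finset.card_le_card ?_) (card_filter_nodes_subset_le hG A hA)
    exact Finset.monotone_filter_right _ fun a _ h => h.le
  · rw [Finset.card_eq_zero.2]
    · exact Nat.zero_le _
    · exact Finset.filter_eq_empty_iff.2 fun a _ h => hA (h ▸ hD a)

theorem sum_prod_sq_nodes_tuple_le (hG : G.Injective) {Vtx : Finset (ℕ ⊕ ℕ)}
    (ht : ∑ v ∈ Vtx, t v ^ 2 ≤ 2) (hV : ∀ a, (G a).nodes ⊆ Vtx) {D M : ℕ}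
    (hD : ∀ a, (G a).nodes.card ≤ D) (hM : Fintype.card ι * D ≤ M) [DecidableEq ι] :
    ∑ T : ι → α, ∏ v ∈ Finset.univ.biUnion (fun i => (G (T i)).nodes), t v ^ 2 ≤
      ((2 ^ (M + M * M)) ^ Fintype.card ι : ℕ) * Real.exp 2 := by
  classical
  refine sum_prod_sq_le ht (fun T : ι → α => Finset.univ.biUnion fun i => (G (T i)).nodes)
    (fun T => Finset.biUnion_subset.2 fun i _ => hV _) fun A => ?_
  by_cases hA : A.card ≤ M
  · calc _ ≤ (Fintype.piFinset fun _ : ι =>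
          Finset.univ.filter fun a => (G a).nodes ⊆ A).card := by
          refine Finset.card_le_card fun T hT => Fintype.mem_piFinset.2 fun i => ?_
          have hT' := (Finset.mem_filter.1 hT).2
          refine Finset.mem_filter.2 ⟨Finset.mem_univ _, ?_⟩
          rw [← hT']
          exact Finset.subset_biUnion_of_mem (fun i => (G (T i)).nodes) (Finset.mem_univ i)
      _ ≤ _ := by
          rw [Fintype.card_piFinset, Finset.prod_const, Finset.card_univ]
          exact Nat.pow_le_pow_left (card_filter_nodes_subset_le hG A hA) _
  · rw [Finset.card_eq_zero.2]
    · exact Nat.zero_le _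
    · refine Finset.filter_eq_empty_iff.2 fun T _ h => hA ?_
      rw [← h]
      refine Finset.card_biUnion_le.trans (le_trans ?_ hM)
      calc ∑ i, (G (T i)).nodes.card ≤ ∑ _i : ι, D := Finset.sum_le_sum fun i _ => hD _
        _ = _ := by rw [Finset.sum_const, Finset.card_univ, smul_eq_mul]

/-- If every node is covered twice and some node three times, a factor `ε` is gained over the weight
of a pairing. -/
theorem prod_prod_nodes_le {T : ι → BipGraph} {ε : ℝ} (ht0 : ∀ v, 0 ≤ t v) (htε : ∀ v, t v ≤ ε)
    (hε : ε ≤ 1) (h₂ : ∀ i, ∀ v ∈ (T i).nodes, ∃ j, j ≠ i ∧ v ∈ (T j).nodes)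
    (h₃ : ∃ v i j l, i ≠ j ∧ i ≠ l ∧ j ≠ l ∧ v ∈ (T i).nodes ∧ v ∈ (T j).nodes ∧
      v ∈ (T l).nodes) :
    ∏ i, ∏ v ∈ (T i).nodes, t v ≤
      ε * ∏ v ∈ Finset.univ.biUnion (fun i => (T i).nodes), t v ^ 2 := by
  classical
  set U := Finset.univ.biUnion fun i => (T i).nodes with hU
  have ht1 : ∀ v, t v ≤ 1 := fun v => (htε v).trans hε
  have h1 : ∏ i, ∏ v ∈ (T i).nodes, t v =
      ∏ v ∈ U, t v ^ (Finset.univ.filter fun i => v ∈ (T i).nodes).card := by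
    have : ∀ i, ∏ v ∈ (T i).nodes, t v = ∏ v ∈ U, if v ∈ (T i).nodes then t v else 1 := by
      intro i
      rw [Finset.prod_ite_mem, Finset.inter_eq_right.2
        (Finset.subset_biUnion_of_mem (fun i => (T i).nodes) (Finset.mem_univ i))]
    simp_rw [this]
    rw [Finset.prod_comm]
    refine Finset.prod_congr rfl fun v _ => ?_
    rw [Finset.prod_ite, Finset.prod_const_one, mul_one, Finset.prod_const]
  obtain ⟨v₀, i, j, l, hij, hil, hjl, hi, hj, hl⟩ := h₃
  have hv₀ : v₀ ∈ U := Finset.mem_biUnion.2 ⟨i, Finset.mem_univ _, hi⟩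
  have h3 : 3 ≤ (Finset.univ.filter fun i => v₀ ∈ (T i).nodes).card := by
    rw [← Finset.card_eq_three.2 ⟨i, j, l, hij, hil, hjl, rfl⟩]
    refine Finset.card_le_card fun x hx => ?_
    simp only [Finset.mem_insert, Finset.mem_singleton] at hx
    rcases hx with rfl | rfl | rfl <;> simpa
  have h2 : ∀ v ∈ U, 2 ≤ (Finset.univ.filter fun i => v ∈ (T i).nodes).card := by
    intro v hv
    obtain ⟨a, -, ha⟩ := Finset.mem_biUnion.1 hv
    obtain ⟨b, hba, hb⟩ := h₂ a v ha
    rw [← Finset.card_pair hba]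
    refine Finset.card_le_card fun x hx => ?_
    simp only [Finset.mem_insert, Finset.mem_singleton] at hx
    rcases hx with rfl | rfl <;> simpa
  rw [h1, ← Finset.mul_prod_erase _ _ hv₀, ← Finset.mul_prod_erase U (fun v => t v ^ 2) hv₀,
    ← mul_assoc]
  refine mul_le_mul ?_ (Finset.prod_le_prod (fun v _ => pow_nonneg (ht0 v) _) fun v hv =>
    pow_le_pow_of_le_one (ht0 v) (ht1 v) (h2 v (Finset.mem_of_mem_erase hv)))
    (Finset.prod_nonneg fun v _ => pow_nonneg (ht0 v) _)
    (mul_nonneg ((ht0 v₀).trans (htε v₀)) (sq_nonneg _))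
  calc _ ≤ t v₀ ^ 3 := pow_le_pow_of_le_one (ht0 v₀) (ht1 v₀) h3
    _ = t v₀ * t v₀ ^ 2 := by ring
    _ ≤ ε * t v₀ ^ 2 := mul_le_mul_of_nonneg_right (htε v₀) (sq_nonneg _)

/-- The moments of a weighted sum of bounded degenerate variables over connected graphs almost
satisfy the recursion of the Gaussian moments, if the weights are small on each node. -/
theorem abs_moment_recursion_le {Ω : Type*} [MeasurableSpace Ω] {P : Measure Ω}
    [IsProbabilityMeasure P] {Y : ℕ → ℕ → Ω → ℝ} {φ : ℝ → ℝ → ℝ → ℝ} {ξ η : ℕ → Ω → ℝ}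
    {ζ : ℕ → ℕ → Ω → ℝ} {X : BipGraph → Ω → ℝ} {B : ℝ}
    (hY : IsAHKRepresentation P Y φ ξ η ζ) (hX : IsDegenerateFamily P ξ η ζ X)
    (hG : G.Injective) (hB0 : 0 ≤ B) (hB : ∀ a, ∀ᵐ ω ∂P, |X (G a) ω| ≤ B)
    (hconn : ∀ a, (G a).Connected) {Vtx : Finset (ℕ ⊕ ℕ)} (ht : ∑ v ∈ Vtx, t v ^ 2 ≤ 2)
    (hV : ∀ a, (G a).nodes ⊆ Vtx) {D : ℕ} (hD : ∀ a, (G a).nodes.card ≤ D) {ε : ℝ}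
    (ht0 : ∀ v, 0 ≤ t v) (htε : ∀ v, t v ≤ ε) (hε : ε ≤ 1) {w : α → ℝ} {C₀ : ℝ} (hC₀ : 0 ≤ C₀)
    (hw : ∀ a, |w a| ≤ C₀ * ∏ v ∈ (G a).nodes, t v) (k : ℕ) :
    |∫ ω, (∑ a, w a * X (G a) ω) ^ (k + 2) ∂P -
        (k + 1) * (∑ a, w a ^ 2 * ∫ ω, X (G a) ω ^ 2 ∂P) *
          ∫ ω, (∑ a, w a * X (G a) ω) ^ k ∂P| ≤
      C₀ ^ (k + 2) * ((k + 2) * B ^ (k + 2)) *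
        (((2 ^ ((k + 2) * D + (k + 2) * D * ((k + 2) * D))) ^ (k + 2) : ℕ) * Real.exp 2) * ε := by
  classical
  rw [← sum_pairingDefect hY hX hG hB w k]
  have hε0 : 0 ≤ ε := (ht0 (Sum.inl 0)).trans (htε _)
  have hterm : ∀ T : Fin (k + 2) → α,
      |(∏ i, w (T i)) * pairingDefect P X (fun i => G (T i))| ≤
        C₀ ^ (k + 2) * ((k + 2) * B ^ (k + 2)) *
          (ε * ∏ v ∈ Finset.univ.biUnion (fun i => (G (T i)).nodes), t v ^ 2) := by
    intro T
    have hpos : 0 ≤ ε * ∏ v ∈ Finset.univ.biUnion (fun i => (G (T i)).nodes), t v ^ 2 :=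
      mul_nonneg hε0 (Finset.prod_nonneg fun v _ => sq_nonneg _)
    by_cases h0 : pairingDefect P X (fun i => G (T i)) = 0
    · rw [h0, mul_zero, abs_zero]
      positivity
    obtain ⟨h₂, h₃⟩ := cover_of_pairingDefect_ne_zero hY hX (T := fun i => G (T i))
      (fun i => hB _) (fun i => hconn _) h0
    have h1 : |∏ i, w (T i)| ≤ C₀ ^ (k + 2) * ∏ i, ∏ v ∈ (G (T i)).nodes, t v := by
      rw [Finset.abs_prod]
      refine (Finset.prod_le_prod (fun i _ => abs_nonneg _) fun i _ => hw (T i)).trans ?_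
      rw [Finset.prod_mul_distrib, Finset.prod_const, Finset.card_univ, Fintype.card_fin]
    have h4 := prod_prod_nodes_le ht0 htε hε h₂ h₃
    rw [abs_mul]
    calc _ ≤ (C₀ ^ (k + 2) * (ε * ∏ v ∈ Finset.univ.biUnion (fun i => (G (T i)).nodes), t v ^ 2)) *
          ((k + 2) * B ^ (k + 2)) :=
          mul_le_mul (h1.trans (mul_le_mul_of_nonneg_left h4 (by positivity)))
            (abs_pairingDefect_le fun i => hB _) (abs_nonneg _)
            (mul_nonneg (by positivity) hpos)
      _ = _ := by ring
  refine (Finset.abs_sum_le_sum_abs _ _).trans ((Finset.sum_le_sum fun T _ => hterm T).trans ?_)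
  rw [← Finset.mul_sum, ← Finset.mul_sum, mul_assoc _ _ ε]
  refine mul_le_mul_of_nonneg_left ?_ (by positivity)
  rw [mul_comm _ ε]
  refine mul_le_mul_of_nonneg_left ?_ hε0
  have := sum_prod_sq_nodes_tuple_le (ι := Fin (k + 2)) hG ht hV hD
    (M := (k + 2) * D) (by rw [Fintype.card_fin])
  rwa [Fintype.card_fin] at this

end Counting

/-! ### The method of moments for Gaussian limits -/

theorem norm_exp_I_mul_sub_sum_le (x : ℝ) (n : ℕ) :
    ‖Complex.exp (Complex.I * x) - ∑ k ∈ Finset.range n, (Complex.I * x) ^ k / k.factorial‖ ≤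
      |x| ^ n / n.factorial := by
  -- The remainders along the segment from `0` to `x` are successive antiderivatives.
  have key : ∀ n : ℕ, ∀ u ∈ Set.Icc (0 : ℝ) 1,
      ‖Complex.exp (Complex.I * x * u) -
        ∑ k ∈ Finset.range n, (Complex.I * x * u) ^ k / k.factorial‖ ≤
        (|x| * u) ^ n / n.factorial := by
    intro n
    induction n with
    | zero =>
      intro u _
      have : Complex.I * x * u = ((x * u : ℝ) : ℂ) * Complex.I := by push_cast; ring
      simp only [Finset.range_zero, Finset.sum_empty, sub_zero, pow_zero, Nat.factorial_zero,
        Nat.cast_one, div_one]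
      rw [this, Complex.norm_exp_ofReal_mul_I]
    | succ n ih =>
      have hderiv : ∀ u : ℝ, HasDerivAt (fun u : ℝ => Complex.exp (Complex.I * x * u) -
          ∑ k ∈ Finset.range (n + 1), (Complex.I * x * u) ^ k / k.factorial)
          (Complex.I * x * (Complex.exp (Complex.I * x * u) -
            ∑ k ∈ Finset.range n, (Complex.I * x * u) ^ k / k.factorial)) u := by
        intro u
        have hlin : HasDerivAt (fun u : ℝ => Complex.I * x * (u : ℂ)) (Complex.I * x) u := by
          simpa using (Complex.ofRealCLM.hasDerivAt (x := u)).const_mul (Complex.I * (x : ℂ))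
        have hsum : HasDerivAt (fun u : ℝ => ∑ k ∈ Finset.range (n + 1),
            (Complex.I * x * (u : ℂ)) ^ k / (k.factorial : ℂ))
            (∑ k ∈ Finset.range n, Complex.I * x * ((Complex.I * x * (u : ℂ)) ^ k /
              (k.factorial : ℂ))) u := by
          have h := HasDerivAt.fun_sum (u := Finset.range (n + 1)) (x := u)
            (A := fun k (u : ℝ) => (Complex.I * x * (u : ℂ)) ^ k / (k.factorial : ℂ))
            (A' := fun k => (k * (Complex.I * x * (u : ℂ)) ^ (k - 1) * (Complex.I * x)) /
              (k.factorial : ℂ)) fun k _ => (hlin.pow k).div_const _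
          refine h.congr_deriv ?_
          rw [Finset.sum_range_succ']
          simp only [Nat.cast_zero, zero_mul, zero_div, add_zero]
          refine Finset.sum_congr rfl fun k _ => ?_
          have h1 : (k.factorial : ℂ) ≠ 0 := Nat.cast_ne_zero.2 k.factorial_ne_zero
          have h2 : ((k + 1 : ℕ) : ℂ) ≠ 0 := Nat.cast_ne_zero.2 k.succ_ne_zero
          rw [Nat.factorial_succ, Nat.add_sub_cancel, Nat.cast_mul]
          field_simp
        refine (hlin.cexp.sub hsum).congr_deriv ?_
        rw [← Finset.mul_sum]
        ring
      have hB : ∀ u : ℝ, HasDerivAt (fun u : ℝ => (|x| * u) ^ (n + 1) / (n + 1).factorial)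
          (|x| * ((|x| * u) ^ n / n.factorial)) u := by
        intro u
        have h1 : (n.factorial : ℝ) ≠ 0 := Nat.cast_ne_zero.2 n.factorial_ne_zero
        have h2 : ((n + 1 : ℕ) : ℝ) ≠ 0 := Nat.cast_ne_zero.2 n.succ_ne_zero
        have h := (((hasDerivAt_id u).const_mul |x|).pow (n + 1)).div_const
          ((n + 1).factorial : ℝ)
        refine h.congr_deriv ?_
        rw [Nat.factorial_succ, Nat.add_sub_cancel, Nat.cast_mul]
        simp only [id, mul_one]
        field_simp
      intro u hu
      refine image_norm_le_of_norm_deriv_right_le_deriv_boundary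
        (fun v _ => (hderiv v).continuousAt.continuousWithinAt)
        (fun v _ => (hderiv v).hasDerivWithinAt) ?_ hB ?_ hu
      · simp [Finset.sum_range_succ']
      · intro v hv
        rw [norm_mul, norm_mul, Complex.norm_I, one_mul, Complex.norm_real, Real.norm_eq_abs]
        exact mul_le_mul_of_nonneg_left (ih v ⟨hv.1, hv.2.le⟩) (abs_nonneg _)
  simpa using key n 1 (by simp)

/-- The moments of the centred normal distribution with variance `s`, by their recursion. -/
def gaussianMoment (s : ℝ) : ℕ → ℝ
  | 0 => 1
  | 1 => 0
  | k + 2 => (k + 1) * s * gaussianMoment s k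

theorem gaussianMoment_odd (s : ℝ) (j : ℕ) : gaussianMoment s (2 * j + 1) = 0 := by
  induction j with
  | zero => rfl
  | succ j ih =>
    rw [show 2 * (j + 1) + 1 = 2 * j + 1 + 2 by ring, gaussianMoment, ih, mul_zero]

theorem gaussianMoment_even (s : ℝ) (j : ℕ) :
    gaussianMoment s (2 * j) / (2 * j).factorial = (s / 2) ^ j / j.factorial := by
  induction j with
  | zero => simp [gaussianMoment]
  | succ j ih =>
    have h1 : ((2 * j).factorial : ℝ) ≠ 0 := Nat.cast_ne_zero.2 (Nat.factorial_ne_zero _)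
    have h2 : (j.factorial : ℝ) ≠ 0 := Nat.cast_ne_zero.2 (Nat.factorial_ne_zero _)
    have h3 : ((j : ℝ) + 1) ≠ 0 := by positivity
    have h4 : (2 * (j : ℝ) + 1) ≠ 0 := by positivity
    rw [show 2 * (j + 1) = 2 * j + 2 by ring, gaussianMoment, Nat.factorial_succ,
      Nat.factorial_succ, Nat.factorial_succ, pow_succ]
    push_cast
    rw [div_eq_iff h1] at ih
    rw [ih]
    field_simp
    ring

theorem sum_gaussianMoment (s t : ℝ) (n : ℕ) :
    ∑ k ∈ Finset.range (2 * n), (Complex.I * t) ^ k / k.factorial * (gaussianMoment s k : ℂ) =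
      ∑ j ∈ Finset.range n, ((-(t ^ 2 * s / 2) : ℝ) : ℂ) ^ j / j.factorial := by
  induction n with
  | zero => simp
  | succ n ih =>
    rw [show 2 * (n + 1) = 2 * n + 1 + 1 by ring, Finset.sum_range_succ, Finset.sum_range_succ, ih,
      Finset.sum_range_succ, gaussianMoment_odd, Complex.ofReal_zero, mul_zero, add_zero]
    congr 1
    have h := congrArg (fun x : ℝ => (x : ℂ)) (gaussianMoment_even s n)
    push_cast at h
    rw [div_mul_eq_mul_div, mul_div_assoc, h, pow_mul, mul_pow, Complex.I_sq]
    push_cast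
    rw [← mul_div_assoc, ← mul_pow]
    congr 2
    ring

section Moments

variable {Ω : Type*} [MeasurableSpace Ω] {P : Measure Ω} [IsProbabilityMeasure P]

omit [IsProbabilityMeasure P] in
theorem integrable_exp_I_mul [IsFiniteMeasure P] {f : Ω → ℝ}
    (hf : AEStronglyMeasurable f P) (t : ℝ) :
    Integrable (fun ω => Complex.exp (Complex.I * (t * f ω : ℝ))) P := by
  refine Integrable.of_bound (C := 1) ?_ (Eventually.of_forall fun ω => ?_)
  · have hc : Continuous fun x : ℝ => Complex.exp (Complex.I * (t * x : ℝ)) := by fun_prop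
    exact hc.comp_aestronglyMeasurable hf
  · rw [mul_comm, Complex.norm_exp_ofReal_mul_I]

theorem norm_charFun_sub_sum_moments_le {W : Ω → ℝ} (hW : ∀ k : ℕ, Integrable (fun ω => W ω ^ k) P)
    (t : ℝ) (n : ℕ) :
    ‖∫ ω, Complex.exp (Complex.I * (t * W ω : ℝ)) ∂P - ∑ k ∈ Finset.range (2 * n),
        (Complex.I * t) ^ k / k.factorial * ((∫ ω, W ω ^ k ∂P : ℝ) : ℂ)‖ ≤
      t ^ (2 * n) / (2 * n).factorial * ∫ ω, W ω ^ (2 * n) ∂P := by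
  have hWm : AEStronglyMeasurable W P := by simpa using (hW 1).1
  have h2 : ∀ k : ℕ, Integrable (fun ω => (Complex.I * (t * W ω : ℝ)) ^ k / k.factorial) P := by
    intro k
    have := ((hW k).ofReal (𝕜 := ℂ)).const_mul ((Complex.I * t) ^ k / k.factorial)
    refine this.congr (Eventually.of_forall fun ω => ?_)
    simp only [RCLike.ofReal_pow, Complex.coe_algebraMap]
    push_cast
    ring_nf
  have h3 : ∀ k : ℕ, (Complex.I * t) ^ k / k.factorial * ((∫ ω, W ω ^ k ∂P : ℝ) : ℂ) =
      ∫ ω, (Complex.I * (t * W ω : ℝ)) ^ k / k.factorial ∂P := by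
    intro k
    rw [← integral_complex_ofReal, ← integral_const_mul]
    refine integral_congr_ae (Eventually.of_forall fun ω => ?_)
    push_cast
    ring
  simp_rw [h3]
  rw [← integral_finsetSum _ fun k _ => h2 k, ← integral_sub (integrable_exp_I_mul hWm t)
      (integrable_finsetSum _ fun k _ => h2 k),
    ← integral_const_mul]
  refine norm_integral_le_of_norm_le ((hW _).const_mul _) (Eventually.of_forall fun ω => ?_)
  refine (norm_exp_I_mul_sub_sum_le (t * W ω) (2 * n)).trans (le_of_eq ?_)
  rw [pow_mul, sq_abs, ← pow_mul, mul_pow]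
  ring

/-- The method of moments for a convergent sequence of variances. -/
theorem tendsto_charFun_of_moments {W : ℕ → Ω → ℝ} {s : ℕ → ℝ} {s₀ : ℝ}
    (hW : ∀ N k : ℕ, Integrable (fun ω => W N ω ^ k) P) (hs : Tendsto s atTop (𝓝 s₀))
    (h1 : Tendsto (fun N => ∫ ω, W N ω ∂P) atTop (𝓝 0))
    (hrec : ∀ k : ℕ, Tendsto (fun N => ∫ ω, W N ω ^ (k + 2) ∂P -
      (k + 1) * s N * ∫ ω, W N ω ^ k ∂P) atTop (𝓝 0)) (t : ℝ) :
    Tendsto (fun N => ∫ ω, Complex.exp (Complex.I * (t * W N ω : ℝ)) ∂P) atTop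
      (𝓝 (Complex.exp ((-(t ^ 2 * s₀ / 2) : ℝ) : ℂ))) := by
  have hmom : ∀ k : ℕ, Tendsto (fun N => ∫ ω, W N ω ^ k ∂P) atTop (𝓝 (gaussianMoment s₀ k)) := by
    intro k
    induction k using Nat.twoStepInduction with
    | zero => simp [gaussianMoment]
    | one => simpa [gaussianMoment] using h1
    | more k ih _ =>
      have := (hrec k).add ((hs.const_mul ((k : ℝ) + 1)).mul ih)
      simpa [gaussianMoment] using this
  have hexp := (NormedSpace.exp_series_hasSum_exp' (𝕂 := ℂ)
    ((-(t ^ 2 * s₀ / 2) : ℝ) : ℂ)).tendsto_sum_nat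
  have hzero : Tendsto (fun n : ℕ => t ^ (2 * n) / (2 * n).factorial * gaussianMoment s₀ (2 * n))
      atTop (𝓝 0) := by
    have := FloorSemiring.tendsto_pow_div_factorial_atTop (t ^ 2 * (s₀ / 2))
    refine this.congr fun n => ?_
    rw [mul_pow, mul_div_assoc, ← gaussianMoment_even, pow_mul]
    ring
  rw [Metric.tendsto_atTop]
  intro ε hε
  have hexp' : Tendsto (fun n => ∑ j ∈ Finset.range n,
      ((-(t ^ 2 * s₀ / 2) : ℝ) : ℂ) ^ j / j.factorial) atTop
      (𝓝 (Complex.exp ((-(t ^ 2 * s₀ / 2) : ℝ) : ℂ))) := by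
    rw [Complex.exp_eq_exp_ℂ]
    refine hexp.congr fun n => Finset.sum_congr rfl fun j _ => ?_
    rw [smul_eq_mul, inv_mul_eq_div]
  obtain ⟨n, hn1, hn2⟩ := ((Metric.tendsto_nhds.1 hexp' (ε / 3) (by positivity)).and
    (hzero.eventually (gt_mem_nhds (show (0 : ℝ) < ε / 3 by positivity)))).exists
  -- For fixed `n` the moments up to order `2 n` converge.
  have hlim1 : Tendsto (fun N => ∑ k ∈ Finset.range (2 * n),
      (Complex.I * t) ^ k / k.factorial * ((∫ ω, W N ω ^ k ∂P : ℝ) : ℂ)) atTop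
      (𝓝 (∑ j ∈ Finset.range n, ((-(t ^ 2 * s₀ / 2) : ℝ) : ℂ) ^ j / j.factorial)) := by
    rw [← sum_gaussianMoment]
    exact tendsto_finsetSum _ fun k _ =>
      ((Complex.continuous_ofReal.tendsto _).comp (hmom k)).const_mul _
  have hlim2 : Tendsto (fun N => t ^ (2 * n) / (2 * n).factorial * ∫ ω, W N ω ^ (2 * n) ∂P) atTop
      (𝓝 (t ^ (2 * n) / (2 * n).factorial * gaussianMoment s₀ (2 * n))) :=
    (hmom _).const_mul _
  obtain ⟨N₀, hN₀⟩ := eventually_atTop.1 ((Metric.tendsto_nhds.1 hlim1 (ε / 3) (by positivity)).and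
    (hlim2.eventually (gt_mem_nhds hn2)))
  refine ⟨N₀, fun N hN => ?_⟩
  obtain ⟨e1, e2⟩ := hN₀ N hN
  have e3 := (norm_charFun_sub_sum_moments_le (hW N) t n).trans_lt e2
  rw [← dist_eq_norm] at e3
  calc _ ≤ _ := dist_triangle4 _ _ _ _
    _ < ε / 3 + ε / 3 + ε / 3 := add_lt_add (add_lt_add e3 e1) hn1
    _ = ε := by ring

/-- The method of moments for bounded variances. -/
theorem tendsto_charFun_sub_of_moments {W : ℕ → Ω → ℝ} {s : ℕ → ℝ} {C : ℝ}
    (hW : ∀ N k : ℕ, Integrable (fun ω => W N ω ^ k) P)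
    (hs : ∀ᶠ N in atTop, s N ∈ Set.Icc 0 C)
    (h1 : Tendsto (fun N => ∫ ω, W N ω ∂P) atTop (𝓝 0))
    (hrec : ∀ k : ℕ, Tendsto (fun N => ∫ ω, W N ω ^ (k + 2) ∂P -
      (k + 1) * s N * ∫ ω, W N ω ^ k ∂P) atTop (𝓝 0)) (t : ℝ) :
    Tendsto (fun N => ∫ ω, Complex.exp (Complex.I * (t * W N ω : ℝ)) ∂P -
      Complex.exp ((-(t ^ 2 * s N / 2) : ℝ) : ℂ)) atTop (𝓝 0) := by
  refine tendsto_of_subseq_tendsto fun ns hns => ?_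
  obtain ⟨s₀, -, ms, hms, hlim⟩ := isCompact_Icc.tendsto_subseq' (hns.eventually hs).frequently
  refine ⟨ms, ?_⟩
  have hsub : Tendsto (fun N => ns (ms N)) atTop atTop := hns.comp hms.tendsto_atTop
  have a1 := tendsto_charFun_of_moments (W := fun N => W (ns (ms N)))
    (s := fun N => s (ns (ms N))) (fun N k => hW _ k) hlim (h1.comp hsub)
    (fun k => (hrec k).comp hsub) t
  have hc : Continuous fun x : ℝ => Complex.exp ((-(t ^ 2 * x / 2) : ℝ) : ℂ) := by fun_prop
  have a2 := (hc.tendsto s₀).comp hlim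
  simpa using a1.sub a2

end Moments

/-! ### Truncation of the kernel -/

section Truncation

variable {Ω : Type*} [mΩ : MeasurableSpace Ω] {P : Measure Ω}
  {Y : ℕ → ℕ → Ω → ℝ} {φ : ℝ → ℝ → ℝ → ℝ} {ξ η : ℕ → Ω → ℝ} {ζ : ℕ → ℕ → Ω → ℝ}
  {p q : ℕ} {h h' : (Fin p → Fin q → ℝ) → ℝ}

/-- The kernel `h` with its values cut off at `-M` and `M`. -/
def truncate (M : ℝ) (h : (Fin p → Fin q → ℝ) → ℝ) : (Fin p → Fin q → ℝ) → ℝ :=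
  fun A => max (-M) (min M (h A))

theorem abs_truncate_le {M : ℝ} (hM : 0 ≤ M) (A : Fin p → Fin q → ℝ) : |truncate M h A| ≤ M :=
  abs_le.2 ⟨le_max_left _ _, max_le (by linarith) (min_le_left _ _)⟩

theorem abs_truncate_le_abs {M : ℝ} (hM : 0 ≤ M) (A : Fin p → Fin q → ℝ) :
    |truncate M h A| ≤ |h A| := by
  refine abs_le.2 ⟨?_, max_le ?_ ((min_le_right _ _).trans (le_abs_self _))⟩
  · rcases le_total M (h A) with hA | hA
    · rw [truncate, min_eq_left hA]
      exact le_max_of_le_right (by linarith [abs_nonneg (h A)])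
    · rw [truncate, min_eq_right hA]
      exact le_max_of_le_right (neg_abs_le _)
  · linarith [abs_nonneg (h A)]

theorem truncate_eq_of_abs_le {M : ℝ} {A : Fin p → Fin q → ℝ} (hA : |h A| ≤ M) :
    truncate M h A = h A := by
  rw [truncate, min_eq_right (abs_le.1 hA).2, max_eq_right (abs_le.1 hA).1]

theorem IsKernel.truncate (hK : IsKernel P Y φ ξ η ζ h) {M : ℝ} (hM : 0 ≤ M) :
    IsKernel P Y φ ξ η ζ (truncate M h) where
  repr := hK.repr
  meas := measurable_const.max (measurable_const.min hK.meas)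
  symm σ τ A := by simp only [RCE.truncate, hK.symm]
  memLp := hK.memLp.of_le
    (hK.repr.aestronglyMeasurable_kernelAt
      (measurable_const.max (measurable_const.min hK.meas)) _ _)
    (Eventually.of_forall fun _ => abs_truncate_le_abs hM _)

theorem IsKernel.sub (hK : IsKernel P Y φ ξ η ζ h) (hK' : IsKernel P Y φ ξ η ζ h') :
    IsKernel P Y φ ξ η ζ (h - h') where
  repr := hK.repr
  meas := hK.meas.sub hK'.meas
  symm σ τ A := by simp only [Pi.sub_apply, hK.symm, hK'.symm]
  memLp := hK.memLp.sub hK'.memLp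

theorem IsKernel.tendsto_integral_sq_sub_truncate (hK : IsKernel P Y φ ξ η ζ h) :
    Tendsto (fun M : ℕ => ∫ ω, kernel₀ (h - RCE.truncate (M : ℝ) h) Y ω ^ 2 ∂P) atTop (𝓝 0) := by
  have h0 : ∫ _, (0 : ℝ) ∂P = 0 := by simp
  rw [← h0]
  refine tendsto_integral_of_dominated_convergence (fun ω => 4 * kernel₀ h Y ω ^ 2) (fun M => ?_)
    (hK.memLp.integrable_sq.const_mul 4) (fun M => Eventually.of_forall fun ω => ?_)
    (Eventually.of_forall fun ω => ?_)
  · exact (hK.sub (hK.truncate M.cast_nonneg)).memLp.1.pow 2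
  · set A : Fin p → Fin q → ℝ := fun a b =>
      Y ((Finset.range p).orderEmbOfFin (Finset.card_range p) a)
        ((Finset.range q).orderEmbOfFin (Finset.card_range q) b) ω
    change ‖(h A - RCE.truncate M h A) ^ 2‖ ≤ 4 * h A ^ 2
    rw [Real.norm_eq_abs, abs_of_nonneg (sq_nonneg _)]
    have h1 : |h A - RCE.truncate M h A| ≤ |2 * h A| := by
      rw [abs_mul, abs_two]
      exact (abs_sub _ _).trans (by
        linarith [abs_truncate_le_abs (h := h) (M.cast_nonneg (α := ℝ)) A])
    calc _ ≤ (2 * h A) ^ 2 := sq_le_sq.2 h1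
      _ = _ := by ring
  · refine tendsto_const_nhds.congr' ?_
    filter_upwards [eventually_ge_atTop ⌈|kernel₀ h Y ω|⌉₊] with M hM
    have h1 : |kernel₀ h Y ω| ≤ M := (Nat.le_ceil _).trans (Nat.cast_le.2 hM)
    change 0 = (kernel₀ h Y ω - kernel₀ (RCE.truncate M h) Y ω) ^ 2
    have h2 : kernel₀ (RCE.truncate M h) Y ω = kernel₀ h Y ω := truncate_eq_of_abs_le h1
    rw [h2, sub_self, zero_pow two_ne_zero]

variable [IsProbabilityMeasure P]

theorem IsKernel.isDegenerateFamily_graphProj (hK : IsKernel P Y φ ξ η ζ h) :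
    IsDegenerateFamily P ξ η ζ (graphProj P ξ η ζ h Y) :=
  ⟨stronglyMeasurable_graphProj, fun _ _ => hK.repr.condExp_graphProj_eq_zero⟩

omit [IsProbabilityMeasure P] in
theorem abs_graphProj_truncate_le {M : ℝ} (hM : 0 ≤ M) {D : ℕ} {G : BipGraph} (hG : G.size ≤ D) :
    ∀ᵐ ω ∂P, |graphProj P ξ η ζ (RCE.truncate M h) Y G ω| ≤ M * (1 + 2 ^ D) ^ D := by
  rcases graphProj_eq_proj_or_zero (P := P) (ξ := ξ) (η := η) (ζ := ζ) (h := RCE.truncate M h)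
    (Y := Y) G with ⟨I, J, hI, hJ, -, h1⟩ | h1
  · rw [h1]
    filter_upwards [abs_proj_le (P := P) (ξ := ξ) (η := η) (ζ := ζ)
      (X := kernelAt (RCE.truncate M h) Y I J hI hJ)
      (Eventually.of_forall fun ω => abs_truncate_le hM _) hM D hG] with ω hω
    refine hω.trans (mul_le_mul_of_nonneg_left (pow_le_pow_right₀ ?_ hG) hM)
    linarith [pow_pos (two_pos : (0 : ℝ) < 2) D]
  · rw [h1]
    refine Eventually.of_forall fun ω => ?_
    simp only [Pi.zero_apply, abs_zero]
    positivity

omit [IsProbabilityMeasure P] in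
theorem IsKernel.graphProj_sub [IsFiniteMeasure P] (hK : IsKernel P Y φ ξ η ζ h)
    (hK' : IsKernel P Y φ ξ η ζ h') (G : BipGraph) :
    graphProj P ξ η ζ (h - h') Y G =ᵐ[P]
      graphProj P ξ η ζ h Y G - graphProj P ξ η ζ h' Y G := by
  by_cases H : ∃ A : {A : Finset ℕ × Finset ℕ // A.1.card = p ∧ A.2.card = q}, G ≤ K A.1.1 A.1.2
  · simp only [graphProj, dif_pos H]
    exact proj_sub ((hK.memLp_kernelAt _ _).integrable one_le_two)
      ((hK'.memLp_kernelAt _ _).integrable one_le_two) G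
  · simp only [graphProj, dif_neg H, sub_zero]
    exact EventuallyEq.rfl

theorem IsKernel.integral_sq_graphProj_le (hK : IsKernel P Y φ ξ η ζ h) (G : BipGraph) :
    ∫ ω, graphProj P ξ η ζ h Y G ω ^ 2 ∂P ≤ ∫ ω, kernel₀ h Y ω ^ 2 ∂P := by
  rcases graphProj_eq_proj_or_zero (P := P) (ξ := ξ) (η := η) (ζ := ζ) (h := h)
    (Y := Y) G with ⟨I, J, hI, hJ, -, h1⟩ | h1
  · rw [h1]
    have h2 : ∫ ω, kernelAt h Y I J hI hJ ω ^ 2 ∂P = ∫ ω, kernel₀ h Y ω ^ 2 ∂P :=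
      ((hK.repr.identDistrib_kernelAt hK.meas hK.symm hI hJ).comp
        (measurable_id.pow_const 2)).integral_eq
    rw [← h2]
    exact hK.repr.integral_sq_proj_le (hK.memLp_kernelAt hI hJ) G
  · rw [h1]
    simp only [Pi.zero_apply, ne_eq, OfNat.ofNat_ne_zero, not_false_eq_true, zero_pow,
      integral_zero]
    exact integral_nonneg fun ω => sq_nonneg _

end Truncation

/-! ### Characteristic functions under approximation in mean square -/

section Approximation

variable {Ω : Type*} [MeasurableSpace Ω] {P : Measure Ω} [IsProbabilityMeasure P] {f g : Ω → ℝ}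
  {δ : ℝ}

theorem norm_exp_I_mul_sub_exp_I_mul_le (x y : ℝ) :
    ‖Complex.exp (Complex.I * x) - Complex.exp (Complex.I * y)‖ ≤ |x - y| := by
  have h1 : Complex.exp (Complex.I * x) - Complex.exp (Complex.I * y) =
      Complex.exp (Complex.I * y) * (Complex.exp (Complex.I * (x - y : ℝ)) - 1) := by
    rw [mul_sub, ← Complex.exp_add, mul_one]
    congr 2
    push_cast
    ring
  rw [h1, norm_mul, mul_comm Complex.I, Complex.norm_exp_ofReal_mul_I, one_mul]
  have := norm_exp_I_mul_sub_sum_le (x - y) 1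
  simpa using this

theorem norm_charFun_sub_charFun_le (hf : MemLp f 2 P) (hg : MemLp g 2 P) (hδ : 0 < δ)
    (hfg : ∫ ω, (f ω - g ω) ^ 2 ∂P ≤ δ ^ 2) (t : ℝ) :
    ‖∫ ω, Complex.exp (Complex.I * (t * f ω : ℝ)) ∂P -
      ∫ ω, Complex.exp (Complex.I * (t * g ω : ℝ)) ∂P‖ ≤ |t| * δ := by
  rw [← integral_sub (integrable_exp_I_mul hf.1 t) (integrable_exp_I_mul hg.1 t)]
  have hsq : Integrable (fun ω => (f ω - g ω) ^ 2) P := (hf.sub hg).integrable_sq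
  have hbd : Integrable (fun ω => |t| * (δ / 2 + δ⁻¹ / 2 * (f ω - g ω) ^ 2)) P :=
    ((integrable_const _).add (hsq.const_mul _)).const_mul _
  refine (norm_integral_le_of_norm_le hbd (Eventually.of_forall fun ω => ?_)).trans ?_
  · refine (norm_exp_I_mul_sub_exp_I_mul_le _ _).trans ?_
    rw [← mul_sub, abs_mul]
    refine mul_le_mul_of_nonneg_left ?_ (abs_nonneg t)
    have h1 : 0 ≤ δ⁻¹ * (|f ω - g ω| - δ) ^ 2 := by positivity
    have h2 : δ⁻¹ * (|f ω - g ω| - δ) ^ 2 = δ⁻¹ * (f ω - g ω) ^ 2 - 2 * |f ω - g ω| + δ := by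
      rw [sub_sq, sq_abs]
      field_simp
    linarith
  · rw [integral_const_mul, integral_add (integrable_const _) (hsq.const_mul _),
      integral_const_mul, integral_const, probReal_univ, one_smul]
    refine mul_le_mul_of_nonneg_left ?_ (abs_nonneg t)
    have h1 : δ⁻¹ / 2 * ∫ ω, (f ω - g ω) ^ 2 ∂P ≤ δ⁻¹ / 2 * δ ^ 2 :=
      mul_le_mul_of_nonneg_left hfg (by positivity)
    have h2 : δ⁻¹ / 2 * δ ^ 2 = δ / 2 := by field_simp
    linarith

omit [IsProbabilityMeasure P] in
theorem abs_integral_sq_sub_le (hf : MemLp f 2 P) (hg : MemLp g 2 P) (hδ : 0 < δ)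
    (hfg : ∫ ω, (f ω - g ω) ^ 2 ∂P ≤ δ ^ 2) :
    |∫ ω, f ω ^ 2 ∂P - ∫ ω, g ω ^ 2 ∂P| ≤ δ * (∫ ω, f ω ^ 2 ∂P + 1 + δ) := by
  have hsq : Integrable (fun ω => (f ω - g ω) ^ 2) P := (hf.sub hg).integrable_sq
  rw [← integral_sub hf.integrable_sq hg.integrable_sq, ← Real.norm_eq_abs]
  refine (norm_integral_le_of_norm_le (g := fun ω => δ * f ω ^ 2 + (δ⁻¹ + 1) * (f ω - g ω) ^ 2)
    ((hf.integrable_sq.const_mul _).add (hsq.const_mul _))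
    (Eventually.of_forall fun ω => ?_)).trans ?_
  · rw [Real.norm_eq_abs, show f ω ^ 2 - g ω ^ 2 = 2 * f ω * (f ω - g ω) - (f ω - g ω) ^ 2 by ring]
    have h0 : 0 ≤ δ⁻¹ * (|f ω - g ω| - δ * |f ω|) ^ 2 := by positivity
    have h1 : δ⁻¹ * (|f ω - g ω| - δ * |f ω|) ^ 2 =
        δ⁻¹ * (f ω - g ω) ^ 2 - 2 * |f ω| * |f ω - g ω| + δ * f ω ^ 2 := by
      rw [sub_sq, mul_pow, sq_abs, sq_abs]
      field_simp
    have h2 := abs_sub (2 * f ω * (f ω - g ω)) ((f ω - g ω) ^ 2)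
    rw [abs_mul, abs_mul, abs_two, abs_of_nonneg (sq_nonneg (f ω - g ω))] at h2
    linarith
  · rw [integral_add (hf.integrable_sq.const_mul _) (hsq.const_mul _), integral_const_mul,
      integral_const_mul]
    have h1 := mul_le_mul_of_nonneg_left hfg (show 0 ≤ δ⁻¹ + 1 by positivity)
    have h2 : (δ⁻¹ + 1) * δ ^ 2 = δ * (1 + δ) := by field_simp
    linarith

theorem abs_exp_neg_sub_exp_neg_le {x y : ℝ} (hx : 0 ≤ x) (hy : 0 ≤ y) :
    |Real.exp (-x) - Real.exp (-y)| ≤ |x - y| := by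
  wlog hxy : x ≤ y generalizing x y
  · rw [abs_sub_comm, abs_sub_comm x]
    exact this hy hx (le_of_not_ge hxy)
  rw [abs_of_nonneg (sub_nonneg.2 (Real.exp_le_exp.2 (neg_le_neg hxy))), abs_sub_comm,
    abs_of_nonneg (sub_nonneg.2 hxy)]
  have h1 : Real.exp (-y) = Real.exp (-x) * Real.exp (-(y - x)) := by
    rw [← Real.exp_add]; congr 1; ring
  have h2 : Real.exp (-x) ≤ 1 := Real.exp_le_one_iff.2 (by linarith)
  have h3 := Real.add_one_le_exp (-(y - x))
  have h4 := Real.exp_pos (-x)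
  calc _ = Real.exp (-x) * (1 - Real.exp (-(y - x))) := by rw [h1]; ring
    _ ≤ Real.exp (-x) * (y - x) := mul_le_mul_of_nonneg_left (by linarith) h4.le
    _ ≤ y - x := mul_le_of_le_one_left (by linarith) h2

/-- Gaussian limits are stable under approximation in mean square: it suffices to find, for each
`δ > 0`, variables within `δ` of the given ones that are asymptotically Gaussian. -/
theorem tendsto_charFun_of_approx {Z : ℕ → Ω → ℝ} {s₀ : ℝ} (hZ : ∀ N, MemLp (Z N) 2 P)
    (hs : Tendsto (fun N => ∫ ω, Z N ω ^ 2 ∂P) atTop (𝓝 s₀)) (t : ℝ)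
    (happ : ∀ δ > 0, ∃ W : ℕ → Ω → ℝ, (∀ N, MemLp (W N) 2 P) ∧
      (∀ᶠ N in atTop, ∫ ω, (Z N ω - W N ω) ^ 2 ∂P ≤ δ ^ 2) ∧
      Tendsto (fun N => ∫ ω, Complex.exp (Complex.I * (t * W N ω : ℝ)) ∂P -
        Complex.exp ((-(t ^ 2 * (∫ ω, W N ω ^ 2 ∂P) / 2) : ℝ) : ℂ)) atTop (𝓝 0)) :
    Tendsto (fun N => ∫ ω, Complex.exp (Complex.I * (t * Z N ω : ℝ)) ∂P) atTop
      (𝓝 (Complex.exp ((-(t ^ 2 * s₀ / 2) : ℝ) : ℂ))) := by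
  have hlip : ∀ x y : ℝ, 0 ≤ x → 0 ≤ y →
      ‖Complex.exp ((-(t ^ 2 * x / 2) : ℝ) : ℂ) - Complex.exp ((-(t ^ 2 * y / 2) : ℝ) : ℂ)‖ ≤
        t ^ 2 * |x - y| := by
    intro x y hx hy
    rw [← Complex.ofReal_exp, ← Complex.ofReal_exp, ← Complex.ofReal_sub, Complex.norm_real,
      Real.norm_eq_abs]
    refine (abs_exp_neg_sub_exp_neg_le (by positivity) (by positivity)).trans ?_
    rw [show t ^ 2 * x / 2 - t ^ 2 * y / 2 = t ^ 2 * ((x - y) / 2) by ring, abs_mul,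
      abs_of_nonneg (sq_nonneg t), abs_div, abs_two]
    exact mul_le_mul_of_nonneg_left (by linarith [abs_nonneg (x - y)]) (sq_nonneg t)
  have hs0 : 0 ≤ s₀ := ge_of_tendsto' hs fun N => integral_nonneg fun ω => sq_nonneg _
  have hc : Continuous fun x : ℝ => Complex.exp ((-(t ^ 2 * x / 2) : ℝ) : ℂ) := by fun_prop
  have hlim := (hc.tendsto s₀).comp hs
  rw [Metric.tendsto_atTop]
  intro ε hε
  -- The distance to the approximating sequence contributes at most `δ * κ`.
  set κ : ℝ := |t| + t ^ 2 * (s₀ + 1 + 1 + 1) + 1 with hκ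
  have hκ0 : 0 < κ := by positivity
  set δ : ℝ := min 1 (ε / 3 / κ) with hδ
  have hδ0 : 0 < δ := lt_min one_pos (by positivity)
  have hδκ : δ * κ ≤ ε / 3 := (le_div_iff₀ hκ0).1 (min_le_right _ _)
  have hδ1 : δ ≤ 1 := min_le_left _ _
  obtain ⟨W, hW, hZW, hWt⟩ := happ δ hδ0
  obtain ⟨N₀, hN₀⟩ := eventually_atTop.1 (((Metric.tendsto_nhds.1 hlim (ε / 3) (by positivity)).and
    (Metric.tendsto_nhds.1 hWt (ε / 3) (by positivity))).and
    (hZW.and (hs.eventually (gt_mem_nhds (lt_add_one s₀)))))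
  refine ⟨N₀, fun N hN => ?_⟩
  obtain ⟨⟨e1, e2⟩, e3, e4⟩ := hN₀ N hN
  have e5 := norm_charFun_sub_charFun_le (hZ N) (hW N) hδ0 e3 t
  have e6 := abs_integral_sq_sub_le (hZ N) (hW N) hδ0 e3
  have e7 := hlip (∫ ω, W N ω ^ 2 ∂P) (∫ ω, Z N ω ^ 2 ∂P) (integral_nonneg fun ω => sq_nonneg _)
    (integral_nonneg fun ω => sq_nonneg _)
  rw [abs_sub_comm] at e7
  have e8 : t ^ 2 * |∫ ω, Z N ω ^ 2 ∂P - ∫ ω, W N ω ^ 2 ∂P| ≤ t ^ 2 * (δ * (s₀ + 1 + 1 + 1)) :=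
    mul_le_mul_of_nonneg_left (e6.trans (mul_le_mul_of_nonneg_left (by linarith) hδ0.le))
      (sq_nonneg t)
  rw [dist_zero_right] at e2
  rw [← dist_eq_norm] at e2 e5 e7
  have e9 := dist_triangle4 (∫ ω, Complex.exp (Complex.I * (t * Z N ω : ℝ)) ∂P)
    (∫ ω, Complex.exp (Complex.I * (t * W N ω : ℝ)) ∂P)
    (Complex.exp ((-(t ^ 2 * (∫ ω, W N ω ^ 2 ∂P) / 2) : ℝ) : ℂ))
    (Complex.exp ((-(t ^ 2 * (∫ ω, Z N ω ^ 2 ∂P) / 2) : ℝ) : ℂ))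
  have e10 := dist_triangle (∫ ω, Complex.exp (Complex.I * (t * Z N ω : ℝ)) ∂P)
    (Complex.exp ((-(t ^ 2 * (∫ ω, Z N ω ^ 2 ∂P) / 2) : ℝ) : ℂ))
    (Complex.exp ((-(t ^ 2 * s₀ / 2) : ℝ) : ℂ))
  simp only [Function.comp] at e1
  have e11 : δ * κ = |t| * δ + t ^ 2 * (δ * (s₀ + 1 + 1 + 1)) + δ := by rw [hκ]; ring
  linarith

end Approximation

/-! ### Weighted sums of projections on connected graphs -/

/-- For each `N` a weighted finite family of connected graphs with a bounded number of nodes, with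
nodes in `Vtx N`; the weight of a graph is bounded by the product of the numbers `t N v` over its
nodes, which are square summable over `Vtx N` and uniformly small. -/
structure IsConnectedArray (A : ℕ → Finset BipGraph) (w : ℕ → BipGraph → ℝ)
    (Vtx : ℕ → Finset (ℕ ⊕ ℕ)) (t : ℕ → ℕ ⊕ ℕ → ℝ) (ε : ℕ → ℝ) (D : ℕ) (C₀ : ℝ) : Prop where
  connected : ∀ N, ∀ F ∈ A N, F.Connected
  nodes_subset : ∀ N, ∀ F ∈ A N, F.nodes ⊆ Vtx N
  card_nodes_le : ∀ N, ∀ F ∈ A N, F.nodes.card ≤ D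
  sum_sq_le : ∀ N, ∑ v ∈ Vtx N, t N v ^ 2 ≤ 2
  nonneg : ∀ N v, 0 ≤ t N v
  le_eps : ∀ N v, t N v ≤ ε N
  tendsto_eps : Tendsto ε atTop (𝓝 0)
  const_nonneg : 0 ≤ C₀
  abs_weight_le : ∀ᶠ N in atTop, ∀ F ∈ A N, |w N F| ≤ C₀ * ∏ v ∈ F.nodes, t N v

section Array

variable {A : ℕ → Finset BipGraph} {w : ℕ → BipGraph → ℝ} {Vtx : ℕ → Finset (ℕ ⊕ ℕ)}
  {t : ℕ → ℕ ⊕ ℕ → ℝ} {ε : ℕ → ℝ} {D : ℕ} {C₀ : ℝ}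

theorem IsConnectedArray.size_le (hA : IsConnectedArray A w Vtx t ε D C₀) {N : ℕ} {F : BipGraph}
    (hF : F ∈ A N) : F.size ≤ D + D * D := by
  have h1 := hA.card_nodes_le N F hF
  rw [card_nodes] at h1
  have h2 : F.edges.card ≤ F.v₁ * F.v₂ :=
    (Finset.card_le_card F.edges_subset).trans (Finset.card_product _ _).le
  have h3 : F.v₁ * F.v₂ ≤ D * D := Nat.mul_le_mul (by omega) (by omega)
  exact add_le_add h1 (h2.trans h3)

theorem IsConnectedArray.ne_empty (hA : IsConnectedArray A w Vtx t ε D C₀) {N : ℕ} {F : BipGraph}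
    (hF : F ∈ A N) : F ≠ BipGraph.empty := by
  rintro rfl
  obtain ⟨v, hv⟩ := (hA.connected N _ hF).nodes_nonempty
  simp [BipGraph.nodes, BipGraph.empty] at hv

theorem IsConnectedArray.sum_sq_weight_le (hA : IsConnectedArray A w Vtx t ε D C₀) :
    ∀ᶠ N in atTop, ∑ F ∈ A N, w N F ^ 2 ≤
      C₀ ^ 2 * ((2 ^ (D + D * D) : ℕ) * Real.exp 2) := by
  filter_upwards [hA.abs_weight_le] with N hN
  have h1 : ∀ F ∈ A N, w N F ^ 2 ≤ C₀ ^ 2 * ∏ v ∈ F.nodes, t N v ^ 2 := by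
    intro F hF
    rw [Finset.prod_pow, ← mul_pow, ← sq_abs]
    exact pow_le_pow_left₀ (abs_nonneg _) (hN F hF) 2
  refine (Finset.sum_le_sum h1).trans ?_
  rw [← Finset.mul_sum, ← Finset.sum_coe_sort (A N)]
  exact mul_le_mul_of_nonneg_left (sum_prod_sq_nodes_le (G := fun a : A N => a.1)
    Subtype.val_injective (hA.sum_sq_le N) (fun a => hA.nodes_subset N a.1 a.2)
    fun a => hA.card_nodes_le N a.1 a.2) (sq_nonneg _)

variable {Ω : Type*} [mΩ : MeasurableSpace Ω] {P : Measure Ω} [IsProbabilityMeasure P]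
  {Y : ℕ → ℕ → Ω → ℝ} {φ : ℝ → ℝ → ℝ → ℝ} {ξ η : ℕ → Ω → ℝ} {ζ : ℕ → ℕ → Ω → ℝ}
  {p q : ℕ} {h : (Fin p → Fin q → ℝ) → ℝ}

omit [IsProbabilityMeasure P] in
theorem IsKernel.memLp_sum_graphProj (hK : IsKernel P Y φ ξ η ζ h) (A : Finset BipGraph)
    (w : BipGraph → ℝ) : MemLp (fun ω => ∑ F ∈ A, w F * graphProj P ξ η ζ h Y F ω) 2 P :=
  memLp_finsetSum _ fun F _ => (hK.memLp_graphProj F).const_mul (w F)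

/-- For bounded projections the method of moments applies. -/
theorem IsConnectedArray.tendsto_charFun_of_bounded (hA : IsConnectedArray A w Vtx t ε D C₀)
    (hK : IsKernel P Y φ ξ η ζ h) {B : ℝ} (hB0 : 0 ≤ B)
    (hB : ∀ F : BipGraph, F.size ≤ D + D * D → ∀ᵐ ω ∂P, |graphProj P ξ η ζ h Y F ω| ≤ B) (u : ℝ) :
    Tendsto (fun N => ∫ ω, Complex.exp
        (Complex.I * (u * ∑ F ∈ A N, w N F * graphProj P ξ η ζ h Y F ω : ℝ)) ∂P -
      Complex.exp ((-(u ^ 2 * (∫ ω, (∑ F ∈ A N, w N F * graphProj P ξ η ζ h Y F ω) ^ 2 ∂P) / 2) :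
        ℝ) : ℂ)) atTop (𝓝 0) := by
  have hBA : ∀ N, ∀ F ∈ A N, ∀ᵐ ω ∂P, |graphProj P ξ η ζ h Y F ω| ≤ B :=
    fun N F hF => hB F (hA.size_le hF)
  have hsq : ∀ F : BipGraph, F.size ≤ D + D * D →
      ∫ ω, graphProj P ξ η ζ h Y F ω ^ 2 ∂P ≤ B ^ 2 := by
    intro F hF
    have := integral_mono_ae (hK.memLp_graphProj F).integrable_sq (integrable_const (B ^ 2))
      ((hB F hF).mono fun ω hω => sq_le_sq' (abs_le.1 hω).1 (abs_le.1 hω).2)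
    simpa using this
  refine tendsto_charFun_sub_of_moments (C := C₀ ^ 2 * ((2 ^ (D + D * D) : ℕ) * Real.exp 2) * B ^ 2)
    (fun N k => ?_) ?_ ?_ (fun k => ?_) u
  · refine Integrable.of_bound ((hK.memLp_sum_graphProj (A N) (w N)).1.pow k)
      ((∑ F ∈ A N, |w N F| * B) ^ k) ?_
    filter_upwards [(Finset.eventually_all (A N)).2 (hBA N)] with ω hω
    rw [norm_pow]
    refine pow_le_pow_left₀ (norm_nonneg _) ((norm_sum_le _ _).trans
      (Finset.sum_le_sum fun F hF => ?_)) k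
    rw [norm_mul]
    exact mul_le_mul_of_nonneg_left (hω F hF) (abs_nonneg _)
  · filter_upwards [hA.sum_sq_weight_le] with N hN
    refine ⟨integral_nonneg fun ω => sq_nonneg _, ?_⟩
    rw [hK.integral_sq_sum_graphProj]
    refine (Finset.sum_le_sum fun F hF =>
      mul_le_mul_of_nonneg_left (hsq F (hA.size_le hF)) (sq_nonneg _)).trans ?_
    rw [← Finset.sum_mul]
    exact mul_le_mul_of_nonneg_right hN (sq_nonneg _)
  · refine tendsto_const_nhds.congr fun N => ?_
    rw [integral_finsetSum _ fun F _ =>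
      ((hK.memLp_graphProj F).integrable one_le_two).const_mul _]
    refine (Finset.sum_eq_zero fun F hF => ?_).symm
    rw [integral_const_mul, hK.repr.integral_graphProj_eq_zero (hA.ne_empty hF), mul_zero]
  · have h1 := hA.tendsto_eps.const_mul (C₀ ^ (k + 2) * ((k + 2) * B ^ (k + 2)) *
        (((2 ^ ((k + 2) * D + (k + 2) * D * ((k + 2) * D))) ^ (k + 2) : ℕ) * Real.exp 2))
    rw [mul_zero] at h1
    refine squeeze_zero_norm' ?_ h1
    filter_upwards [hA.abs_weight_le, hA.tendsto_eps.eventually (ge_mem_nhds one_pos)] with N h2 h3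
    have h4 := abs_moment_recursion_le (G := fun a : A N => a.1) hK.repr
      hK.isDegenerateFamily_graphProj Subtype.val_injective hB0 (fun a => hBA N a.1 a.2)
      (fun a => hA.connected N a.1 a.2) (hA.sum_sq_le N) (fun a => hA.nodes_subset N a.1 a.2)
      (fun a => hA.card_nodes_le N a.1 a.2) (hA.nonneg N) (hA.le_eps N) h3
      (w := fun a => w N a.1) hA.const_nonneg (fun a => h2 a.1 a.2) k
    simp only [Finset.sum_coe_sort (A N) fun F => w N F ^ 2 * ∫ ω, graphProj P ξ η ζ h Y F ω ^ 2 ∂P,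
      fun ω => Finset.sum_coe_sort (A N) fun F => w N F * graphProj P ξ η ζ h Y F ω] at h4
    rw [hK.integral_sq_sum_graphProj, Real.norm_eq_abs]
    exact h4

theorem IsKernel.integral_sq_sum_graphProj_sub_le (hK : IsKernel P Y φ ξ η ζ h)
    {h' : (Fin p → Fin q → ℝ) → ℝ} (hK' : IsKernel P Y φ ξ η ζ h') (A : Finset BipGraph)
    (w : BipGraph → ℝ) :
    ∫ ω, (∑ F ∈ A, w F * graphProj P ξ η ζ h Y F ω -
        ∑ F ∈ A, w F * graphProj P ξ η ζ h' Y F ω) ^ 2 ∂P ≤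
      (∑ F ∈ A, w F ^ 2) * ∫ ω, kernel₀ (h - h') Y ω ^ 2 ∂P := by
  have h1 : ∀ᵐ ω ∂P, ∀ F ∈ A, graphProj P ξ η ζ (h - h') Y F ω =
      graphProj P ξ η ζ h Y F ω - graphProj P ξ η ζ h' Y F ω :=
    (Finset.eventually_all A).2 fun F _ => hK.graphProj_sub hK' F
  calc _ = ∫ ω, (∑ F ∈ A, w F * graphProj P ξ η ζ (h - h') Y F ω) ^ 2 ∂P := by
        refine integral_congr_ae (h1.mono fun ω hω => ?_)
        simp only
        rw [← Finset.sum_sub_distrib]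
        congr 1
        exact Finset.sum_congr rfl fun F hF => by rw [hω F hF, mul_sub]
    _ = ∑ F ∈ A, w F ^ 2 * ∫ ω, graphProj P ξ η ζ (h - h') Y F ω ^ 2 ∂P :=
        (hK.sub hK').integral_sq_sum_graphProj A w
    _ ≤ _ := by
        rw [Finset.sum_mul]
        exact Finset.sum_le_sum fun F _ =>
          mul_le_mul_of_nonneg_left ((hK.sub hK').integral_sq_graphProj_le F) (sq_nonneg _)

/-- Variables that are asymptotically equal in mean square to weighted sums of projections on
connected graphs are asymptotically Gaussian. -/
theorem IsConnectedArray.tendsto_charFun (hA : IsConnectedArray A w Vtx t ε D C₀)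
    (hK : IsKernel P Y φ ξ η ζ h) {Z : ℕ → Ω → ℝ} (hZ : ∀ N, MemLp (Z N) 2 P) {s₀ : ℝ}
    (hs : Tendsto (fun N => ∫ ω, Z N ω ^ 2 ∂P) atTop (𝓝 s₀))
    (hZA : Tendsto (fun N => ∫ ω, (Z N ω - ∑ F ∈ A N, w N F * graphProj P ξ η ζ h Y F ω) ^ 2 ∂P)
      atTop (𝓝 0)) (u : ℝ) :
    Tendsto (fun N => ∫ ω, Complex.exp (Complex.I * (u * Z N ω : ℝ)) ∂P) atTop
      (𝓝 (Complex.exp ((-(u ^ 2 * s₀ / 2) : ℝ) : ℂ))) := by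
  refine tendsto_charFun_of_approx hZ hs u fun δ hδ => ?_
  have hlim := hK.tendsto_integral_sq_sub_truncate.const_mul
    (C₀ ^ 2 * ((2 ^ (D + D * D) : ℕ) * Real.exp 2))
  rw [mul_zero] at hlim
  obtain ⟨M, hM⟩ := (hlim.eventually (gt_mem_nhds (show (0 : ℝ) < δ ^ 2 / 4 by positivity))).exists
  have hKM := hK.truncate (M.cast_nonneg (α := ℝ))
  refine ⟨fun N ω => ∑ F ∈ A N, w N F * graphProj P ξ η ζ (truncate M h) Y F ω,
    fun N => hKM.memLp_sum_graphProj _ _, ?_,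
    hA.tendsto_charFun_of_bounded hKM (B := M * (1 + 2 ^ (D + D * D)) ^ (D + D * D))
      (by positivity) (fun F hF => abs_graphProj_truncate_le M.cast_nonneg hF) u⟩
  filter_upwards [hA.sum_sq_weight_le,
    hZA.eventually (gt_mem_nhds (show (0 : ℝ) < δ ^ 2 / 4 by positivity))] with N h1 h2
  have h3 := hK.integral_sq_sum_graphProj_sub_le hKM (A N) (w N)
  have h4 := h3.trans (mul_le_mul_of_nonneg_right h1 (integral_nonneg fun ω => sq_nonneg _))
  set W : Ω → ℝ := fun ω => ∑ F ∈ A N, w N F * graphProj P ξ η ζ h Y F ω with hW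
  set W' : Ω → ℝ := fun ω => ∑ F ∈ A N, w N F * graphProj P ξ η ζ (truncate M h) Y F ω with hW'
  have hWL : MemLp W 2 P := hK.memLp_sum_graphProj _ _
  have hWL' : MemLp W' 2 P := hKM.memLp_sum_graphProj _ _
  have i1 : Integrable (fun ω => (Z N ω - W ω) ^ 2) P := ((hZ N).sub hWL).integrable_sq
  have i2 : Integrable (fun ω => (W ω - W' ω) ^ 2) P := (hWL.sub hWL').integrable_sq
  calc ∫ ω, (Z N ω - W' ω) ^ 2 ∂P ≤ ∫ ω, 2 * (Z N ω - W ω) ^ 2 + 2 * (W ω - W' ω) ^ 2 ∂P :=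
        integral_mono ((hZ N).sub hWL').integrable_sq ((i1.const_mul 2).add (i2.const_mul 2))
          fun ω => by
            have := sq_nonneg ((Z N ω - W ω) - (W ω - W' ω))
            simp only
            linarith
    _ = 2 * ∫ ω, (Z N ω - W ω) ^ 2 ∂P + 2 * ∫ ω, (W ω - W' ω) ^ 2 ∂P := by
        rw [integral_add (i1.const_mul 2) (i2.const_mul 2), integral_const_mul, integral_const_mul]
    _ ≤ δ ^ 2 := by
        have h5 : ∫ ω, (W ω - W' ω) ^ 2 ∂P < δ ^ 2 / 4 := h4.trans_lt hM
        linarith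

end Array

/-! ### The principal part of the U-statistic -/

section Principal

variable {m n : ℕ → ℕ} {γ : ℕ → ℝ}

theorem tendsto_pow_div_descFactorial (hm : Tendsto m atTop atTop) (r : ℕ) :
    Tendsto (fun N => (m N : ℝ) ^ r / (m N).descFactorial r) atTop (𝓝 1) := by
  have h1 : Tendsto (fun k : ℕ => (k.descFactorial r : ℝ) / (k : ℝ) ^ r) atTop (𝓝 1) := by
    refine (isEquivalent_iff_tendsto_one ?_).1 (isEquivalent_descFactorial r)
    filter_upwards [eventually_gt_atTop 0] with k hk
    exact pow_ne_zero _ (Nat.cast_ne_zero.2 hk.ne')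
  have h2 := (h1.comp hm).inv₀ one_ne_zero
  simpa using h2

/-- The normalization may be replaced by its positive part, and powers by descending factorials. -/
theorem tendsto_sq_sqrt_div_descFactorial (hm : Tendsto m atTop atTop) (hn : Tendsto n atTop atTop)
    {r c : ℕ} {a : ℝ} (ha : 0 < a)
    (hγ : Tendsto (fun N => γ N * (((m N : ℝ) ^ r)⁻¹ * ((n N : ℝ) ^ c)⁻¹)) atTop (𝓝 a)) :
    Tendsto (fun N => √(γ N) ^ 2 / (((m N).descFactorial r : ℝ) * (n N).descFactorial c)) atTop
      (𝓝 a) := by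
  have h1 : Tendsto (fun N => √(γ N) ^ 2 * (((m N : ℝ) ^ r)⁻¹ * ((n N : ℝ) ^ c)⁻¹)) atTop
      (𝓝 a) := by
    refine hγ.congr' ?_
    filter_upwards [hγ.eventually (lt_mem_nhds ha)] with N hN
    have h0 : 0 ≤ ((m N : ℝ) ^ r)⁻¹ * ((n N : ℝ) ^ c)⁻¹ := by positivity
    rw [Real.sq_sqrt (pos_of_mul_pos_left hN h0).le]
  have h2 := (h1.mul (tendsto_pow_div_descFactorial hm r)).mul (tendsto_pow_div_descFactorial hn c)
  rw [mul_one, mul_one] at h2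
  refine h2.congr' ?_
  filter_upwards [hm.eventually_gt_atTop 0, hn.eventually_gt_atTop 0] with N hN hN'
  have e1 : (m N : ℝ) ≠ 0 := Nat.cast_ne_zero.2 hN.ne'
  have e2 : (n N : ℝ) ≠ 0 := Nat.cast_ne_zero.2 hN'.ne'
  field_simp

/-- The normalized coefficients of the graphs with `r` rows and `c` columns are of the order
`m ^ (-r / 2) * n ^ (-c / 2)`. -/
theorem exists_abs_sqrt_mul_hoeffdingCoeff_le (hm : Tendsto m atTop atTop)
    (hn : Tendsto n atTop atTop) (p q : ℕ) {r c : ℕ} {a : ℝ} (ha : 0 < a)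
    (hγ : Tendsto (fun N => γ N * (((m N : ℝ) ^ r)⁻¹ * ((n N : ℝ) ^ c)⁻¹)) atTop (𝓝 a)) :
    ∃ C, 0 ≤ C ∧ ∀ᶠ N in atTop, |√(γ N) * hoeffdingCoeff p q (m N) (n N) r c| ≤
      C * ((√(m N))⁻¹ ^ r * (√(n N))⁻¹ ^ c) := by
  set b : ℝ := (p.descFactorial r : ℝ) * q.descFactorial c with hb
  have h1 := ((((tendsto_sq_sqrt_div_descFactorial hm hn ha hγ).mul
    (tendsto_pow_div_descFactorial hm r)).mul (tendsto_pow_div_descFactorial hn c)).const_mul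
      (b ^ 2))
  rw [mul_one, mul_one] at h1
  refine ⟨√(b ^ 2 * a + 1), Real.sqrt_nonneg _, ?_⟩
  filter_upwards [h1.eventually (ge_mem_nhds (lt_add_one _)), hm.eventually_gt_atTop 0,
    hn.eventually_gt_atTop 0] with N hN hN' hN''
  have e1 : (0 : ℝ) < m N := Nat.cast_pos.2 hN'
  have e2 : (0 : ℝ) < n N := Nat.cast_pos.2 hN''
  have e3 : 0 < √(m N : ℝ) := Real.sqrt_pos.2 e1
  have e4 : 0 < √(n N : ℝ) := Real.sqrt_pos.2 e2
  refine abs_le_of_sq_le_sq ?_ (by positivity)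
  have s1 : (√(m N : ℝ) ^ r) ^ 2 = (m N : ℝ) ^ r := by
    rw [← pow_mul, mul_comm, pow_mul, Real.sq_sqrt e1.le]
  have s2 : (√(n N : ℝ) ^ c) ^ 2 = (n N : ℝ) ^ c := by
    rw [← pow_mul, mul_comm, pow_mul, Real.sq_sqrt e2.le]
  have e5 : 0 < (m N : ℝ) ^ r := by positivity
  have e6 : 0 < (n N : ℝ) ^ c := by positivity
  rw [mul_pow (√(b ^ 2 * a + 1)), Real.sq_sqrt (by positivity), mul_pow ((√(m N : ℝ))⁻¹ ^ r),
    inv_pow, inv_pow, inv_pow, inv_pow, s1, s2, ← mul_inv, ← div_eq_mul_inv,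
    le_div_iff₀ (by positivity)]
  refine le_trans (le_of_eq ?_) hN
  rw [hoeffdingCoeff, ← hb]
  ring

variable {Ω : Type*} [mΩ : MeasurableSpace Ω] {P : Measure Ω} [IsProbabilityMeasure P]
  {Y : ℕ → ℕ → Ω → ℝ} {φ : ℝ → ℝ → ℝ → ℝ} {ξ η : ℕ → Ω → ℝ} {ζ : ℕ → ℕ → Ω → ℝ}
  {p q : ℕ} {h : (Fin p → Fin q → ℝ) → ℝ} {S : Finset (ℕ × ℕ)} {α : ℕ × ℕ → ℝ}

open Classical in
/-- The connected graphs in `K_{[m],[n]}` whose numbers of nodes form a principal degree. -/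
def principalCopies (p q : ℕ) (S : Finset (ℕ × ℕ)) (m n : ℕ) : Finset BipGraph :=
  (copies p q m n).filter fun F => (F.v₁, F.v₂) ∈ S ∧ F.Connected

theorem isConnectedArray_principalCopies (p q : ℕ) (hm : Tendsto m atTop atTop)
    (hn : Tendsto n atTop atTop) (hα : ∀ s ∈ S, 0 < α s)
    (hγ : ∀ s ∈ S, Tendsto (fun N => γ N * (((m N : ℝ) ^ s.1)⁻¹ * ((n N : ℝ) ^ s.2)⁻¹)) atTop
      (𝓝 (α s))) :
    ∃ Vtx t ε C₀, IsConnectedArray (fun N => principalCopies p q S (m N) (n N))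
      (fun N F => √(γ N) * hoeffdingCoeff p q (m N) (n N) F.v₁ F.v₂) Vtx t ε (p + q) C₀ := by
  classical
  have key : ∀ s ∈ S, ∃ C, 0 ≤ C ∧ ∀ᶠ N in atTop,
      |√(γ N) * hoeffdingCoeff p q (m N) (n N) s.1 s.2| ≤
        C * ((√(m N))⁻¹ ^ s.1 * (√(n N))⁻¹ ^ s.2) := fun s hs =>
    exists_abs_sqrt_mul_hoeffdingCoeff_le hm hn p q (hα s hs) (hγ s hs)
  choose! C hC0 hC using key
  have hmem : ∀ {N F}, F ∈ principalCopies p q S (m N) (n N) →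
      F ≤ K (Finset.range (m N)) (Finset.range (n N)) ∧ (F.v₁ ≤ p ∧ F.v₂ ≤ q) ∧
        (F.v₁, F.v₂) ∈ S ∧ F.Connected := by
    intro N F hF
    obtain ⟨h1, h2⟩ := Finset.mem_filter.1 hF
    obtain ⟨h3, h4⟩ := Finset.mem_filter.1 h1
    exact ⟨mem_subgraphs.1 h3, h4, h2⟩
  have hinv : ∀ {k : ℕ → ℕ}, Tendsto k atTop atTop →
      Tendsto (fun N => (√(k N : ℝ))⁻¹) atTop (𝓝 0) := fun hk =>
    tendsto_inv_atTop_zero.comp (Real.tendsto_sqrt_atTop.comp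
      (tendsto_natCast_atTop_atTop.comp hk))
  have hsum : ∀ k : ℕ, ∑ _i ∈ Finset.range k, (√(k : ℝ))⁻¹ ^ 2 ≤ 1 := by
    intro k
    rw [Finset.sum_const, Finset.card_range, nsmul_eq_mul, inv_pow, Real.sq_sqrt k.cast_nonneg]
    exact mul_inv_le_one
  refine ⟨fun N => (Finset.range (m N)).disjSum (Finset.range (n N)),
    fun N => Sum.elim (fun _ => (√(m N : ℝ))⁻¹) (fun _ => (√(n N : ℝ))⁻¹),
    fun N => max (√(m N : ℝ))⁻¹ (√(n N : ℝ))⁻¹, ∑ s ∈ S, C s,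
    ⟨fun N F hF => (hmem hF).2.2.2, fun N F hF => ?_, fun N F hF => ?_, fun N => ?_, fun N v => ?_,
      fun N v => ?_, ?_, Finset.sum_nonneg hC0, ?_⟩⟩
  · exact Finset.disjSum_mono (hmem hF).1.1 (hmem hF).1.2.1
  · rw [card_nodes]
    exact add_le_add (hmem hF).2.1.1 (hmem hF).2.1.2
  · rw [Finset.sum_disjSum]
    simp only [Sum.elim_inl, Sum.elim_inr]
    linarith [hsum (m N), hsum (n N)]
  · rcases v with v | v <;> simp
  · rcases v with v | v <;> simp
  · simpa using (hinv hm).max (hinv hn)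
  · filter_upwards [(Finset.eventually_all S).2 hC] with N hN F hF
    have hFS := (hmem hF).2.2.1
    refine (hN _ hFS).trans ?_
    rw [BipGraph.nodes, Finset.prod_disjSum]
    simp only [Sum.elim_inl, Sum.elim_inr, Finset.prod_const]
    exact mul_le_mul_of_nonneg_right (Finset.single_le_sum (f := C) hC0 hFS) (by positivity)

/-- If the principal support graphs are connected, the connected graphs carry the whole variance of
the principal degrees. -/
theorem IsKernel.sum_principalCopies (hK : IsKernel P Y φ ξ η ζ h)
    (hS : ∀ s ∈ S, s ≠ (0, 0) ∧ s.1 ≤ p ∧ s.2 ≤ q)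
    (hconn : ∀ G, IsPrincipalSupportGraph P ξ η ζ h Y S G → G.Connected) {m n : ℕ} (hm : p ≤ m)
    (hn : q ≤ n) :
    ∑ F ∈ principalCopies p q S m n, hoeffdingCoeff p q m n F.v₁ F.v₂ ^ 2 *
        ∫ ω, graphProj P ξ η ζ h Y F ω ^ 2 ∂P =
      ∑ s ∈ S, V P ξ η ζ h Y s.1 s.2 / ((m.descFactorial s.1 : ℝ) * n.descFactorial s.2) := by
  classical
  have h0 : ∀ F : BipGraph, (F.v₁, F.v₂) ∈ S → ¬ F.Connected →
      ∫ ω, graphProj P ξ η ζ h Y F ω ^ 2 ∂P = 0 := by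
    intro F hF hc
    have h1 : graphProj P ξ η ζ h Y F =ᵐ[P] 0 := by
      rcases graphProj_eq_proj_or_zero (P := P) (ξ := ξ) (η := η) (ζ := ζ) (h := h) (Y := Y) F with
        ⟨I, J, hI, hJ, hle, hG⟩ | hG
      · by_contra hne
        rw [hG] at hne
        exact hc (hconn F ⟨hF, I, J, hI, hJ, hle, hne⟩)
      · rw [hG]
    rw [integral_congr_ae (g := fun _ => (0 : ℝ)) (h1.mono fun ω hω => by simp [hω]),
      integral_zero]
  calc _ = ∑ F ∈ (copies p q m n).filter (fun F => (F.v₁, F.v₂) ∈ S),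
        hoeffdingCoeff p q m n F.v₁ F.v₂ ^ 2 * ∫ ω, graphProj P ξ η ζ h Y F ω ^ 2 ∂P := by
        refine Finset.sum_subset (fun F hF => ?_) fun F hF hF' => ?_
        · obtain ⟨h1, h2⟩ := Finset.mem_filter.1 hF
          exact Finset.mem_filter.2 ⟨h1, h2.1⟩
        · obtain ⟨h1, h2⟩ := Finset.mem_filter.1 hF
          rw [h0 F h2 fun hc => hF' (Finset.mem_filter.2 ⟨h1, h2, hc⟩), mul_zero]
    _ = ∑ s ∈ S, ∑ F ∈ (copies p q m n).filter (fun F => F.v₁ = s.1 ∧ F.v₂ = s.2),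
        hoeffdingCoeff p q m n F.v₁ F.v₂ ^ 2 * ∫ ω, graphProj P ξ η ζ h Y F ω ^ 2 ∂P := by
        rw [← Finset.sum_fiberwise_of_maps_to (t := S) (g := fun F : BipGraph => (F.v₁, F.v₂))
          fun F hF => (Finset.mem_filter.1 hF).2]
        refine Finset.sum_congr rfl fun s hs => Finset.sum_congr ?_ fun _ _ => rfl
        ext F
        simp only [Finset.mem_filter, Prod.ext_iff]
        exact ⟨fun h => ⟨h.1.1, h.2⟩, fun h => ⟨⟨h.1, by rwa [h.2.1, h.2.2]⟩, h.2⟩⟩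
    _ = _ := Finset.sum_congr rfl fun s hs => hK.sum_sq_degree (hS s hs).2.1 (hS s hs).2.2 hm hn

omit [IsProbabilityMeasure P] in
theorem IsKernel.memLp_UStat (hK : IsKernel P Y φ ξ η ζ h) (m n : ℕ) : MemLp (UStat h Y m n) 2 P :=
  (memLp_finsetSum _ fun _ _ => memLp_finsetSum _ fun _ _ => hK.memLp_kernelAt _ _).const_mul _

/-- The distance in mean square between the normalized U-statistic and its principal part is the
variance carried by the remaining graphs. -/
theorem IsKernel.integral_sq_sub_principal (hK : IsKernel P Y φ ξ η ζ h)
    (hS : ∀ s ∈ S, s ≠ (0, 0)) {m n : ℕ} (hm : p ≤ m) (hn : q ≤ n) (g : ℝ) :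
    ∫ ω, (g * (UStat h Y m n ω - ∫ ω', kernel₀ h Y ω' ∂P) - ∑ F ∈ principalCopies p q S m n,
        g * hoeffdingCoeff p q m n F.v₁ F.v₂ * graphProj P ξ η ζ h Y F ω) ^ 2 ∂P =
      g ^ 2 * Var[UStat h Y m n; P] - g ^ 2 * ∑ F ∈ principalCopies p q S m n,
        hoeffdingCoeff p q m n F.v₁ F.v₂ ^ 2 * ∫ ω, graphProj P ξ η ζ h Y F ω ^ 2 ∂P := by
  classical
  have hsub : principalCopies p q S m n ⊆ (copies p q m n).erase BipGraph.empty := by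
    intro F hF
    obtain ⟨h1, h2⟩ := Finset.mem_filter.1 hF
    refine Finset.mem_erase.2 ⟨?_, h1⟩
    rintro rfl
    exact hS _ h2.1 rfl
  rw [hK.variance_UStat hm hn, ← Finset.sum_sdiff hsub, mul_add, add_sub_cancel_right]
  have h1 := hK.integral_sq_sum_graphProj
    ((copies p q m n).erase BipGraph.empty \ principalCopies p q S m n)
    fun F => g * hoeffdingCoeff p q m n F.v₁ F.v₂
  calc _ = ∫ ω, (∑ F ∈ (copies p q m n).erase BipGraph.empty \ principalCopies p q S m n,
        g * hoeffdingCoeff p q m n F.v₁ F.v₂ * graphProj P ξ η ζ h Y F ω) ^ 2 ∂P := by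
        refine integral_congr_ae ((hK.UStat_sub_ae_eq_sum hm hn).mono fun ω hω => ?_)
        simp only at hω ⊢
        rw [hω, ← Finset.sum_sdiff hsub, mul_add, Finset.mul_sum, Finset.mul_sum]
        simp only [← mul_assoc]
        rw [add_sub_cancel_right]
    _ = _ := by
        rw [h1, Finset.mul_sum]
        exact Finset.sum_congr rfl fun F _ => by ring

theorem IsKernel.tendsto_charFun_UStat (hK : IsKernel P Y φ ξ η ζ h)
    (hm : Tendsto m atTop atTop) (hn : Tendsto n atTop atTop)
    (hS : IsPrincipalDegrees P ξ η ζ h Y m n S) (hγ : IsNormalization P ξ η ζ h Y m n S γ α)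
    (hconn : ∀ G, IsPrincipalSupportGraph P ξ η ζ h Y S G → G.Connected) (u : ℝ) :
    Tendsto (fun N => ∫ ω, Complex.exp (Complex.I *
        (u * (√(γ N) * (UStat h Y (m N) (n N) ω - ∫ ω', kernel₀ h Y ω' ∂P)) : ℝ)) ∂P) atTop
      (𝓝 (Complex.exp ((-(u ^ 2 * (∑ s ∈ S, α s * V P ξ η ζ h Y s.1 s.2) / 2) : ℝ) : ℂ))) := by
  set v : ℝ := ∑ s ∈ S, α s * V P ξ η ζ h Y s.1 s.2 with hv
  have hlarge : ∀ᶠ N in atTop, p ≤ m N ∧ q ≤ n N :=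
    (hm.eventually_ge_atTop p).and (hn.eventually_ge_atTop q)
  have hcoeff : ∀ s ∈ S, Tendsto (fun N => √(γ N) ^ 2 /
      (((m N).descFactorial s.1 : ℝ) * (n N).descFactorial s.2)) atTop (𝓝 (α s)) := fun s hs =>
    tendsto_sq_sqrt_div_descFactorial hm hn (hγ.pos s hs) (hγ.tendsto_coeff s hs)
  have hprinc : Tendsto (fun N => √(γ N) ^ 2 * ∑ F ∈ principalCopies p q S (m N) (n N),
      hoeffdingCoeff p q (m N) (n N) F.v₁ F.v₂ ^ 2 * ∫ ω, graphProj P ξ η ζ h Y F ω ^ 2 ∂P) atTop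
      (𝓝 v) := by
    refine (tendsto_finsetSum S fun s hs => (hcoeff s hs).mul_const
      (V P ξ η ζ h Y s.1 s.2)).congr' ?_
    filter_upwards [hlarge] with N hN
    rw [hK.sum_principalCopies hS.range hconn hN.1 hN.2, Finset.mul_sum]
    exact Finset.sum_congr rfl fun s _ => by ring
  have hv0 : 0 ≤ v := ge_of_tendsto' hprinc fun N => mul_nonneg (sq_nonneg _)
    (Finset.sum_nonneg fun F _ => mul_nonneg (sq_nonneg _) (integral_nonneg fun ω => sq_nonneg _))
  -- As the limit is nonnegative, `γ` may be replaced by its positive part `√γ ^ 2`.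
  have hvar : Tendsto (fun N => √(γ N) ^ 2 * Var[UStat h Y (m N) (n N); P]) atTop (𝓝 v) := by
    have h1 := hγ.tendsto_variance.max (tendsto_const_nhds (x := (0 : ℝ)))
    rw [max_eq_left hv0] at h1
    refine h1.congr fun N => ?_
    rw [Real.sq_sqrt', max_mul_of_nonneg _ _ (variance_nonneg _ _), zero_mul]
  obtain ⟨Vtx, t, ε, C₀, hA⟩ :=
    isConnectedArray_principalCopies p q hm hn hγ.pos hγ.tendsto_coeff
  refine hA.tendsto_charFun hK (fun N => ((hK.memLp_UStat (m N) (n N)).sub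
    (memLp_const (∫ ω', kernel₀ h Y ω' ∂P))).const_mul (√(γ N))) ?_ ?_ u
  · refine hvar.congr' ?_
    filter_upwards [hlarge] with N hN
    -- Without principal degrees the principal part is zero.
    have h1 := hK.integral_sq_sub_principal (S := ∅) (by simp) hN.1 hN.2 (√(γ N))
    simpa [principalCopies] using h1.symm
  · have h1 := hvar.sub hprinc
    rw [sub_self] at h1
    refine h1.congr' ?_
    filter_upwards [hlarge] with N hN
    exact (hK.integral_sq_sub_principal (fun s hs => (hS.range s hs).1) hN.1 hN.2 (√(γ N))).symm

end Principal

theorem V_nonneg {Ω : Type*} [MeasurableSpace Ω] {P : Measure Ω} {ξ η : ℕ → Ω → ℝ}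
    {ζ : ℕ → ℕ → Ω → ℝ} {p q : ℕ} {h : (Fin p → Fin q → ℝ) → ℝ} {Y : ℕ → ℕ → Ω → ℝ} (r c : ℕ) :
    0 ≤ V P ξ η ζ h Y r c :=
  mul_nonneg (by positivity) (Finset.sum_nonneg fun _ _ =>
    mul_nonneg (by positivity) (integral_nonneg fun _ => sq_nonneg _))

end RCE

end

theorem mainTheorem5 {Ω : Type*} [MeasurableSpace Ω] (P : Measure Ω) [IsProbabilityMeasure P]
    (Y : ℕ → ℕ → Ω → ℝ) (φ : ℝ → ℝ → ℝ → ℝ) (ξ η : ℕ → Ω → ℝ) (ζ : ℕ → ℕ → Ω → ℝ)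
    (hY : RCE.IsAHKRepresentation P Y φ ξ η ζ)
    (p q : ℕ) (h : (Fin p → Fin q → ℝ) → ℝ) (hmeas : Measurable h)
    (hsymm : ∀ (σ : Equiv.Perm (Fin p)) (τ : Equiv.Perm (Fin q)) (A : Fin p → Fin q → ℝ),
      h (fun a b => A (σ a) (τ b)) = h A)
    (hL2 : MemLp (RCE.kernel₀ h Y) 2 P)
    (m n : ℕ → ℕ) (hm : Tendsto m atTop atTop) (hn : Tendsto n atTop atTop)
    (S : Finset (ℕ × ℕ)) (hS : RCE.IsPrincipalDegrees P ξ η ζ h Y m n S)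
    (γ : ℕ → ℝ) (α : ℕ × ℕ → ℝ) (hγ : RCE.IsNormalization P ξ η ζ h Y m n S γ α)
    (hconn : ∀ G, RCE.IsPrincipalSupportGraph P ξ η ζ h Y S G → G.Connected) :
    TendstoInDistribution
      (fun N ω => √(γ N) * (RCE.UStat h Y (m N) (n N) ω - ∫ ω', RCE.kernel₀ h Y ω' ∂P))
      atTop (id : ℝ → ℝ) (fun _ => P)
      (gaussianReal 0 (∑ s ∈ S, α s * RCE.V P ξ η ζ h Y s.1 s.2).toNNReal) := by
  have hK : RCE.IsKernel P Y φ ξ η ζ h := ⟨hY, hmeas, hsymm, hL2⟩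
  have haem : ∀ N, AEMeasurable
      (fun ω => √(γ N) * (RCE.UStat h Y (m N) (n N) ω - ∫ ω', RCE.kernel₀ h Y ω' ∂P)) P := fun N =>
    ((hK.memLp_UStat (m N) (n N)).1.aemeasurable.sub_const _).const_mul _
  refine ⟨haem, aemeasurable_id, ProbabilityMeasure.tendsto_iff_tendsto_charFun.2 fun u => ?_⟩
  have hv0 : 0 ≤ ∑ s ∈ S, α s * RCE.V P ξ η ζ h Y s.1 s.2 := Finset.sum_nonneg fun s hs =>
    mul_nonneg (hγ.pos s hs).le (RCE.V_nonneg _ _)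
  have h1 := hK.tendsto_charFun_UStat hm hn hS hγ hconn u
  have h2 : charFun
      ((gaussianReal 0 (∑ s ∈ S, α s * RCE.V P ξ η ζ h Y s.1 s.2).toNNReal).map id) u =
      Complex.exp ((-(u ^ 2 * (∑ s ∈ S, α s * RCE.V P ξ η ζ h Y s.1 s.2) / 2) : ℝ) : ℂ) := by
    rw [Measure.map_id, charFun_gaussianReal, Real.coe_toNNReal _ hv0]
    congr 1
    push_cast
    ring
  refine (h2 ▸ h1).congr fun N => ?_
  simp only [ProbabilityMeasure.coe_mk]
  rw [charFun_apply_real, integral_map (haem N) (by fun_prop)]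
  refine integral_congr_ae (Eventually.of_forall fun ω => ?_)
  simp only
  congr 1
  push_cast
  ring
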